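/- **Setting.** Let $\Theta\subset\mathbb R^m$ be compact and convex with nonempty interior, and let $\{f_\theta:\theta\in\Theta\}$ be an identifiable family of everywhere positive probability densities on $\mathbb R$, such that $\theta\mapsto f_\theta(x)$ is three times continuously differentiable on $\Theta$ for every $x$. Put $u_\theta=\nabla_\theta\log f_\theta$, with components $u_{\theta,i}$, let $\dot u_\theta=(u_{\theta,i,j})$ with $u_{\theta,i,j}=\partial_{\theta_i}u_{\theta,j}$, and $u_{\theta,i,j,l}=\partial_{\theta_i}u_{\theta,j,l}$; $E_\theta$ is expectation for $X\sim f_\theta$. Assume: the Fisher information $I(\theta)=-E_\theta[\dot u_\theta(X)]$ is finite, positive definite and continuous on $\Theta$; the $L_2(\mathbb R)$ norms of $u_\theta f_\theta^{1/2}$, $\dot u_\theta f_\theta^{1/2}$, $u_\theta u_\theta^Tf_\theta^{1/2}$ are finite and continuous in $\theta$; $E_\theta\prod_i|u_{\theta,i}(X)|^{k_i}$ is finite and continuous in $\theta$ whenever $k_1+\dots+k_m\le 6$; $E_\theta[u_{\theta,i,j}(X)^2]$ and $E_\theta[u_{\theta,i,j,l}(X)^2]$ are finite; and for some $p_0\in(1,2)$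 and $q_0$ with $1/p_0+1/q_0=1$, the expectations $E_\theta\|u_\theta f_\theta^{1/2-1/q_0}\|_1^{q_0}$, $E_\theta\|u_\theta u_\theta^Tf_\theta^{1/2-1/q_0}\|_1^{q_0}$, $E_\theta\|\dot u_\theta f_\theta^{1/2-1/q_0}\|_1^{q_0}$ (all functions evaluated at $X$; entrywise $\ell^1$ norms) are finite and continuous in $\theta$. Let $K$ be a symmetric probability density with support in some $(-\beta,\beta)$, $c_n>0$ with $c_n\to0$, $n^{1/2}c_n^2\to0$, $n^{1/2}c_n\to\infty$, and $b_n\nearrow\infty$. For a dataset $D=(X_1,\dots,X_n)\in\mathbb R^n$ put $\bar g_n(x)=\frac1{nc_n}\sum_{i}K\big(\frac{x-X_i}{c_n}\big)1_{(|X_i|<b_n)}$, $HD^2(h,g)=\int(\sqrt h-\sqrt g)^2dx$, $L_n(\theta)=2HD^2(f_\theta,\bar g_n)$ and $\nabla L_n(\theta)=-2\int\bar g_n^{1/2}f_\theta^{1/2}u_\theta\,dx$. The MHDE $\hat\theta_n$ is any minimizer of $L_n$ over $\Theta$. Two datasets are adjacent if they differ in exactly one entry. The sensitivity $S_n$ is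 the supremum of $\|\nabla L_n(\theta;D)-\nabla L_n(\theta;D')\|_2$ over $\theta\in\Theta$ and adjacent $D,D'\in\mathbb R^n$. A mechanism is $\epsilon$-HDP if for any adjacent $D,D'$ its output laws, with densities $p_1,p_2$ (with respect to a dominating measure), satisfy $\int(\sqrt{p_1}-\sqrt{p_2})^2\le\epsilon$. Let $h_1(x)=x$, $h_{j+1}(x)=x+h_j(x)-\frac12xh_j(x)$ (and $h_0=0$), and $c_{x}=\big(-8\log(1-x/2)\big)^{-1/2}$. Private gradient descent with step size $\eta>0$, deterministic initial value $\hat\theta_n^{(0)}$, sensitivity bound $\Delta_n\ge S_n$ and level $\epsilon'\in(0,2)$ per iteration is $$\hat\theta_n^{(k+1)}=\hat\theta_n^{(k)}-\eta\big(\nabla L_n(\hat\theta_n^{(k)})+\Delta_nc_{\epsilon'}Z_k\big),\qquad Z_k\sim N(0,I_m)\ \text{i.i.d., independent of the data},$$ where, if $\hat\theta_n^{(k)}\notin\Theta$, $\nabla L_n$ is evaluated at the image of $\hat\theta_n^{(k)}$ under an arbitrary fixed Borel retraction onto $\Theta$. The output after $K_n$ steps is the PMHDE $\hat\theta_n^{(K_n)}$.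 Let $0<\epsilon<2$. **Theorem.** 1. (Privacy) For all $n$, $K_n$, $\eta>0$, $\hat\theta_n^{(0)}\in\mathbb R^m$, $\Delta_n\ge S_n$ and $\epsilon'\in(0,2)$ with $h_{K_n}(\epsilon')\le\epsilon$, the PMHDE $\hat\theta_n^{(K_n)}$ is $\epsilon$-HDP. 2. (Sensitivity order) There is $p\in(1,2)$ such that for all $K$, $(c_n)$, $(b_n)$ as above there is $A>0$ with $S_n\le A n^{-1/p}$ for all $n\ge1$. 3. (Utility) There are $\epsilon_0,\eta,c_1,c_2\in(0,\infty)$, depending only on $m$ and the family $\{f_\theta\}$, such that the following holds. Let $X_1,X_2,\dots$ be i.i.d. with a density $g$ such that $HD^2(f_\theta,g)$ has a unique minimizer $\theta_g$ over $\Theta$, $\theta_g$ is interior to $\Theta$, and $HD^2(f_{\theta_g},g)<\epsilon_0$. Suppose that for some $a_n\to\infty$: $n\sup_{t\in\mathrm{supp}K}P(|X-c_nt|>a_n)\to0$ for $X\sim f_{\theta_g}$; $\sup_{n\ge1}\sup_{|x|\le a_n}\sup_{t\in\mathrm{supp}K}f_{\theta_g}(x+tc_n)/f_{\theta_g}(x)<\infty$;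 $u_{\theta_g}$ is integrable on $[-a_n,a_n]$, and both $(n^{1/2}c_n)^{-1}\int_{-a_n}^{a_n}u_{\theta_g}\to0$ and $n^{1/2}c_n^4\int_{-a_n}^{a_n}u_{\theta_g}\to0$; and, for every component $i$, $\sup_{t\in\mathrm{supp}K}\int(u_{\theta_g,i}(x+tc_n)-u_{\theta_g,i}(x))^2f_{\theta_g}(x)dx\to0$. Then there is $r>0$ such that, for every $p\in(1,2]$, $A>0$, every $\Delta_n$ with $S_n\le\Delta_n\le An^{-1/p}$, all $K_n$ with $K_n\ge c_1\log n$ and $n^{-1/p}(K_n\log K_n)^{1/2}\to0$, all levels $\epsilon'_n\in(0,2)$ with $\epsilon/K_n\le\epsilon'_n$ and $h_{K_n}(\epsilon_n')\le\epsilon$ (for instance $\epsilon'_n=\epsilon/K_n$, or the solution of $h_{K_n}(\epsilon'_n)=\epsilon$), and every $\xi\in(0,1)$, there is $N$ such that for all $n>N$ and all $\hat\theta_n^{(0)}$ with $\|\hat\theta_n^{(0)}-\theta_g\|_2\le r$, with probability at least $1-\xi$, $$\|\hat\theta_n^{(K_n)}-\hat\theta_n\|_2\le c_2\frac{A}{\sqrt\epsilon}\,n^{-1/p}\big(K_n\log(K_n/\xi)\big)^{1/2}.$$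 In particular $\|\hat\theta_n^{(K_n)}-\hat\theta_n\|_2=O_p\big(n^{-1/p}(K_n\log K_n)^{1/2}\big)$, uniformly over these initial values. -/

import Mathlib

open MeasureTheory ProbabilityTheory Filter Topology Set
open scoped ENNReal

namespace PMHDE

noncomputable section

/-- Parameter space `ℝ^m` with the Euclidean norm. -/
abbrev E (m : ℕ) := EuclideanSpace ℝ (Fin m)

/-! ### Hellinger distance and Hellinger differential privacy -/

/-- The (squared) Hellinger divergence `∫ (√p - √q)²` between two measures, with densities taken
with respect to the dominating measure `P + Q`. The value does not depend on the dominating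
measure, see `hellingerDiv_eq`; in particular Lebesgue densities may be used when they exist. -/
def hellingerDiv {α : Type*} [MeasurableSpace α] (P Q : Measure α) : ℝ :=
  ∫ x, (√((P.rnDeriv (P + Q) x).toReal) - √((Q.rnDeriv (P + Q) x).toReal)) ^ 2 ∂(P + Q)

theorem hellingerDiv_eq {α : Type*} [MeasurableSpace α] (P Q ν : Measure α) [IsFiniteMeasure P]
    [IsFiniteMeasure Q] [SigmaFinite ν] (hP : P ≪ ν) (hQ : Q ≪ ν) :
    hellingerDiv P Q =
      ∫ x, (√((P.rnDeriv ν x).toReal) - √((Q.rnDeriv ν x).toReal)) ^ 2 ∂ν := by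
  have hPQ : P + Q ≪ ν := Measure.AbsolutelyContinuous.add_left hP hQ
  have h1 := Measure.rnDeriv_mul_rnDeriv (κ := ν) (rfl.absolutelyContinuous.add_right Q : P ≪ P + Q)
  have h2 := Measure.rnDeriv_mul_rnDeriv (κ := ν) (rfl.absolutelyContinuous.add_right' P : Q ≪ P + Q)
  unfold hellingerDiv
  rw [← integral_rnDeriv_smul hPQ]
  refine integral_congr_ae ?_
  filter_upwards [h1, h2] with x hx1 hx2
  rw [← hx1, ← hx2]
  simp only [Pi.mul_apply, ENNReal.toReal_mul, smul_eq_mul]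
  rw [Real.sqrt_mul ENNReal.toReal_nonneg, Real.sqrt_mul ENNReal.toReal_nonneg, ← sub_mul, mul_pow,
    Real.sq_sqrt ENNReal.toReal_nonneg, mul_comm]

/-- A randomized mechanism `M : dataset → noise → output`, the noise having law `ν`, satisfies
`ε`-HDP: it is measurable in the noise, and on any two datasets of size `n` at Hamming distance one
the Hellinger divergence between the two output laws is at most `ε`. -/
def IsHDP {n : ℕ} {Noise Out : Type*} [MeasurableSpace Noise] [MeasurableSpace Out]
    (ε : ℝ) (ν : Measure Noise) (M : (Fin n → ℝ) → Noise → Out) : Prop :=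
  (∀ D, Measurable (M D)) ∧
    ∀ D D' : Fin n → ℝ, hammingDist D D' = 1 → hellingerDiv (ν.map (M D)) (ν.map (M D')) ≤ ε

/-- The level after `j` compositions: `h_1(x) = x`, `h_{j+1}(x) = x + h_j(x) - x h_j(x) / 2`. -/
def hComp (x : ℝ) : ℕ → ℝ
  | 0 => 0
  | j + 1 => x + hComp x j - 1 / 2 * x * hComp x j

/-! ### Parametric families -/

/-- `∂F/∂θ_i` at `θ`, taken inside the parameter set `Θ` (one-sided at boundary points). -/
def partialDeriv {m : ℕ} (Θ : Set (E m)) (i : Fin m) (F : E m → ℝ) (θ : E m) : ℝ :=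
  fderivWithin ℝ F Θ θ (EuclideanSpace.single i 1)

/-- `u_{θ,i}(x) = ∂/∂θ_i log f_θ(x)`. -/
def score {m : ℕ} (Θ : Set (E m)) (f : E m → ℝ → ℝ) (θ : E m) (i : Fin m) (x : ℝ) : ℝ :=
  partialDeriv Θ i (fun ϑ => Real.log (f ϑ x)) θ

/-- `u_{θ,i,j}(x) = ∂/∂θ_i u_{θ,j}(x)`. -/
def score2 {m : ℕ} (Θ : Set (E m)) (f : E m → ℝ → ℝ) (θ : E m) (i j : Fin m) (x : ℝ) : ℝ :=
  partialDeriv Θ i (fun ϑ => score Θ f ϑ j x) θ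

/-- `u_{θ,i,j,l}(x) = ∂/∂θ_i u_{θ,j,l}(x)`. -/
def score3 {m : ℕ} (Θ : Set (E m)) (f : E m → ℝ → ℝ) (θ : E m) (i j l : Fin m) (x : ℝ) : ℝ :=
  partialDeriv Θ i (fun ϑ => score2 Θ f ϑ j l x) θ

/-- `E_θ[φ_θ(X)]` exists, is finite, and is continuous in `θ ∈ Θ`. -/
def FiniteContExp {m : ℕ} (Θ : Set (E m)) (f : E m → ℝ → ℝ) (φ : E m → ℝ → ℝ) : Prop :=
  (∀ θ ∈ Θ, Integrable (fun x => φ θ x * f θ x)) ∧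
    ContinuousOn (fun θ => ∫ x, φ θ x * f θ x) Θ

/-- Fisher information `I(θ) = (-E_θ[u_{θ,i,j}(X)])`. -/
def fisher {m : ℕ} (Θ : Set (E m)) (f : E m → ℝ → ℝ) (θ : E m) : Matrix (Fin m) (Fin m) ℝ :=
  fun i j => -∫ x, score2 Θ f θ i j x * f θ x

/-- A probability density on the line. -/
structure IsDensity (g : ℝ → ℝ) : Prop where
  measurable : Measurable g
  nonneg : ∀ x, 0 ≤ g x
  integral_eq_one : ∫ x, g x = 1

/-- Regularity conditions on the family `{f_θ : θ ∈ Θ}`. The exponents `p`, `q` occur only in the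
last three fields. -/
structure RegularFamily {m : ℕ} (Θ : Set (E m)) (f : E m → ℝ → ℝ) (p q : ℝ) : Prop where
  isCompact : IsCompact Θ
  convex : Convex ℝ Θ
  interior_nonempty : (interior Θ).Nonempty
  isDensity : ∀ θ ∈ Θ, IsDensity (f θ)
  pos : ∀ θ ∈ Θ, ∀ x, 0 < f θ x
  identifiable : ∀ θ₁ ∈ Θ, ∀ θ₂ ∈ Θ, θ₁ ≠ θ₂ → ¬ (f θ₁ =ᵐ[volume] f θ₂)
  contDiffOn : ∀ x, ContDiffOn ℝ 3 (fun θ => f θ x) Θ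
  fisher_posDef : ∀ θ ∈ Θ, (fisher Θ f θ).PosDef
  fisher_continuous : ContinuousOn (fisher Θ f) Θ
  /-- `‖u_θ f_θ^{1/2}‖₂`, `‖u̇_θ f_θ^{1/2}‖₂`, `‖u_θ u_θᵀ f_θ^{1/2}‖₂` exist and are continuous. -/
  l2_score : FiniteContExp Θ f fun θ x => ∑ i, score Θ f θ i x ^ 2
  l2_score2 : FiniteContExp Θ f fun θ x => ∑ i, ∑ j, score2 Θ f θ i j x ^ 2
  l2_outer : FiniteContExp Θ f fun θ x => ∑ i, ∑ j, (score Θ f θ i x * score Θ f θ j x) ^ 2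
  /-- Mixed absolute moments of the score up to total order six. -/
  moments : ∀ k : Fin m → ℕ, ∑ i, k i ≤ 6 →
    FiniteContExp Θ f fun θ x => ∏ i, |score Θ f θ i x| ^ k i
  sq_score2 : ∀ θ ∈ Θ, ∀ i j, Integrable fun x => score2 Θ f θ i j x ^ 2 * f θ x
  sq_score3 : ∀ θ ∈ Θ, ∀ i j l, Integrable fun x => score3 Θ f θ i j l x ^ 2 * f θ x
  one_lt_p : 1 < p
  p_lt_two : p < 2
  conj : 1 / p + 1 / q = 1
  /-- Moments of order `q`, with entrywise `ℓ¹` norms. -/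
  lq_score : FiniteContExp Θ f fun θ x =>
    (∑ i, |score Θ f θ i x * f θ x ^ (1 / 2 - 1 / q)|) ^ q
  lq_outer : FiniteContExp Θ f fun θ x =>
    (∑ i, ∑ j, |score Θ f θ i x * score Θ f θ j x * f θ x ^ (1 / 2 - 1 / q)|) ^ q
  lq_score2 : FiniteContExp Θ f fun θ x =>
    (∑ i, ∑ j, |score2 Θ f θ i j x * f θ x ^ (1 / 2 - 1 / q)|) ^ q

/-! ### Kernel density estimator, Hellinger loss, gradient, sensitivity -/

/-- Conditions on the kernel `κ`, the bandwidths `c_n` and the truncation points `b_n`. -/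
structure KernelDesign (κ : ℝ → ℝ) (c b : ℕ → ℝ) : Prop where
  isDensity : IsDensity κ
  symm : ∀ x, κ (-x) = κ x
  support : ∃ β > 0, Function.support κ ⊆ Ioo (-β) β
  c_pos : ∀ n, 0 < c n
  c_tendsto : Tendsto c atTop (𝓝 0)
  c_sq : Tendsto (fun n : ℕ => √n * c n ^ 2) atTop (𝓝 0)
  c_one : Tendsto (fun n : ℕ => √n * c n) atTop atTop
  b_mono : Monotone b
  b_tendsto : Tendsto b atTop atTop

/-- The truncated kernel density estimator
`ḡ_n(x) = (n c_n)⁻¹ ∑ K((x - X_i) / c_n) 1(X_i ∈ (-b_n, b_n))`. -/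
def kde (κ : ℝ → ℝ) (c b : ℕ → ℝ) {n : ℕ} (D : Fin n → ℝ) (x : ℝ) : ℝ :=
  1 / (n * c n) * ∑ i, (Ioo (-b n) (b n)).indicator (fun y => κ ((x - y) / c n)) (D i)

/-- `HD²(h, g) = ∫ (√h - √g)²`. -/
def hdSq (h g : ℝ → ℝ) : ℝ := ∫ x, (√(h x) - √(g x)) ^ 2

/-- `L_n(θ) = 2 HD²(f_θ, ḡ_n)`. -/
def loss {m : ℕ} (f : E m → ℝ → ℝ) (κ : ℝ → ℝ) (c b : ℕ → ℝ) {n : ℕ} (D : Fin n → ℝ)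
    (θ : E m) : ℝ :=
  2 * hdSq (f θ) (kde κ c b D)

/-- The Hellinger score `∇L_n(θ) = -2 ∫ ḡ_n^{1/2} f_θ^{1/2} u_θ`. -/
def gradLoss {m : ℕ} (Θ : Set (E m)) (f : E m → ℝ → ℝ) (κ : ℝ → ℝ) (c b : ℕ → ℝ) {n : ℕ}
    (D : Fin n → ℝ) (θ : E m) : E m :=
  WithLp.toLp 2 fun i => -2 * ∫ x, √(kde κ c b D x) * √(f θ x) * score Θ f θ i x

/-- Global `L₂` sensitivity of `∇L_n`: supremum over parameters and over datasets of size `n` at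
Hamming distance one. -/
def sensitivity {m : ℕ} (Θ : Set (E m)) (f : E m → ℝ → ℝ) (κ : ℝ → ℝ) (c b : ℕ → ℝ) (n : ℕ) :
    ℝ≥0∞ :=
  ⨆ (D : Fin n → ℝ) (D' : Fin n → ℝ) (_ : hammingDist D D' = 1) (θ ∈ Θ),
    edist (gradLoss Θ f κ c b D θ) (gradLoss Θ f κ c b D' θ)

/-- The minimum Hellinger distance estimators: minimizers of `L_n` over `Θ`. -/
def IsMHDE {m : ℕ} (Θ : Set (E m)) (f : E m → ℝ → ℝ) (κ : ℝ → ℝ) (c b : ℕ → ℝ) {n : ℕ}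
    (D : Fin n → ℝ) (θ : E m) : Prop :=
  θ ∈ Θ ∧ ∀ ϑ ∈ Θ, loss f κ c b D θ ≤ loss f κ c b D ϑ

/-! ### Private gradient descent -/

/-- `c_x = √(1 / (-8 log (1 - x / 2)))`. -/
def noiseScale (x : ℝ) : ℝ := √(1 / (-8 * Real.log (1 - 1 / 2 * x)))

/-- A Borel retraction onto `Θ` (for instance the metric projection). It fixes where `∇L_n` is
evaluated if an iterate has left `Θ`. -/
structure IsRetraction {m : ℕ} (Θ : Set (E m)) (π : E m → E m) : Prop where
  measurable : Measurable π
  mem : ∀ θ, π θ ∈ Θ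
  eq_self : ∀ θ ∈ Θ, π θ = θ

/-- Noisy gradient iterates `θ^{(k+1)} = θ^{(k)} - η (G(θ^{(k)}) + σ Z_k)`, `θ^{(0)} = θ₀`. -/
def noisyGD {m : ℕ} (G : E m → E m) (η σ : ℝ) (θ₀ : E m) (z : ℕ → E m) : ℕ → E m
  | 0 => θ₀
  | k + 1 => noisyGD G η σ θ₀ z k - η • (G (noisyGD G η σ θ₀ z k) + σ • z k)

/-- Output after `k` steps of private gradient descent on the dataset `D`, with step size `η`,
sensitivity bound `Δ`, privacy level `x` per step, initial value `θ₀` and noise `z`. -/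
def pgd {m : ℕ} (Θ : Set (E m)) (f : E m → ℝ → ℝ) (κ : ℝ → ℝ) (c b : ℕ → ℝ) (π : E m → E m)
    (η Δ x : ℝ) (θ₀ : E m) (k : ℕ) {n : ℕ} (D : Fin n → ℝ) (z : ℕ → E m) : E m :=
  noisyGD (fun θ => gradLoss Θ f κ c b D (π θ)) η (Δ * noiseScale x) θ₀ z k

/-- Law of the noise sequence: i.i.d. standard Gaussian vectors in `ℝ^m`. -/
def noiseLaw (m : ℕ) : Measure (ℕ → E m) := Measure.infinitePi fun _ => stdGaussian (E m)

/-- Joint law of an i.i.d. sample of size `n` with density `g` and of the independent noise. -/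
def sampleNoiseLaw (m n : ℕ) (g : ℝ → ℝ) : Measure ((Fin n → ℝ) × (ℕ → E m)) :=
  (Measure.pi fun _ : Fin n => volume.withDensity fun x => ENNReal.ofReal (g x)).prod (noiseLaw m)

/-! ### Conditions on the true density -/

/-- `θ_g` is the unique minimizer of `HD(f_θ, g)` over `Θ`, and an interior point of `Θ`. -/
structure IsTarget {m : ℕ} (Θ : Set (E m)) (f : E m → ℝ → ℝ) (g : ℝ → ℝ) (θg : E m) : Prop where
  mem_interior : θg ∈ interior Θ
  unique_min : ∀ θ ∈ Θ, θ ≠ θg → hdSq (f θg) g < hdSq (f θ) g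

/-- Tail and central-behaviour conditions on `f_{θ_g}`, for a sequence `a_n` tending to infinity.
-/
structure CentralConditions {m : ℕ} (Θ : Set (E m)) (f : E m → ℝ → ℝ) (κ : ℝ → ℝ) (c : ℕ → ℝ)
    (θg : E m) (a : ℕ → ℝ) : Prop where
  a_tendsto : Tendsto a atTop atTop
  /-- `n sup_{t ∈ supp K} P(|X - c_n t| > a_n) → 0` for `X ~ f_{θ_g}`. -/
  tail : Tendsto (fun n : ℕ => (n : ℝ≥0∞) * ⨆ t ∈ Function.support κ,
    (volume.withDensity fun x => ENNReal.ofReal (f θg x)) {x | a n < |x - c n * t|}) atTop (𝓝 0)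
  /-- `sup_n sup_{|x| ≤ a_n} sup_{t ∈ supp K} f_{θ_g}(x + t c_n) / f_{θ_g}(x) < ∞`. -/
  ratio : ∃ B : ℝ, ∀ n : ℕ, 1 ≤ n → ∀ x, |x| ≤ a n → ∀ t ∈ Function.support κ,
    f θg (x + t * c n) / f θg x ≤ B
  score_integrable : ∀ n i, IntervalIntegrable (score Θ f θg i) volume (-a n) (a n)
  central : ∀ i, Tendsto (fun n : ℕ => (√n * c n)⁻¹ * ∫ x in (-a n)..(a n), score Θ f θg i x)
    atTop (𝓝 0)
  central' : ∀ i, Tendsto (fun n : ℕ => (√n * c n ^ 4) * ∫ x in (-a n)..(a n), score Θ f θg i x)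
    atTop (𝓝 0)
  smooth : ∀ i, Tendsto (fun n : ℕ => ⨆ t ∈ Function.support κ, ∫⁻ x, ENNReal.ofReal
    ((score Θ f θg i (x + t * c n) - score Θ f θg i x) ^ 2 * f θg x)) atTop (𝓝 0)

end

end PMHDE

open PMHDE

/-! Utility. With weight γ = √ḡ_n the gradient of the loss is -2 ∫ γ √f_θ u_θ, and its derivative in
θ is -2 ∫ γ · `rootHess`. For γ = √f_{θ_g} and θ = θ_g this derivative is exactly the Fisher
information, by the information equality. Hence, on a small ball around θ_g and for every γ that is
L²-close to √f_{θ_g}, the gradient map is a small perturbation of a positive definite linear map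
(`exists_weightedScore_sub_approx`), and a short gradient step contracts
(`exists_gradient_contraction`). The closeness needed in γ and the contraction constants are uniform
over interior θ_g; only the radius of the ball depends on θ_g. The MHDE lies close to θ_g by
compactness (`exists_norm_sub_le_of_isMHDE`), is therefore interior, and is a zero of the gradient
(`gradLoss_eq_zero_of_isMHDE`). So the noisy iterates follow a perturbed fixed-point iteration
towards it: the error is a geometric term plus the noise size over 1 - ρ (`norm_noisyGD_sub_le`). L¹
consistency of the kernel estimate makes γ close to √g in probability, the assumption on
HD²(f_{θ_g}, g) bridges √g and √f_{θ_g}, and Gaussian tails with a union bound control all the noise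
vectors at once (`eventually_rates` collects the orders).

Privacy. The Hellinger affinity, which is 1 minus half the divergence, is at worst multiplied by
exp(-d²/(8s²)) when both chains make a Gaussian step of scale s from centres at most d apart
(`AffinityGE.gaussianStep`). The noise is calibrated so that this factor is 1 - x/2, and 1 -
h_k(x)/2 = (1 - x/2)^k (`hComp_eq`).

Sensitivity. Changing one observation perturbs ḡ_n by at most two rescaled kernels. Since |√a - √b|
≤ √|a - b|, Hölder's inequality with the exponents p, q of the family gives the order n^{-1/2}
c_n^{1/p - 1/2}, and n^{1/2} c_n² → 0 turns the power of c_n into a power of n.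

The hypotheses give continuity in θ of certain integrals rather than one dominating function for all
θ. Differentiation under the integral therefore rests on a generalized dominated convergence theorem
and on Fubini along segments. -/

namespace PMHDE

/-! ### Continuity of parametric integrals, and the fundamental theorem of calculus under the
integral. -/

section Domination

variable {T α : Type*} [TopologicalSpace T] [FirstCountableTopology T] [MeasurableSpace α]
  {μ : Measure α}

/-- Lower semicontinuity of the integral of a pointwise continuous nonnegative family. -/
theorem eventually_lt_integral_of_nonneg {H : T → α → ℝ} (h0 : ∀ t x, 0 ≤ H t x)
    (hi : ∀ t, Integrable (H t) μ) (hc : ∀ x, Continuous fun t => H t x) (t₀ : T) {a : ℝ}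
    (ha : a < ∫ x, H t₀ x ∂μ) : ∀ᶠ t in 𝓝 t₀, a < ∫ x, H t x ∂μ := by
  rcases lt_or_ge a 0 with ha0 | ha0
  · exact Eventually.of_forall fun t => ha0.trans_le (integral_nonneg (h0 t))
  have key : ∀ t, ENNReal.ofReal (∫ x, H t x ∂μ) = ∫⁻ x, ENNReal.ofReal (H t x) ∂μ := fun t =>
    ofReal_integral_eq_lintegral_ofReal (hi t) (Eventually.of_forall (h0 t))
  -- Fatou's lemma along the neighbourhood filter itself, which is countably generated by first
  -- countability.
  have hF := lintegral_liminf_le' (μ := μ) (u := 𝓝 t₀) (f := fun t x => ENNReal.ofReal (H t x))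
    fun t => (hi t).aemeasurable.ennreal_ofReal
  have hl : ∀ x, liminf (fun t => ENNReal.ofReal (H t x)) (𝓝 t₀) = ENNReal.ofReal (H t₀ x) :=
    fun x => Tendsto.liminf_eq
      ((ENNReal.continuous_ofReal.comp (hc x)).tendsto t₀)
  simp only [hl, ← key] at hF
  have h1 : ENNReal.ofReal a < liminf (fun t => ENNReal.ofReal (∫ x, H t x ∂μ)) (𝓝 t₀) :=
    lt_of_lt_of_le ((ENNReal.ofReal_lt_ofReal_iff (ha0.trans_lt ha)).2 ha) hF
  filter_upwards [eventually_lt_of_lt_liminf h1] with t ht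
  exact (ENNReal.ofReal_lt_ofReal_iff_of_nonneg ha0).1 ht

/-- Continuity of a parametric integral dominated by a family with continuous integrals. -/
theorem continuous_integral_of_dominated {F G : T → α → ℝ}
    (hF : ∀ t, AEStronglyMeasurable (F t) μ) (hG : ∀ t, Integrable (G t) μ)
    (hb : ∀ t x, |F t x| ≤ G t x) (hFc : ∀ x, Continuous fun t => F t x)
    (hGc : ∀ x, Continuous fun t => G t x) (hI : Continuous fun t => ∫ x, G t x ∂μ) :
    (∀ t, Integrable (F t) μ) ∧ Continuous fun t => ∫ x, F t x ∂μ := by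
  have hFi : ∀ t, Integrable (F t) μ := fun t =>
    (hG t).mono' (hF t) (Eventually.of_forall (hb t))
  refine ⟨hFi, continuous_iff_continuousAt.2 fun t₀ => ?_⟩
  refine Metric.tendsto_nhds.2 fun ε hε => ?_
  -- Lower semicontinuity for the two nonnegative families G + F and G - F, combined with continuity
  -- of ∫ G, bounds ∫ F from below and from above.
  have h1 := eventually_lt_integral_of_nonneg (μ := μ) (H := fun t x => G t x + F t x)
    (fun t x => by have := abs_le.1 (hb t x); linarith) (fun t => (hG t).add (hFi t))
    (fun x => (hGc x).add (hFc x)) t₀ (a := (∫ x, G t₀ x + F t₀ x ∂μ) - ε / 2) (by linarith)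
  have h2 := eventually_lt_integral_of_nonneg (μ := μ) (H := fun t x => G t x - F t x)
    (fun t x => by have := abs_le.1 (hb t x); linarith) (fun t => (hG t).sub (hFi t))
    (fun x => (hGc x).sub (hFc x)) t₀ (a := (∫ x, G t₀ x - F t₀ x ∂μ) - ε / 2) (by linarith)
  have h3 := Metric.tendsto_nhds.1 (hI.tendsto t₀) (ε / 2) (by linarith)
  filter_upwards [h1, h2, h3] with t g1 g2 g3
  rw [integral_add (hG _) (hFi _), integral_add (hG _) (hFi _)] at g1
  rw [integral_sub (hG _) (hFi _), integral_sub (hG _) (hFi _)] at g2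
  rw [Real.dist_eq, abs_lt] at g3 ⊢
  constructor <;> linarith

/-- Version of `continuous_integral_of_dominated` on a subset of the parameter space. -/
theorem continuousOn_integral_of_dominated {S : Set T} {F G : T → α → ℝ}
    (hF : ∀ t ∈ S, AEStronglyMeasurable (F t) μ) (hG : ∀ t ∈ S, Integrable (G t) μ)
    (hb : ∀ t ∈ S, ∀ x, |F t x| ≤ G t x) (hFc : ∀ x, ContinuousOn (fun t => F t x) S)
    (hGc : ∀ x, ContinuousOn (fun t => G t x) S) (hI : ContinuousOn (fun t => ∫ x, G t x ∂μ) S) :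
    (∀ t ∈ S, Integrable (F t) μ) ∧ ContinuousOn (fun t => ∫ x, F t x ∂μ) S := by
  have := continuous_integral_of_dominated (T := S) (μ := μ) (F := fun t x => F t x)
    (G := fun t x => G t x) (fun t => hF t t.2) (fun t => hG t t.2) (fun t => hb t t.2)
    (fun x => continuousOn_iff_continuous_domRestrict.1 (hFc x))
    (fun x => continuousOn_iff_continuous_domRestrict.1 (hGc x))
    (continuousOn_iff_continuous_domRestrict.1 hI)
  exact ⟨fun t ht => this.1 ⟨t, ht⟩, continuousOn_iff_continuous_domRestrict.2 this.2⟩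

end Domination

/-- The fundamental theorem of calculus under the integral sign: a uniform bound on the `L¹` norms
of the derivative replaces domination. -/
theorem integral_sub_eq_intervalIntegral_integral {α : Type*} [MeasurableSpace α] {μ : Measure α}
    [SFinite μ] {V V' : ℝ → α → ℝ} {C : ℝ}
    (hd : ∀ x, ∀ t ∈ Icc (0 : ℝ) 1, HasDerivWithinAt (fun t => V t x) (V' t x) (Icc 0 1) t)
    (hc : ∀ x, ContinuousOn (fun t => V' t x) (Icc 0 1))
    (hm : ∀ t ∈ Icc (0 : ℝ) 1, Measurable (V' t))
    (hi : ∀ t ∈ Icc (0 : ℝ) 1, Integrable (V' t) μ)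
    (hC : ∀ t ∈ Icc (0 : ℝ) 1, ∫ x, |V' t x| ∂μ ≤ C)
    (h0 : Integrable (V 0) μ) (h1 : Integrable (V 1) μ) :
    ∫ x, V 1 x ∂μ - ∫ x, V 0 x ∂μ = ∫ t in (0 : ℝ)..1, ∫ x, V' t x ∂μ := by
  -- Clamping t to [0, 1] makes the integrand continuous in t on the whole line, so that it is
  -- jointly measurable as a Carathéodory function.
  set U : ℝ → α → ℝ := fun t x => V' (projIcc 0 1 zero_le_one t) x with hU
  have hUV : ∀ t ∈ Icc (0 : ℝ) 1, U t = V' t := fun t ht => by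
    simp only [hU, projIcc_of_mem _ ht]
  have hUc : ∀ x, Continuous fun t => U t x := fun x =>
    (continuousOn_iff_continuous_domRestrict.1 (hc x)).comp continuous_projIcc
  have hUm : StronglyMeasurable (Function.uncurry U) :=
    stronglyMeasurable_uncurry_of_continuous_of_stronglyMeasurable hUc
      fun t => (hm _ (projIcc 0 1 zero_le_one t).2).stronglyMeasurable
  have hU_int : Integrable (Function.uncurry U) ((volume.restrict (Ioc (0 : ℝ) 1)).prod μ) := by
    rw [integrable_prod_iff hUm.aestronglyMeasurable]
    have hsub : ∀ᵐ t ∂(volume.restrict (Ioc (0 : ℝ) 1)), t ∈ Icc (0 : ℝ) 1 :=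
      (ae_restrict_mem measurableSet_Ioc).mono fun t ht => Ioc_subset_Icc_self ht
    refine ⟨hsub.mono fun t ht => ?_, ?_⟩
    · simpa [Function.uncurry, hUV t ht] using hi t ht
    · refine Integrable.of_bound (C := C) ?_ ?_
      · exact hUm.norm.integral_prod_right.aestronglyMeasurable
      · refine hsub.mono fun t ht => ?_
        simp only [Function.uncurry, hUV t ht]
        rw [Real.norm_of_nonneg (integral_nonneg fun _ => norm_nonneg _)]
        simpa using hC t ht
  have ftc : ∀ x, V 1 x - V 0 x = ∫ t in (0 : ℝ)..1, U t x := fun x => by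
    symm
    refine intervalIntegral.integral_eq_sub_of_hasDeriv_right_of_le zero_le_one
      (fun t ht => (hd x t ht).continuousWithinAt) (fun t ht => ?_)
      ((hUc x).intervalIntegrable 0 1)
    rw [hUV t (Ioo_subset_Icc_self ht)]
    exact ((hd x t (Ioo_subset_Icc_self ht)).hasDerivAt (Icc_mem_nhds ht.1 ht.2)).hasDerivWithinAt
  rw [← integral_sub h1 h0]
  simp only [ftc, intervalIntegral.integral_of_le zero_le_one]
  rw [integral_integral_swap (f := fun x t => U t x) hU_int.swap]
  refine setIntegral_congr_fun measurableSet_Ioc fun t ht => ?_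
  simp only [hUV t (Ioc_subset_Icc_self ht)]

/-! ### Partial derivatives within a convex parameter set. -/

section PartialDeriv

variable {m : ℕ} {Θ : Set (E m)}

theorem continuousOn_partialDeriv (hΘ : UniqueDiffOn ℝ Θ) {F : E m → ℝ} {n : ℕ}
    (hF : ContDiffOn ℝ (n + 1 : ℕ) F Θ) (i : Fin m) :
    ContDiffOn ℝ n (partialDeriv Θ i F) Θ := by
  have h := hF.fderivWithin hΘ (m := n) (by push_cast; exact le_rfl)
  exact h.clm_apply contDiffOn_const

theorem sum_mul_partialDeriv (F : E m → ℝ) (θ v : E m) :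
    fderivWithin ℝ F Θ θ v = ∑ i, v i * partialDeriv Θ i F θ := by
  conv_lhs => rw [← (EuclideanSpace.basisFun (Fin m) ℝ).sum_repr v]
  simp [partialDeriv, map_sum]

/-- Chain rule along a segment of the parameter set. -/
theorem hasDerivWithinAt_segment (hΘ : Convex ℝ Θ) {F : E m → ℝ} (hF : DifferentiableOn ℝ F Θ)
    {θ θ' : E m} (h : θ ∈ Θ) (h' : θ' ∈ Θ) {t : ℝ} (ht : t ∈ Icc (0 : ℝ) 1) :
    HasDerivWithinAt (fun t : ℝ => F (θ + t • (θ' - θ)))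
      (∑ i, (θ' - θ) i * partialDeriv Θ i F (θ + t • (θ' - θ))) (Icc 0 1) t := by
  have hmaps : MapsTo (fun t : ℝ => θ + t • (θ' - θ)) (Icc 0 1) Θ := fun s hs =>
    hΘ.add_smul_sub_mem h h' hs
  rw [← sum_mul_partialDeriv]
  refine HasFDerivWithinAt.comp_hasDerivWithinAt (t := Θ) t
    (hF _ (hmaps ht)).hasFDerivWithinAt ?_ hmaps
  have := ((hasDerivAt_id t).smul_const (θ' - θ)).const_add θ
  simpa using this.hasDerivWithinAt

/-- At an interior parameter the derivative is a limit of difference quotients taken inside the set.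
A boundary parameter is approached along a segment of interior ones, and continuity of the
derivative up to the boundary passes measurability to the limit. -/
theorem measurable_partialDeriv {α : Type*} [MeasurableSpace α] (hΘ : Convex ℝ Θ)
    (hne : (interior Θ).Nonempty) {F : E m → α → ℝ} (hF : ∀ θ ∈ Θ, Measurable (F θ))
    (hc : ∀ x, ContDiffOn ℝ 1 (fun θ => F θ x) Θ) (i : Fin m) {θ : E m} (hθ : θ ∈ Θ) :
    Measurable fun x => partialDeriv Θ i (fun θ => F θ x) θ := by
  have hu : UniqueDiffOn ℝ Θ := uniqueDiffOn_convex hΘ hne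
  have key : ∀ θ ∈ interior Θ, Measurable fun x => partialDeriv Θ i (fun θ => F θ x) θ := by
    intro θ hθ
    set e : E m := EuclideanSpace.single i 1
    have hlim : Tendsto (fun n : ℕ => θ + (n + 1 : ℝ)⁻¹ • e) atTop (𝓝 θ) := by
      have h1 : Tendsto (fun n : ℕ => (n + 1 : ℝ)⁻¹) atTop (𝓝 0) := by
        simpa using tendsto_one_div_add_atTop_nhds_zero_nat (𝕜 := ℝ)
      simpa using (h1.smul_const e).const_add θ
    obtain ⟨N, hN⟩ := eventually_atTop.1 (hlim.eventually (mem_interior_iff_mem_nhds.1 hθ))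
    refine measurable_of_tendsto_metrizable
      (f := fun n x => ((n + N : ℕ) + 1 : ℝ) * (F (θ + ((n + N : ℕ) + 1 : ℝ)⁻¹ • e) x - F θ x))
      (fun n => ((hF _ (hN _ (by omega))).sub (hF _ (interior_subset hθ))).const_mul _) ?_
    rw [tendsto_pi_nhds]
    intro x
    have hdiff : HasFDerivAt (fun θ => F θ x) (fderivWithin ℝ (fun θ => F θ x) Θ θ) θ :=
      (((hc x).differentiableOn one_ne_zero θ
        (interior_subset hθ)).hasFDerivWithinAt).hasFDerivAt (mem_interior_iff_mem_nhds.1 hθ)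
    have hcast : Tendsto (fun n : ℕ => ‖((n + N : ℕ) + 1 : ℝ)‖) atTop atTop := by
      have h2 : Tendsto (fun n : ℕ => ((n + N : ℕ) + 1 : ℝ)) atTop atTop :=
        tendsto_atTop_add_const_right _ _
          (tendsto_natCast_atTop_atTop.comp (tendsto_add_atTop_nat N))
      exact tendsto_norm_atTop_atTop.comp h2
    exact hdiff.lim e hcast
  obtain ⟨θ₁, hθ₁⟩ := hne
  have hmem : ∀ n : ℕ, θ + (n + 1 : ℝ)⁻¹ • (θ₁ - θ) ∈ interior Θ := fun n =>
    hΘ.add_smul_sub_mem_interior hθ hθ₁ ⟨by positivity, by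
      rw [inv_le_one₀ (by positivity)]; linarith [(Nat.cast_nonneg n : (0 : ℝ) ≤ n)]⟩
  refine measurable_of_tendsto_metrizable (fun n => key _ (hmem n)) ?_
  rw [tendsto_pi_nhds]
  intro x
  have hcont : ContinuousOn (partialDeriv Θ i (fun θ => F θ x)) Θ :=
    (continuousOn_partialDeriv (n := 0) hu (by simpa using hc x) i).continuousOn
  have hlim : Tendsto (fun n : ℕ => θ + (n + 1 : ℝ)⁻¹ • (θ₁ - θ)) atTop (𝓝 θ) := by
    have h1 : Tendsto (fun n : ℕ => (n + 1 : ℝ)⁻¹) atTop (𝓝 0) := by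
      simpa using tendsto_one_div_add_atTop_nhds_zero_nat (𝕜 := ℝ)
    simpa using (h1.smul_const (θ₁ - θ)).const_add θ
  exact (hcont θ hθ).tendsto.comp (tendsto_nhdsWithin_iff.2
    ⟨hlim, Eventually.of_forall fun n => interior_subset (hmem n)⟩)

end PartialDeriv

end PMHDE

/-! ### Scores, their integrable envelope, and derivatives of the root density. -/

namespace PMHDE

variable {m : ℕ} {Θ : Set (E m)} {f : E m → ℝ → ℝ} {p q : ℝ}

/-- `√f_θ · u_{θ,i}`, which is twice the `i`-th partial derivative of `√f_θ`. -/
noncomputable def rootScore (Θ : Set (E m)) (f : E m → ℝ → ℝ) (θ : E m) (i : Fin m) (x : ℝ) : ℝ :=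
  √(f θ x) * score Θ f θ i x

/-- The `i`-th partial derivative of `√f_θ · u_{θ,j}`. -/
noncomputable def rootHess (Θ : Set (E m)) (f : E m → ℝ → ℝ) (θ : E m) (i j : Fin m) (x : ℝ) : ℝ :=
  √(f θ x) * (1 / 2 * (score Θ f θ i x * score Θ f θ j x) + score2 Θ f θ i j x)

/-- An integrable envelope for all the first and second order score terms. -/
noncomputable def envelope (Θ : Set (E m)) (f : E m → ℝ → ℝ) (θ : E m) (x : ℝ) : ℝ :=
  (1 + ∑ i, score Θ f θ i x ^ 2 + ∑ i, ∑ j, score2 Θ f θ i j x ^ 2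
    + ∑ i, ∑ j, (score Θ f θ i x * score Θ f θ j x) ^ 2) * f θ x

namespace RegularFamily

variable (hf : RegularFamily Θ f p q)
include hf

theorem uniqueDiffOn : UniqueDiffOn ℝ Θ := uniqueDiffOn_convex hf.convex hf.interior_nonempty

theorem contDiffOn_log (x : ℝ) : ContDiffOn ℝ 3 (fun θ => Real.log (f θ x)) Θ :=
  (hf.contDiffOn x).log fun θ hθ => (hf.pos θ hθ x).ne'

theorem contDiffOn_score (i : Fin m) (x : ℝ) : ContDiffOn ℝ 2 (fun θ => score Θ f θ i x) Θ :=
  continuousOn_partialDeriv (n := 2) hf.uniqueDiffOn (by simpa using hf.contDiffOn_log x) i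

theorem contDiffOn_score2 (i j : Fin m) (x : ℝ) :
    ContDiffOn ℝ 1 (fun θ => score2 Θ f θ i j x) Θ := by
  have := continuousOn_partialDeriv (n := 1) hf.uniqueDiffOn
    (by simpa using hf.contDiffOn_score j x) i
  simp only [Nat.cast_one] at this
  exact this

theorem continuousOn_score (i : Fin m) (x : ℝ) : ContinuousOn (fun θ => score Θ f θ i x) Θ :=
  (hf.contDiffOn_score i x).continuousOn

theorem continuousOn_score2 (i j : Fin m) (x : ℝ) :
    ContinuousOn (fun θ => score2 Θ f θ i j x) Θ :=
  (hf.contDiffOn_score2 i j x).continuousOn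

theorem continuousOn_density (x : ℝ) : ContinuousOn (fun θ => f θ x) Θ :=
  (hf.contDiffOn x).continuousOn

theorem measurable_density {θ : E m} (hθ : θ ∈ Θ) : Measurable (f θ) := (hf.isDensity θ hθ).measurable

theorem measurable_score {θ : E m} (hθ : θ ∈ Θ) (i : Fin m) : Measurable (score Θ f θ i) :=
  measurable_partialDeriv hf.convex hf.interior_nonempty (F := fun θ x => Real.log (f θ x))
    (fun _ h => (hf.measurable_density h).log)
    (fun x => (hf.contDiffOn_log x).of_le (by norm_num)) i hθ

theorem measurable_score2 {θ : E m} (hθ : θ ∈ Θ) (i j : Fin m) : Measurable (score2 Θ f θ i j) :=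
  measurable_partialDeriv hf.convex hf.interior_nonempty (F := fun θ x => score Θ f θ j x)
    (fun _ h => hf.measurable_score h j)
    (fun x => (hf.contDiffOn_score j x).of_le (by norm_num)) i hθ

theorem measurable_rootScore {θ : E m} (hθ : θ ∈ Θ) (i : Fin m) :
    Measurable (rootScore Θ f θ i) :=
  (hf.measurable_density hθ).sqrt.mul (hf.measurable_score hθ i)

theorem measurable_rootHess {θ : E m} (hθ : θ ∈ Θ) (i j : Fin m) :
    Measurable (rootHess Θ f θ i j) :=
  (hf.measurable_density hθ).sqrt.mul ((((hf.measurable_score hθ i).mul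
    (hf.measurable_score hθ j)).const_mul _).add (hf.measurable_score2 hθ i j))

theorem integrable_density {θ : E m} (hθ : θ ∈ Θ) : Integrable (f θ) :=
  integrable_of_integral_eq_one (hf.isDensity θ hθ).integral_eq_one

theorem continuousOn_envelope (x : ℝ) : ContinuousOn (fun θ => envelope Θ f θ x) Θ := by
  have h1 := fun i => hf.continuousOn_score i x
  have h2 := fun i j => hf.continuousOn_score2 i j x
  have h3 := hf.continuousOn_density x
  unfold envelope
  fun_prop

/-- The envelope is integrable, with integral continuous in the parameter. -/
theorem envelope_integrable : (∀ θ ∈ Θ, Integrable (envelope Θ f θ)) ∧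
    ContinuousOn (fun θ => ∫ x, envelope Θ f θ x) Θ := by
  have e : ∀ θ, envelope Θ f θ = fun x => f θ x + (∑ i, score Θ f θ i x ^ 2) * f θ x
      + (∑ i, ∑ j, score2 Θ f θ i j x ^ 2) * f θ x
      + (∑ i, ∑ j, (score Θ f θ i x * score Θ f θ j x) ^ 2) * f θ x := fun θ => by
    funext x; unfold envelope; ring
  have i1 := hf.l2_score
  have i2 := hf.l2_score2
  have i3 := hf.l2_outer
  refine ⟨fun θ hθ => ?_, ?_⟩
  · rw [e]
    exact (((hf.integrable_density hθ).add (i1.1 θ hθ)).add (i2.1 θ hθ)).add (i3.1 θ hθ)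
  · refine ((((continuousOn_const (c := (1 : ℝ))).add i1.2).add i2.2).add i3.2).congr
      fun θ hθ => ?_
    dsimp only
    rw [e]
    erw [integral_add (((hf.integrable_density hθ).add (i1.1 θ hθ)).add (i2.1 θ hθ)) (i3.1 θ hθ),
      integral_add ((hf.integrable_density hθ).add (i1.1 θ hθ)) (i2.1 θ hθ),
      integral_add (hf.integrable_density hθ) (i1.1 θ hθ), (hf.isDensity θ hθ).integral_eq_one]
    rfl

omit hf in
theorem sq_score_le (θ : E m) (i : Fin m) (x : ℝ) :
    score Θ f θ i x ^ 2 ≤ ∑ i, score Θ f θ i x ^ 2 :=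
  Finset.single_le_sum (f := fun i => score Θ f θ i x ^ 2) (fun _ _ => sq_nonneg _)
    (Finset.mem_univ i)

omit hf in
theorem le_sum_sum {a : Fin m → Fin m → ℝ} (ha : ∀ i j, 0 ≤ a i j) (i j : Fin m) :
    a i j ≤ ∑ i, ∑ j, a i j :=
  (Finset.single_le_sum (f := fun j => a i j) (fun _ _ => ha _ _) (Finset.mem_univ j)).trans
    (Finset.single_le_sum (f := fun i => ∑ j, a i j)
      (fun _ _ => Finset.sum_nonneg fun _ _ => ha _ _) (Finset.mem_univ i))

theorem mul_le_envelope {θ : E m} (hθ : θ ∈ Θ) (i j : Fin m) (x : ℝ) :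
    f θ x * (1 + score Θ f θ i x ^ 2 + score2 Θ f θ i j x ^ 2
      + (score Θ f θ i x * score Θ f θ j x) ^ 2) ≤ envelope Θ f θ x := by
  have h1 := sq_score_le (Θ := Θ) (f := f) θ i x
  have h2 := le_sum_sum (a := fun i j => score2 Θ f θ i j x ^ 2) (fun _ _ => sq_nonneg _) i j
  have h3 := le_sum_sum (a := fun i j => (score Θ f θ i x * score Θ f θ j x) ^ 2)
    (fun _ _ => sq_nonneg _) i j
  rw [envelope, mul_comm (f θ x)]
  refine mul_le_mul_of_nonneg_right ?_ (hf.pos θ hθ x).le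
  linarith

theorem sq_rootScore_le {θ : E m} (hθ : θ ∈ Θ) (i : Fin m) (x : ℝ) :
    rootScore Θ f θ i x ^ 2 ≤ 2 * envelope Θ f θ x := by
  have h := hf.mul_le_envelope hθ i i x
  have hp := hf.pos θ hθ x
  rw [rootScore, mul_pow, Real.sq_sqrt hp.le]
  nlinarith [mul_nonneg hp.le (sq_nonneg (score Θ f θ i x)),
    mul_nonneg hp.le (sq_nonneg (score2 Θ f θ i i x)),
    mul_nonneg hp.le (sq_nonneg (score Θ f θ i x * score Θ f θ i x))]

/-- The two L² conditions, on the outer product of the score and on its derivative, supply the two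
terms that remain after expanding the square. -/
theorem sq_rootHess_le {θ : E m} (hθ : θ ∈ Θ) (i j : Fin m) (x : ℝ) :
    rootHess Θ f θ i j x ^ 2 ≤ 2 * envelope Θ f θ x := by
  have h := hf.mul_le_envelope hθ i j x
  have hp := hf.pos θ hθ x
  rw [rootHess, mul_pow, Real.sq_sqrt hp.le]
  set a := score Θ f θ i x * score Θ f θ j x
  set b := score2 Θ f θ i j x
  have : (1 / 2 * a + b) ^ 2 ≤ 2 * (1 + score Θ f θ i x ^ 2 + b ^ 2 + a ^ 2) := by
    nlinarith [sq_nonneg (1 / 2 * a - b), sq_nonneg (score Θ f θ i x), sq_nonneg a]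
  calc _ ≤ f θ x * (2 * (1 + score Θ f θ i x ^ 2 + b ^ 2 + a ^ 2)) :=
        mul_le_mul_of_nonneg_left this hp.le
    _ ≤ _ := by linarith

/-- This is what the summand 1 in `envelope` is for: |a| ≤ 1 + a² brings first powers under control.
-/
theorem abs_density_mul_score_le {θ : E m} (hθ : θ ∈ Θ) (i : Fin m) (x : ℝ) :
    |f θ x * score Θ f θ i x| ≤ 2 * envelope Θ f θ x := by
  have h := hf.mul_le_envelope hθ i i x
  have hp := hf.pos θ hθ x
  rw [abs_mul, abs_of_pos hp]
  set a := score Θ f θ i x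
  have : |a| ≤ 2 * (1 + a ^ 2 + score2 Θ f θ i i x ^ 2 + (a * a) ^ 2) := by
    nlinarith [sq_nonneg (score2 Θ f θ i i x), sq_nonneg (a * a), sq_abs a, sq_nonneg (|a| - 1)]
  calc _ ≤ _ := mul_le_mul_of_nonneg_left this hp.le
    _ ≤ _ := by linarith

theorem abs_density_mul_score2_le {θ : E m} (hθ : θ ∈ Θ) (i j : Fin m) (x : ℝ) :
    |f θ x * (score Θ f θ i x * score Θ f θ j x + score2 Θ f θ i j x)|
      ≤ 2 * envelope Θ f θ x := by
  have h := hf.mul_le_envelope hθ i j x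
  have hp := hf.pos θ hθ x
  rw [abs_mul, abs_of_pos hp]
  set a := score Θ f θ i x * score Θ f θ j x
  set b := score2 Θ f θ i j x
  have : |a + b| ≤ 2 * (1 + score Θ f θ i x ^ 2 + b ^ 2 + a ^ 2) := by
    nlinarith [sq_nonneg (score Θ f θ i x), sq_abs a, sq_abs b, sq_nonneg (|a| - 1),
      sq_nonneg (|b| - 1), abs_add_le a b]
  calc _ ≤ _ := mul_le_mul_of_nonneg_left this hp.le
    _ ≤ _ := by linarith

theorem continuousOn_rootScore (i : Fin m) (x : ℝ) :
    ContinuousOn (fun θ => rootScore Θ f θ i x) Θ :=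
  (hf.continuousOn_density x).sqrt.mul (hf.continuousOn_score i x)

theorem contDiffOn_rootScore (i : Fin m) (x : ℝ) :
    ContDiffOn ℝ 1 (fun θ => rootScore Θ f θ i x) Θ :=
  (((hf.contDiffOn x).of_le (by norm_num)).sqrt fun θ hθ => (hf.pos θ hθ x).ne').mul
    ((hf.contDiffOn_score i x).of_le (by norm_num))

theorem continuousOn_rootHess (i j : Fin m) (x : ℝ) :
    ContinuousOn (fun θ => rootHess Θ f θ i j x) Θ :=
  (hf.continuousOn_density x).sqrt.mul ((((hf.continuousOn_score i x).mul
    (hf.continuousOn_score j x)).const_smul (1 / 2 : ℝ)).add (hf.continuousOn_score2 i j x))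

theorem partialDeriv_density {θ : E m} (hθ : θ ∈ Θ) (i : Fin m) (x : ℝ) :
    partialDeriv Θ i (fun θ => f θ x) θ = f θ x * score Θ f θ i x := by
  have hd : DifferentiableWithinAt ℝ (fun θ => f θ x) Θ θ :=
    (hf.contDiffOn x).differentiableOn (by norm_num) θ hθ
  have hp := hf.pos θ hθ x
  rw [score, partialDeriv, partialDeriv, fderivWithin.log hd hp.ne' (hf.uniqueDiffOn θ hθ)]
  simp [hp.ne']

theorem partialDeriv_density_mul_score {θ : E m} (hθ : θ ∈ Θ) (i j : Fin m) (x : ℝ) :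
    partialDeriv Θ i (fun θ => f θ x * score Θ f θ j x) θ
      = f θ x * (score Θ f θ i x * score Θ f θ j x + score2 Θ f θ i j x) := by
  have hd : DifferentiableWithinAt ℝ (fun θ => f θ x) Θ θ :=
    (hf.contDiffOn x).differentiableOn (by norm_num) θ hθ
  have hs : DifferentiableWithinAt ℝ (fun θ => score Θ f θ j x) Θ θ :=
    (hf.contDiffOn_score j x).differentiableOn (by norm_num) θ hθ
  have h := hf.partialDeriv_density hθ i x
  rw [partialDeriv] at h
  rw [partialDeriv, fderivWithin_fun_mul (hf.uniqueDiffOn θ hθ) hd hs]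
  simp only [score2, partialDeriv, add_apply, smul_apply, h,
    smul_eq_mul]
  ring

/-- The derivative of √f is √f · u / 2, which accounts for the coefficient 1/2 in `rootHess`. -/
theorem partialDeriv_rootScore {θ : E m} (hθ : θ ∈ Θ) (i j : Fin m) (x : ℝ) :
    partialDeriv Θ i (fun θ => rootScore Θ f θ j x) θ = rootHess Θ f θ i j x := by
  have hd : DifferentiableWithinAt ℝ (fun θ => f θ x) Θ θ :=
    (hf.contDiffOn x).differentiableOn (by norm_num) θ hθ
  have hs : DifferentiableWithinAt ℝ (fun θ => score Θ f θ j x) Θ θ :=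
    (hf.contDiffOn_score j x).differentiableOn (by norm_num) θ hθ
  have hp := hf.pos θ hθ x
  have h := hf.partialDeriv_density hθ i x
  rw [partialDeriv] at h
  have hu := hf.uniqueDiffOn θ hθ
  simp only [rootScore]
  rw [partialDeriv, fderivWithin_fun_mul hu (hd.sqrt hp.ne') hs, fderivWithin_sqrt hd hp.ne' hu]
  simp only [score2, partialDeriv, add_apply, smul_apply, h,
    smul_eq_mul, rootHess]
  have hsq := Real.mul_self_sqrt hp.le
  have hne : √(f θ x) ≠ 0 := (Real.sqrt_pos.2 hp).ne'
  nth_rw 3 [← hsq]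
  field_simp
  ring

/-- Continuity in `θ` of integrals dominated by a weight plus the envelope. -/
theorem continuousOn_integral_of_le_envelope {γ : ℝ → ℝ} (hγ : Integrable fun x => γ x ^ 2)
    {F : E m → ℝ → ℝ} (hm : ∀ θ ∈ Θ, Measurable (F θ))
    (hb : ∀ θ ∈ Θ, ∀ x, |F θ x| ≤ γ x ^ 2 + 2 * envelope Θ f θ x)
    (hc : ∀ x, ContinuousOn (fun θ => F θ x) Θ) :
    (∀ θ ∈ Θ, Integrable (F θ)) ∧ ContinuousOn (fun θ => ∫ x, F θ x) Θ := by
  refine continuousOn_integral_of_dominated (G := fun θ x => γ x ^ 2 + 2 * envelope Θ f θ x)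
    (fun θ hθ => (hm θ hθ).aestronglyMeasurable)
    (fun θ hθ => hγ.add ((hf.envelope_integrable.1 θ hθ).const_mul 2)) hb hc
    (fun x => continuousOn_const.add ((hf.continuousOn_envelope x).const_smul (2 : ℝ))) ?_
  refine ((continuousOn_const (c := ∫ x, γ x ^ 2)).add
    (hf.envelope_integrable.2.const_smul (2 : ℝ))).congr fun θ hθ => ?_
  rw [integral_add hγ ((hf.envelope_integrable.1 θ hθ).const_mul 2), integral_const_mul]
  rfl

theorem exists_integral_envelope_le : ∃ M, 0 ≤ M ∧ ∀ θ ∈ Θ, ∫ x, envelope Θ f θ x ≤ M := by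
  obtain ⟨M, hM⟩ := hf.isCompact.bddAbove_image hf.envelope_integrable.2
  exact ⟨max M 0, le_max_right _ _, fun θ hθ =>
    (hM (mem_image_of_mem _ hθ)).trans (le_max_left _ _)⟩

/-- Increments over `Θ` of an integral with dominated partial derivatives. -/
theorem integral_sub_eq_of_le_envelope {γ : ℝ → ℝ} (hγ : Integrable fun x => γ x ^ 2)
    {F : E m → ℝ → ℝ} (hm : ∀ θ ∈ Θ, Measurable (F θ)) (hi : ∀ θ ∈ Θ, Integrable (F θ))
    (hd : ∀ x, ContDiffOn ℝ 1 (fun θ => F θ x) Θ)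
    (hb : ∀ i, ∀ θ ∈ Θ, ∀ x, |partialDeriv Θ i (fun θ => F θ x) θ| ≤ γ x ^ 2 + 2 * envelope Θ f θ x)
    {θ θ' : E m} (hθ : θ ∈ Θ) (hθ' : θ' ∈ Θ) :
    (∫ x, F θ' x) - ∫ x, F θ x = ∫ t in (0 : ℝ)..1, ∑ i, (θ' - θ) i *
      ∫ x, partialDeriv Θ i (fun θ => F θ x) (θ + t • (θ' - θ)) := by
  have hseg : ∀ t ∈ Icc (0 : ℝ) 1, θ + t • (θ' - θ) ∈ Θ := fun t ht =>
    hf.convex.add_smul_sub_mem hθ hθ' ht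
  have hPm : ∀ i, ∀ θ ∈ Θ, Measurable fun x => partialDeriv Θ i (fun θ => F θ x) θ :=
    fun i θ hθ => measurable_partialDeriv hf.convex hf.interior_nonempty hm hd i hθ
  have hPc : ∀ i x, ContinuousOn (partialDeriv Θ i (fun θ => F θ x)) Θ := fun i x =>
    (continuousOn_partialDeriv (n := 0) hf.uniqueDiffOn (by simpa using hd x) i).continuousOn
  have hPI := fun i => hf.continuousOn_integral_of_le_envelope hγ (hPm i) (hb i) (hPc i)
  obtain ⟨M, -, hM⟩ := hf.exists_integral_envelope_le
  have hcs : Continuous fun t : ℝ => θ + t • (θ' - θ) := by fun_prop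
  have hmaps : MapsTo (fun t : ℝ => θ + t • (θ' - θ)) (Icc 0 1) Θ := hseg
  have hint : ∀ t ∈ Icc (0 : ℝ) 1, ∀ i ∈ Finset.univ, Integrable fun x => (θ' - θ) i *
      partialDeriv Θ i (fun θ => F θ x) (θ + t • (θ' - θ)) := fun t ht i _ =>
    ((hPI i).1 _ (hseg t ht)).const_mul _
  have key := integral_sub_eq_intervalIntegral_integral (μ := volume)
    (V := fun t x => F (θ + t • (θ' - θ)) x)
    (V' := fun t x => ∑ i, (θ' - θ) i * partialDeriv Θ i (fun θ => F θ x) (θ + t • (θ' - θ)))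
    (C := ∑ i, |(θ' - θ) i| * ((∫ x, γ x ^ 2) + 2 * M))
    (fun x t ht => hasDerivWithinAt_segment hf.convex ((hd x).differentiableOn one_ne_zero)
      hθ hθ' ht)
    (fun x => continuousOn_finsetSum _ fun i _ =>
      continuousOn_const.mul ((hPc i x).comp hcs.continuousOn hmaps))
    (fun t ht => Finset.measurable_sum _ fun i _ => (hPm i _ (hseg t ht)).const_mul _)
    (fun t ht => integrable_finsetSum _ (hint t ht))
    (fun t ht => ?_) (by simpa using hi θ hθ) (by simpa using hi θ' hθ')
  · simp only [one_smul, zero_smul, add_zero, add_sub_cancel] at key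
    rw [key]
    refine intervalIntegral.integral_congr fun t ht => ?_
    rw [uIcc_of_le zero_le_one] at ht
    dsimp only
    rw [integral_finsetSum _ (hint t ht)]
    simp only [integral_const_mul]
  · calc _ ≤ ∫ x, ∑ i, |(θ' - θ) i| * |partialDeriv Θ i (fun θ => F θ x) (θ + t • (θ' - θ))| := by
          refine integral_mono (integrable_finsetSum _ (hint t ht)).abs
            (integrable_finsetSum _ fun i _ => ((hPI i).1 _ (hseg t ht)).abs.const_mul _) ?_
          intro x
          refine (Finset.abs_sum_le_sum_abs _ _).trans (le_of_eq ?_)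
          simp only [abs_mul]
      _ = ∑ i, |(θ' - θ) i| * ∫ x, |partialDeriv Θ i (fun θ => F θ x) (θ + t • (θ' - θ))| := by
          rw [integral_finsetSum _ fun i _ => ((hPI i).1 _ (hseg t ht)).abs.const_mul _]
          simp only [integral_const_mul]
      _ ≤ _ := by
          refine Finset.sum_le_sum fun i _ => mul_le_mul_of_nonneg_left ?_ (abs_nonneg _)
          have he := (hf.envelope_integrable.1 _ (hseg t ht)).const_mul 2
          calc _ ≤ ∫ x, γ x ^ 2 + 2 * envelope Θ f (θ + t • (θ' - θ)) x :=
                integral_mono ((hPI i).1 _ (hseg t ht)).abs (hγ.add he) (hb i _ (hseg t ht))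
            _ = (∫ x, γ x ^ 2) + 2 * ∫ x, envelope Θ f (θ + t • (θ' - θ)) x := by
                rw [integral_add hγ he, integral_const_mul]
            _ ≤ _ := by linarith [hM _ (hseg t ht)]

end RegularFamily

end PMHDE

/-! ### First-order expansions of the Hellinger score and the Fisher information. -/

namespace PMHDE

/-- Cauchy–Schwarz for real integrals. -/
theorem abs_integral_mul_le_sqrt {α : Type*} [MeasurableSpace α] {μ : Measure α} {g h : α → ℝ}
    (hg : AEStronglyMeasurable g μ) (hh : AEStronglyMeasurable h μ)
    (hg2 : Integrable (fun x => g x ^ 2) μ) (hh2 : Integrable (fun x => h x ^ 2) μ) :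
    |∫ x, g x * h x ∂μ| ≤ √(∫ x, g x ^ 2 ∂μ) * √(∫ x, h x ^ 2 ∂μ) := by
  have h2 : (2 : ℝ).HolderConjugate 2 := Real.HolderConjugate.two_two
  have := integral_mul_norm_le_Lp_mul_Lq (μ := μ) (f := g) (g := h) h2
    (by simpa using (memLp_two_iff_integrable_sq hg).2 hg2)
    (by simpa using (memLp_two_iff_integrable_sq hh).2 hh2)
  simp only [Real.norm_eq_abs, Real.rpow_two, sq_abs, ← Real.sqrt_eq_rpow] at this
  refine (abs_integral_le_integral_abs).trans ?_
  simpa only [abs_mul] using this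

variable {m : ℕ} {Θ : Set (E m)} {f : E m → ℝ → ℝ} {p q : ℝ}

/-- `-2 ∫ γ √f_θ u_{θ,i}`; for `γ = √ḡ_n` this is the Hellinger score. -/
noncomputable def weightedScore (Θ : Set (E m)) (f : E m → ℝ → ℝ) (γ : ℝ → ℝ) (θ : E m)
    (i : Fin m) : ℝ :=
  -2 * ∫ x, γ x * rootScore Θ f θ i x

theorem gradLoss_apply (κ : ℝ → ℝ) (c b : ℕ → ℝ) {n : ℕ} (D : Fin n → ℝ) (θ : E m) (i : Fin m) :
    gradLoss Θ f κ c b D θ i = weightedScore Θ f (fun x => √(kde κ c b D x)) θ i := by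
  simp only [gradLoss, weightedScore, rootScore, mul_assoc]

namespace RegularFamily

variable (hf : RegularFamily Θ f p q)
include hf

/-- First order expansion of an integral, given control of its partial derivatives along a
segment. -/
theorem abs_integral_sub_sub_le {γ : ℝ → ℝ} (hγ : Integrable fun x => γ x ^ 2)
    {F : E m → ℝ → ℝ} (hm : ∀ θ ∈ Θ, Measurable (F θ)) (hi : ∀ θ ∈ Θ, Integrable (F θ))
    (hd : ∀ x, ContDiffOn ℝ 1 (fun θ => F θ x) Θ)
    (hb : ∀ i, ∀ θ ∈ Θ, ∀ x, |partialDeriv Θ i (fun θ => F θ x) θ| ≤ γ x ^ 2 + 2 * envelope Θ f θ x)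
    {θ θ' : E m} (hθ : θ ∈ Θ) (hθ' : θ' ∈ Θ) {D : Fin m → ℝ} {τ : ℝ}
    (hD : ∀ t ∈ Icc (0 : ℝ) 1, ∀ i,
      |(∫ x, partialDeriv Θ i (fun θ => F θ x) (θ + t • (θ' - θ))) - D i| ≤ τ) :
    |(∫ x, F θ' x) - (∫ x, F θ x) - ∑ i, (θ' - θ) i * D i| ≤ τ * ∑ i, |(θ' - θ) i| := by
  rw [hf.integral_sub_eq_of_le_envelope hγ hm hi hd hb hθ hθ']
  have hPm : ∀ i, ∀ θ ∈ Θ, Measurable fun x => partialDeriv Θ i (fun θ => F θ x) θ :=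
    fun i θ hθ => measurable_partialDeriv hf.convex hf.interior_nonempty hm hd i hθ
  have hPc : ∀ i x, ContinuousOn (partialDeriv Θ i (fun θ => F θ x)) Θ := fun i x =>
    (continuousOn_partialDeriv (n := 0) hf.uniqueDiffOn (by simpa using hd x) i).continuousOn
  have hPI := fun i => hf.continuousOn_integral_of_le_envelope hγ (hPm i) (hb i) (hPc i)
  have hcs : Continuous fun t : ℝ => θ + t • (θ' - θ) := by fun_prop
  have hmaps : MapsTo (fun t : ℝ => θ + t • (θ' - θ)) (Icc 0 1) Θ := fun t ht =>
    hf.convex.add_smul_sub_mem hθ hθ' ht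
  have hS : IntervalIntegrable (fun t : ℝ => ∑ i, (θ' - θ) i *
      ∫ x, partialDeriv Θ i (fun θ => F θ x) (θ + t • (θ' - θ))) volume 0 1 := by
    refine ContinuousOn.intervalIntegrable_of_Icc zero_le_one ?_
    exact continuousOn_finsetSum _ fun i _ =>
      continuousOn_const.mul ((hPI i).2.comp hcs.continuousOn hmaps)
  have hconst : ∑ i, (θ' - θ) i * D i = ∫ t in (0 : ℝ)..1, ∑ i, (θ' - θ) i * D i := by simp
  rw [hconst, ← intervalIntegral.integral_sub hS (by simp)]
  have hτ := intervalIntegral.norm_integral_le_of_norm_le_const (a := (0 : ℝ)) (b := 1)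
    (f := fun t : ℝ => (∑ i, (θ' - θ) i *
      ∫ x, partialDeriv Θ i (fun θ => F θ x) (θ + t • (θ' - θ))) - ∑ i, (θ' - θ) i * D i)
    (C := τ * ∑ i, |(θ' - θ) i|) fun t ht => ?_
  · simpa using hτ
  · rw [uIoc_of_le zero_le_one] at ht
    rw [← Finset.sum_sub_distrib, Real.norm_eq_abs, Finset.mul_sum]
    refine (Finset.abs_sum_le_sum_abs _ _).trans (Finset.sum_le_sum fun i _ => ?_)
    rw [← mul_sub, abs_mul, mul_comm]
    exact mul_le_mul_of_nonneg_right (hD t (Ioc_subset_Icc_self ht) i) (abs_nonneg _)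

/-- First order condition for an integral maximized at an interior point. -/
theorem integral_partialDeriv_eq_zero_of_isMax {γ : ℝ → ℝ} (hγ : Integrable fun x => γ x ^ 2)
    {F : E m → ℝ → ℝ} (hm : ∀ θ ∈ Θ, Measurable (F θ)) (hi : ∀ θ ∈ Θ, Integrable (F θ))
    (hd : ∀ x, ContDiffOn ℝ 1 (fun θ => F θ x) Θ)
    (hb : ∀ i, ∀ θ ∈ Θ, ∀ x, |partialDeriv Θ i (fun θ => F θ x) θ| ≤ γ x ^ 2 + 2 * envelope Θ f θ x)
    {θ : E m} (hθ : θ ∈ interior Θ)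
    (hmax : ∀ θ' ∈ interior Θ, ∫ x, F θ' x ≤ ∫ x, F θ x) (i : Fin m) :
    ∫ x, partialDeriv Θ i (fun θ => F θ x) θ = 0 := by
  have hPm : ∀ i, ∀ θ ∈ Θ, Measurable fun x => partialDeriv Θ i (fun θ => F θ x) θ :=
    fun i θ hθ => measurable_partialDeriv hf.convex hf.interior_nonempty hm hd i hθ
  have hPc : ∀ i x, ContinuousOn (partialDeriv Θ i (fun θ => F θ x)) Θ := fun i x =>
    (continuousOn_partialDeriv (n := 0) hf.uniqueDiffOn (by simpa using hd x) i).continuousOn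
  have hPI := fun i => (hf.continuousOn_integral_of_le_envelope hγ (hPm i) (hb i) (hPc i)).2
  set D : ℝ := ∫ x, partialDeriv Θ i (fun θ => F θ x) θ with hD
  -- A step of length r/2 in the direction σ e_i changes the integral by (r/2) σ D up to an error
  -- (r/2) ε, so maximality forces σ D ≤ ε. The two signs σ = 1 and σ = -1 together give D = 0.
  have key : ∀ σ : ℝ, |σ| = 1 → σ * D ≤ 0 := fun σ hσ => by
    refine le_of_forall_pos_le_add fun ε hε => ?_
    rw [zero_add]
    have hnhds : Θ ∈ 𝓝 θ := mem_interior_iff_mem_nhds.1 hθ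
    have hev : ∀ᶠ θ' in 𝓝 θ, θ' ∈ interior Θ ∧ ∀ j,
        |(∫ x, partialDeriv Θ j (fun θ => F θ x) θ') - ∫ x, partialDeriv Θ j (fun θ => F θ x) θ|
          ≤ ε := by
      refine (eventually_mem_set.2 (isOpen_interior.mem_nhds hθ)).and (eventually_all.2 fun j => ?_)
      filter_upwards [Metric.tendsto_nhds.1 ((hPI j).continuousAt hnhds) ε hε] with θ' h
      exact h.le
    obtain ⟨r, hr, hball⟩ := Metric.eventually_nhds_iff_ball.1 hev
    set e : E m := EuclideanSpace.single i σ with he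
    have hen : ‖e‖ = 1 := by simp [he, hσ]
    set θ' : E m := θ + (r / 2) • e with hθ'
    have hsub : θ' - θ = (r / 2) • e := by simp [hθ']
    have hseg : ∀ t ∈ Icc (0 : ℝ) 1, θ + t • (θ' - θ) ∈ Metric.ball θ r := fun t ht => by
      rw [hsub, Metric.mem_ball, dist_eq_norm, add_sub_cancel_left, norm_smul, norm_smul, hen,
        Real.norm_of_nonneg ht.1, Real.norm_of_nonneg (by positivity)]
      nlinarith [ht.1, ht.2]
    have hθ'm : θ' ∈ interior Θ := by
      have := (hball _ (hseg 1 (by simp))).1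
      simpa using this
    have := hf.abs_integral_sub_sub_le hγ hm hi hd hb (interior_subset hθ)
      (interior_subset hθ'm) (fun t ht j => (hball _ (hseg t ht)).2 j)
    rw [hsub] at this
    simp only [he, PiLp.smul_apply, PiLp.single_apply, smul_eq_mul, mul_ite, mul_zero, ite_mul,
      zero_mul, Finset.sum_ite_eq', Finset.mem_univ, if_true, abs_mul, apply_ite abs,
      abs_zero, hσ, mul_one] at this
    rw [abs_of_pos (by positivity : 0 < r / 2), ← hD] at this
    have h1 := (abs_le.1 this).1
    have h2 := hmax θ' hθ'm
    have h3 : r / 2 * (σ * D) ≤ r / 2 * ε := by nlinarith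
    exact le_of_mul_le_mul_left h3 (by positivity)
  have h1 := key 1 (by simp)
  have h2 := key (-1) (by simp)
  linarith

/-- Differentiation of a constant integral at an interior point. -/
theorem integral_partialDeriv_eq_zero
    {F : E m → ℝ → ℝ} (hm : ∀ θ ∈ Θ, Measurable (F θ)) (hi : ∀ θ ∈ Θ, Integrable (F θ))
    (hd : ∀ x, ContDiffOn ℝ 1 (fun θ => F θ x) Θ)
    (hb : ∀ i, ∀ θ ∈ Θ, ∀ x, |partialDeriv Θ i (fun θ => F θ x) θ| ≤ 2 * envelope Θ f θ x)
    {C : ℝ} (hC : ∀ θ ∈ interior Θ, ∫ x, F θ x = C) {θ : E m} (hθ : θ ∈ interior Θ) (i : Fin m) :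
    ∫ x, partialDeriv Θ i (fun θ => F θ x) θ = 0 :=
  hf.integral_partialDeriv_eq_zero_of_isMax (γ := fun _ => 0) (by simp) hm hi hd
    (by simpa using hb) hθ (fun θ' hθ' => by rw [hC _ hθ, hC _ hθ']) i

/-- The score is centred at interior parameters. -/
theorem integral_density_mul_score {θ : E m} (hθ : θ ∈ interior Θ) (i : Fin m) :
    ∫ x, f θ x * score Θ f θ i x = 0 := by
  have := hf.integral_partialDeriv_eq_zero (F := f) (fun θ hθ => hf.measurable_density hθ)
    (fun θ hθ => hf.integrable_density hθ) (fun x => (hf.contDiffOn x).of_le (by norm_num))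
    (fun i θ hθ x => by
      rw [hf.partialDeriv_density hθ]; exact hf.abs_density_mul_score_le hθ i x)
    (C := 1) (fun θ hθ => (hf.isDensity θ (interior_subset hθ)).integral_eq_one) hθ i
  simpa only [hf.partialDeriv_density (interior_subset hθ)] using this

/-- The information equality, in the form `E_θ[u_i u_j + ∂_i u_j] = 0`. -/
theorem integral_density_mul_score2 {θ : E m} (hθ : θ ∈ interior Θ) (i j : Fin m) :
    ∫ x, f θ x * (score Θ f θ i x * score Θ f θ j x + score2 Θ f θ i j x) = 0 := by
  have hm : ∀ θ ∈ Θ, Measurable fun x => f θ x * score Θ f θ j x := fun θ hθ =>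
    (hf.measurable_density hθ).mul (hf.measurable_score hθ j)
  have := hf.integral_partialDeriv_eq_zero (F := fun θ x => f θ x * score Θ f θ j x) hm
    (fun θ hθ => ((hf.envelope_integrable.1 θ hθ).const_mul 2).mono' (hm θ hθ).aestronglyMeasurable
      (Eventually.of_forall fun x => hf.abs_density_mul_score_le hθ j x))
    (fun x => ((hf.contDiffOn x).of_le (by norm_num)).mul
      ((hf.contDiffOn_score j x).of_le (by norm_num)))
    (fun i θ hθ x => by
      rw [hf.partialDeriv_density_mul_score hθ]; exact hf.abs_density_mul_score2_le hθ i j x)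
    (C := 0) (fun θ hθ => hf.integral_density_mul_score hθ j) hθ i
  simpa only [hf.partialDeriv_density_mul_score (interior_subset hθ)] using this

/-- The integrand splits as ½ f (u_i u_j + ∂_i u_j) + ½ f ∂_i u_j. The first half integrates to zero
by the information equality, and the second is the Fisher information up to the factor -1/2. -/
theorem integral_rootDensity_mul_rootHess {θ : E m} (hθ : θ ∈ interior Θ) (i j : Fin m) :
    ∫ x, √(f θ x) * rootHess Θ f θ i j x = -(1 / 2) * fisher Θ f θ i j := by
  have hΘ := interior_subset hθ
  have he := (hf.envelope_integrable.1 θ hΘ).const_mul 2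
  have h1 : Integrable fun x =>
      f θ x * (score Θ f θ i x * score Θ f θ j x + score2 Θ f θ i j x) :=
    he.mono' ((hf.measurable_density hΘ).mul (((hf.measurable_score hΘ i).mul
      (hf.measurable_score hΘ j)).add (hf.measurable_score2 hΘ i j))).aestronglyMeasurable
      (Eventually.of_forall fun x => hf.abs_density_mul_score2_le hΘ i j x)
  have h2 : Integrable fun x => score2 Θ f θ i j x * f θ x := by
    refine he.mono' ((hf.measurable_score2 hΘ i j).mul
      (hf.measurable_density hΘ)).aestronglyMeasurable (Eventually.of_forall fun x => ?_)
    have h := hf.mul_le_envelope hΘ i j x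
    have hp := hf.pos θ hΘ x
    rw [Real.norm_eq_abs, abs_mul, abs_of_pos hp, mul_comm]
    refine (mul_le_mul_of_nonneg_left (b := |score2 Θ f θ i j x|)
      (c := 2 * (1 + score Θ f θ i x ^ 2 + score2 Θ f θ i j x ^ 2
      + (score Θ f θ i x * score Θ f θ j x) ^ 2)) ?_ hp.le).trans (by linarith)
    nlinarith [sq_nonneg (score Θ f θ i x), sq_nonneg (|score2 Θ f θ i j x| - 1),
      sq_abs (score2 Θ f θ i j x), sq_nonneg (score Θ f θ i x * score Θ f θ j x)]
  have e : (fun x => √(f θ x) * rootHess Θ f θ i j x) = fun x =>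
      1 / 2 * (f θ x * (score Θ f θ i x * score Θ f θ j x + score2 Θ f θ i j x))
      + 1 / 2 * (score2 Θ f θ i j x * f θ x) := by
    funext x
    rw [rootHess, ← mul_assoc, Real.mul_self_sqrt (hf.pos θ hΘ x).le]
    ring
  rw [e, integral_add (h1.const_mul _) (h2.const_mul _), integral_const_mul, integral_const_mul,
    hf.integral_density_mul_score2 hθ, fisher]
  ring

/-- The arithmetic–geometric mean inequality separates the weight from the family, which is the
shape of domination required by `continuousOn_integral_of_le_envelope`. -/
theorem abs_mul_rootScore_le {θ : E m} (hθ : θ ∈ Θ) (γ : ℝ → ℝ) (i : Fin m) (x : ℝ) :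
    |γ x * rootScore Θ f θ i x| ≤ γ x ^ 2 + 2 * envelope Θ f θ x := by
  have h := hf.sq_rootScore_le hθ i x
  rw [abs_mul]
  nlinarith [sq_nonneg (|γ x| - |rootScore Θ f θ i x|), sq_abs (γ x),
    sq_abs (rootScore Θ f θ i x), sq_nonneg (γ x), sq_nonneg (rootScore Θ f θ i x)]

theorem abs_mul_rootHess_le {θ : E m} (hθ : θ ∈ Θ) (γ : ℝ → ℝ) (i j : Fin m) (x : ℝ) :
    |γ x * rootHess Θ f θ i j x| ≤ γ x ^ 2 + 2 * envelope Θ f θ x := by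
  have h := hf.sq_rootHess_le hθ i j x
  rw [abs_mul]
  nlinarith [sq_nonneg (|γ x| - |rootHess Θ f θ i j x|), sq_abs (γ x),
    sq_abs (rootHess Θ f θ i j x), sq_nonneg (γ x), sq_nonneg (rootHess Θ f θ i j x)]

theorem continuousOn_integral_mul_rootScore {γ : ℝ → ℝ} (hγm : Measurable γ)
    (hγ : Integrable fun x => γ x ^ 2) (i : Fin m) :
    (∀ θ ∈ Θ, Integrable fun x => γ x * rootScore Θ f θ i x) ∧
      ContinuousOn (fun θ => ∫ x, γ x * rootScore Θ f θ i x) Θ :=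
  hf.continuousOn_integral_of_le_envelope hγ
    (fun _ hθ => hγm.mul (hf.measurable_rootScore hθ i))
    (fun _ hθ x => hf.abs_mul_rootScore_le hθ γ i x)
    (fun x => continuousOn_const.mul (hf.continuousOn_rootScore i x))

theorem continuousOn_integral_mul_rootHess {γ : ℝ → ℝ} (hγm : Measurable γ)
    (hγ : Integrable fun x => γ x ^ 2) (i j : Fin m) :
    (∀ θ ∈ Θ, Integrable fun x => γ x * rootHess Θ f θ i j x) ∧
      ContinuousOn (fun θ => ∫ x, γ x * rootHess Θ f θ i j x) Θ :=
  hf.continuousOn_integral_of_le_envelope hγ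
    (fun _ hθ => hγm.mul (hf.measurable_rootHess hθ i j))
    (fun _ hθ x => hf.abs_mul_rootHess_le hθ γ i j x)
    (fun x => continuousOn_const.mul (hf.continuousOn_rootHess i j x))

theorem continuousOn_weightedScore {γ : ℝ → ℝ} (hγm : Measurable γ)
    (hγ : Integrable fun x => γ x ^ 2) (i : Fin m) :
    ContinuousOn (fun θ => weightedScore Θ f γ θ i) Θ :=
  continuousOn_const.mul (hf.continuousOn_integral_mul_rootScore hγm hγ i).2

/-- Near an interior parameter `θg` and for weights near `√f_{θg}`, the increments of the Hellinger
score are those of the linear map given by the Fisher information at `θg`. -/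
theorem exists_weightedScore_sub_approx {τ : ℝ} (hτ : 0 < τ) :
    ∃ ε₁ > 0, ∀ θg ∈ interior Θ, ∃ R > 0, Metric.closedBall θg R ⊆ Θ ∧
      ∀ γ : ℝ → ℝ, Measurable γ → Integrable (fun x => γ x ^ 2) →
        ∫ x, (γ x - √(f θg x)) ^ 2 ≤ ε₁ →
        ∀ θ ∈ Metric.closedBall θg R, ∀ θ' ∈ Metric.closedBall θg R, ∀ i,
          |weightedScore Θ f γ θ' i - weightedScore Θ f γ θ i
            - ∑ j, (θ' - θ) j * fisher Θ f θg j i| ≤ τ * ∑ j, |(θ' - θ) j| := by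
  obtain ⟨M, hM0, hM⟩ := hf.exists_integral_envelope_le
  -- Chosen so that Cauchy–Schwarz, with ∫ `rootHess`² ≤ 2M + 1, bounds the effect of replacing
  -- √f_{θ_g} by γ by τ/4. It involves only τ and the uniform bound M, not θ_g.
  refine ⟨(τ / 4) ^ 2 / (2 * M + 1), by positivity, fun θg hθg => ?_⟩
  have hΘg := interior_subset hθg
  set s : ℝ → ℝ := fun x => √(f θg x) with hs
  have hsm : Measurable s := (hf.measurable_density hΘg).sqrt
  have hs2 : Integrable fun x => s x ^ 2 := by
    simp only [hs, Real.sq_sqrt (hf.pos θg hΘg _).le]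
    exact hf.integrable_density hΘg
  have hev : ∀ᶠ θ in 𝓝 θg, θ ∈ Θ ∧ ∀ j i, |(∫ x, s x * rootHess Θ f θ j i x)
      - ∫ x, s x * rootHess Θ f θg j i x| ≤ τ / 4 := by
    have hn : Θ ∈ 𝓝 θg := mem_interior_iff_mem_nhds.1 hθg
    refine (eventually_mem_set.2 hn).and (eventually_all.2 fun j => eventually_all.2 fun i => ?_)
    filter_upwards [Metric.tendsto_nhds.1 (((hf.continuousOn_integral_mul_rootHess hsm hs2 j
      i).2).continuousAt hn) (τ / 4) (by positivity)] with θ h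
    exact h.le
  obtain ⟨R, hR, hball⟩ := Metric.nhds_basis_closedBall.eventually_iff.1 hev
  refine ⟨R, hR, fun θ hθ => (hball hθ).1, fun γ hγm hγ hclose θ hθ θ' hθ' i => ?_⟩
  have hF := hf.continuousOn_integral_mul_rootScore hγm hγ i
  have hP : ∀ j, ∀ θ ∈ Θ, ∀ x, partialDeriv Θ j (fun θ => γ x * rootScore Θ f θ i x) θ
      = γ x * rootHess Θ f θ j i x := fun j θ hθ x => by
    rw [← hf.partialDeriv_rootScore hθ]
    unfold partialDeriv
    rw [fderivWithin_const_mul (hf.uniqueDiffOn θ hθ) (((hf.contDiffOn_rootScore i x).differentiableOn one_ne_zero) θ hθ)]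
    rfl
  -- The tolerance τ/2 is spent as τ/4 for moving the parameter away from θ_g and τ/4 for changing
  -- the weight. The factor -2 of the Hellinger score turns it into τ.
  have key := hf.abs_integral_sub_sub_le hγ (F := fun θ x => γ x * rootScore Θ f θ i x)
    (fun _ hθ => hγm.mul (hf.measurable_rootScore hθ i)) hF.1
    (fun x => contDiffOn_const.mul (hf.contDiffOn_rootScore i x))
    (fun j θ hθ x => by rw [hP j θ hθ x]; exact hf.abs_mul_rootHess_le hθ γ j i x)
    (hball hθ).1 (hball hθ').1 (D := fun j => -(1 / 2) * fisher Θ f θg j i) (τ := τ / 2)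
    fun t ht j => ?_
  · have e : weightedScore Θ f γ θ' i - weightedScore Θ f γ θ i
        - ∑ j, (θ' - θ) j * fisher Θ f θg j i
        = -2 * ((∫ x, γ x * rootScore Θ f θ' i x) - (∫ x, γ x * rootScore Θ f θ i x)
          - ∑ j, (θ' - θ) j * (-(1 / 2) * fisher Θ f θg j i)) := by
      have : ∑ j, (θ' - θ) j * (-(1 / 2) * fisher Θ f θg j i)
          = -(1 / 2) * ∑ j, (θ' - θ) j * fisher Θ f θg j i := by
        rw [Finset.mul_sum]
        exact Finset.sum_congr rfl fun j _ => by ring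
      rw [this, weightedScore, weightedScore]
      ring
    rw [e, abs_mul, abs_neg, abs_two]
    linarith
  · have hmem : θ + t • (θ' - θ) ∈ Metric.closedBall θg R :=
      (convex_closedBall θg R).add_smul_sub_mem hθ hθ' ht
    obtain ⟨hΘt, hΨ⟩ := hball hmem
    set ϑ := θ + t • (θ' - θ)
    simp only [hP j ϑ hΘt]
    rw [← hf.integral_rootDensity_mul_rootHess hθg]
    have i1 := (hf.continuousOn_integral_mul_rootHess hγm hγ j i).1 ϑ hΘt
    have i2 := (hf.continuousOn_integral_mul_rootHess hsm hs2 j i).1 ϑ hΘt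
    have hHm := hf.measurable_rootHess hΘt j i
    have he := (hf.envelope_integrable.1 ϑ hΘt).const_mul 2
    have hH2 : Integrable fun x => rootHess Θ f ϑ j i x ^ 2 :=
      he.mono' (hHm.pow_const 2).aestronglyMeasurable (Eventually.of_forall fun x => by
        rw [Real.norm_of_nonneg (sq_nonneg _)]; exact hf.sq_rootHess_le hΘt j i x)
    have hd2 : Integrable fun x => (γ x - s x) ^ 2 := by
      refine ((hγ.const_mul 2).add (hs2.const_mul 2)).mono'
        ((hγm.sub hsm).pow_const 2).aestronglyMeasurable (Eventually.of_forall fun x => ?_)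
      rw [Real.norm_of_nonneg (sq_nonneg _)]
      simp only [Pi.add_apply]
      nlinarith [sq_nonneg (γ x + s x)]
    have hcs := abs_integral_mul_le_sqrt (hγm.sub hsm).aestronglyMeasurable
      hHm.aestronglyMeasurable hd2 hH2
    have e : ∫ x, (γ x - s x) * rootHess Θ f ϑ j i x
        = (∫ x, γ x * rootHess Θ f ϑ j i x) - ∫ x, s x * rootHess Θ f ϑ j i x := by
      rw [← integral_sub i1 i2]
      simp only [sub_mul]
    have hb : √(∫ x, (γ x - s x) ^ 2) * √(∫ x, rootHess Θ f ϑ j i x ^ 2) ≤ τ / 4 := by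
      have h2 : ∫ x, rootHess Θ f ϑ j i x ^ 2 ≤ 2 * M + 1 := by
        have := integral_mono hH2 he fun x => hf.sq_rootHess_le hΘt j i x
        rw [integral_const_mul] at this
        linarith [hM ϑ hΘt]
      rw [← Real.sqrt_mul (integral_nonneg fun _ => sq_nonneg _)]
      refine Real.sqrt_le_iff.2 ⟨by positivity, ?_⟩
      calc _ ≤ (τ / 4) ^ 2 / (2 * M + 1) * (2 * M + 1) :=
            mul_le_mul hclose h2 (integral_nonneg fun _ => sq_nonneg _) (by positivity)
        _ = _ := by field_simp
    have h3 := hΨ j i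
    simp only [Pi.sub_apply] at hcs
    rw [e] at hcs
    have h4 := abs_add_le ((∫ x, γ x * rootHess Θ f ϑ j i x) - ∫ x, s x * rootHess Θ f ϑ j i x)
      ((∫ x, s x * rootHess Θ f ϑ j i x) - ∫ x, s x * rootHess Θ f θg j i x)
    rw [sub_add_sub_cancel] at h4
    linarith

/-- The Fisher information is uniformly positive definite and uniformly bounded. -/
theorem exists_fisher_bounds : ∃ lam M : ℝ, 0 < lam ∧ 0 ≤ M ∧ ∀ θ ∈ Θ,
    (∀ i j, |fisher Θ f θ i j| ≤ M) ∧
    ∀ v : E m, lam * ‖v‖ ^ 2 ≤ ∑ i, ∑ j, v i * v j * fisher Θ f θ j i := by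
  have hcont : ∀ i j, ContinuousOn (fun θ => fisher Θ f θ i j) Θ := fun i j =>
    (continuous_apply_apply i j).comp_continuousOn hf.fisher_continuous
  have hM : ∃ M, 0 ≤ M ∧ ∀ θ ∈ Θ, ∀ i j, |fisher Θ f θ i j| ≤ M := by
    obtain ⟨M, hM⟩ := hf.isCompact.bddAbove_image (f := fun θ => ∑ i, ∑ j, |fisher Θ f θ i j|)
      (continuousOn_finsetSum _ fun i _ => continuousOn_finsetSum _ fun j _ => (hcont i j).abs)
    exact ⟨max M 0, le_max_right _ _, fun θ hθ i j =>
      ((le_sum_sum (a := fun i j => |fisher Θ f θ i j|) (fun _ _ => abs_nonneg _) i j).trans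
        (hM (mem_image_of_mem _ hθ))).trans (le_max_left _ _)⟩
  obtain ⟨M, hM0, hM⟩ := hM
  -- Joint continuity of the quadratic form on the compact product of the parameter set with the
  -- unit sphere yields one positive lower bound for all parameters.
  set Q : E m × E m → ℝ := fun z => ∑ i, ∑ j, z.2 i * z.2 j * fisher Θ f z.1 j i with hQ
  have hQc : ContinuousOn Q (Θ ×ˢ Metric.sphere (0 : E m) 1) := by
    refine continuousOn_finsetSum _ fun i _ => continuousOn_finsetSum _ fun j _ => ?_
    refine ContinuousOn.mul (by fun_prop) ?_
    exact (hcont j i).comp continuousOn_fst fun z hz => hz.1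
  have hcomp : IsCompact (Θ ×ˢ Metric.sphere (0 : E m) 1) :=
    hf.isCompact.prod (isCompact_sphere _ _)
  have hpos : ∀ z ∈ Θ ×ˢ Metric.sphere (0 : E m) 1, 0 < Q z := fun z hz => by
    have hz2 : z.2 ≠ 0 := fun h => by have := hz.2; simp [h] at this
    have h := (hf.fisher_posDef z.1 hz.1).dotProduct_mulVec_pos (x := z.2.ofLp)
      (fun h => hz2 (by ext i; exact congrFun h i))
    refine lt_of_lt_of_eq h ?_
    simp only [dotProduct, Matrix.mulVec, star_trivial, Finset.mul_sum, hQ]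
    rw [Finset.sum_comm]
    exact Finset.sum_congr rfl fun i _ => Finset.sum_congr rfl fun j _ => by ring
  have hlam : ∃ lam > 0, ∀ z ∈ Θ ×ˢ Metric.sphere (0 : E m) 1, lam ≤ Q z := by
    -- The empty case occurs in dimension zero, where there are no unit vectors.
    rcases (Θ ×ˢ Metric.sphere (0 : E m) 1).eq_empty_or_nonempty with h | h
    · exact ⟨1, one_pos, by simp [h]⟩
    · obtain ⟨z, hz, hmin⟩ := hcomp.exists_isMinOn h hQc
      exact ⟨Q z, hpos z hz, fun w hw => hmin hw⟩
  obtain ⟨lam, hl, hlQ⟩ := hlam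
  refine ⟨lam, M, hl, hM0, fun θ hθ => ⟨hM θ hθ, fun v => ?_⟩⟩
  by_cases hv : v = 0
  · simp [hv]
  have hn : 0 < ‖v‖ := norm_pos_iff.2 hv
  have := hlQ (θ, ‖v‖⁻¹ • v) ⟨hθ, by simp [norm_smul, hn.ne']⟩
  have e : Q (θ, ‖v‖⁻¹ • v) = (∑ i, ∑ j, v i * v j * fisher Θ f θ j i) / ‖v‖ ^ 2 := by
    simp only [hQ, PiLp.smul_apply, smul_eq_mul, Finset.sum_div]
    exact Finset.sum_congr rfl fun i _ => Finset.sum_congr rfl fun j _ => by field_simp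
  rwa [e, le_div_iff₀ (by positivity)] at this

end RegularFamily

end PMHDE

/-! ### Kernel estimates, contraction of gradient steps, and stability of the MHDE. -/

namespace PMHDE

section KernelDensityEstimator

variable {κ : ℝ → ℝ} {c b : ℕ → ℝ}

theorem integrable_of_isDensity {g : ℝ → ℝ} (hg : IsDensity g) : Integrable g :=
  integrable_of_integral_eq_one hg.integral_eq_one

theorem kde_nonneg_of_nonneg {κ : ℝ → ℝ} (h0 : ∀ x, 0 ≤ κ x) {c : ℕ → ℝ} (hc : ∀ n, 0 < c n)
    (b : ℕ → ℝ) {n : ℕ} (D : Fin n → ℝ) (x : ℝ) : 0 ≤ kde κ c b D x := by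
  unfold kde
  have := hc n
  refine mul_nonneg (by positivity) (Finset.sum_nonneg fun i _ => ?_)
  exact indicator_nonneg (fun _ _ => h0 _) _

theorem kde_nonneg (h : KernelDesign κ c b) {n : ℕ} (D : Fin n → ℝ) (x : ℝ) :
    0 ≤ kde κ c b D x :=
  kde_nonneg_of_nonneg h.isDensity.nonneg h.c_pos b D x

theorem measurable_kde_uncurry {κ : ℝ → ℝ} (hκ : Measurable κ) (c b : ℕ → ℝ) (n : ℕ) :
    Measurable fun z : (Fin n → ℝ) × ℝ => kde κ c b z.1 z.2 := by
  unfold kde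
  refine (Finset.measurable_sum _ fun i _ => ?_).const_mul _
  have h1 : Measurable fun z : (Fin n → ℝ) × ℝ => κ ((z.2 - z.1 i) / c n) :=
    hκ.comp (by fun_prop)
  have h2 : MeasurableSet {z : (Fin n → ℝ) × ℝ | z.1 i ∈ Ioo (-b n) (b n)} :=
    (show Measurable fun z : (Fin n → ℝ) × ℝ => z.1 i by fun_prop) measurableSet_Ioo
  exact h1.indicator h2

theorem measurable_kde (h : KernelDesign κ c b) {n : ℕ} (D : Fin n → ℝ) :
    Measurable (kde κ c b D) :=
  (measurable_kde_uncurry h.isDensity.measurable c b n).comp (measurable_const.prodMk measurable_id)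

theorem integrable_kernel_comp {κ : ℝ → ℝ} (hκ : Integrable κ) {a : ℝ} (ha : 0 < a) (y : ℝ) :
    Integrable fun x => κ ((x - y) / a) :=
  (hκ.comp_div ha.ne').comp_sub_right y

theorem integral_kernel_comp (κ : ℝ → ℝ) {a : ℝ} (ha : 0 < a) (y : ℝ) :
    ∫ x, κ ((x - y) / a) = a * ∫ x, κ x := by
  rw [integral_sub_right_eq_self (fun x => κ (x / a)) y, Measure.integral_comp_div,
    abs_of_pos ha, smul_eq_mul]

theorem indicator_kernel_eq (κ : ℝ → ℝ) (a t : ℝ) (y : ℝ) (x : ℝ) :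
    (Ioo (-t) t).indicator (fun y => κ ((x - y) / a)) y
      = (Ioo (-t) t).indicator (fun _ => (1 : ℝ)) y * κ ((x - y) / a) := by
  by_cases hy : y ∈ Ioo (-t) t <;> simp [hy]

theorem integrable_kde_of_integrable {κ : ℝ → ℝ} (hκ : Integrable κ) {c : ℕ → ℝ}
    (hc : ∀ n, 0 < c n) (b : ℕ → ℝ) {n : ℕ} (D : Fin n → ℝ) : Integrable (kde κ c b D) := by
  unfold kde
  simp only [indicator_kernel_eq]
  exact (integrable_finsetSum _ fun i _ =>
    (integrable_kernel_comp hκ (hc n) (D i)).const_mul _).const_mul _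

/-- Each retained observation contributes mass c_n ∫ κ and the truncation can only discard some,
hence an inequality. The kernel need not be normalized because the bound is also applied to the
difference of a kernel and its truncation. -/
theorem integral_kde_le {κ : ℝ → ℝ} (hκ : Integrable κ) (h0 : ∀ x, 0 ≤ κ x) {c : ℕ → ℝ}
    (hc : ∀ n, 0 < c n) (b : ℕ → ℝ) {n : ℕ} (D : Fin n → ℝ) :
    ∫ x, kde κ c b D x ≤ ∫ x, κ x := by
  unfold kde
  have hcn := hc n
  have hJ : 0 ≤ ∫ x, κ x := integral_nonneg h0
  simp only [indicator_kernel_eq]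
  rw [integral_const_mul, integral_finsetSum _ fun i _ =>
    (integrable_kernel_comp hκ hcn (D i)).const_mul _]
  simp only [integral_const_mul, integral_kernel_comp κ hcn]
  rcases Nat.eq_zero_or_pos n with rfl | hn
  · simpa using hJ
  have hn' : (0 : ℝ) < n := by exact_mod_cast hn
  have : ∑ i : Fin n, (Ioo (-b n) (b n)).indicator (fun _ => (1 : ℝ)) (D i) * (c n * ∫ x, κ x)
      ≤ n * (c n * ∫ x, κ x) := by
    calc _ ≤ ∑ _i : Fin n, c n * ∫ x, κ x := Finset.sum_le_sum fun i _ => by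
          by_cases hy : D i ∈ Ioo (-b n) (b n) <;> simp [hy, mul_nonneg hcn.le hJ]
      _ = _ := by simp
  calc _ ≤ 1 / (n * c n) * (n * (c n * ∫ x, κ x)) :=
        mul_le_mul_of_nonneg_left this (by positivity)
    _ = ∫ x, κ x := by field_simp

theorem integrable_kde (h : KernelDesign κ c b) {n : ℕ} (D : Fin n → ℝ) :
    Integrable (kde κ c b D) :=
  integrable_kde_of_integrable (integrable_of_isDensity h.isDensity) h.c_pos b D

end KernelDensityEstimator

section RootDensities

/-- Expansion of the squared Hellinger distance. -/
theorem hdSq_eq {g h : ℝ → ℝ} (hg0 : ∀ x, 0 ≤ g x) (hh0 : ∀ x, 0 ≤ h x) (hgm : Measurable g)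
    (hhm : Measurable h) (hg : Integrable g) (hh : Integrable h) :
    hdSq g h = (∫ x, g x) + (∫ x, h x) - 2 * ∫ x, √(h x) * √(g x) := by
  have hm : Integrable fun x => √(h x) * √(g x) := by
    refine (hg.add hh).mono' (hhm.sqrt.mul hgm.sqrt).aestronglyMeasurable
      (Eventually.of_forall fun x => ?_)
    rw [Real.norm_of_nonneg (by positivity)]
    simp only [Pi.add_apply]
    nlinarith [sq_nonneg (√(h x) - √(g x)), Real.sq_sqrt (hg0 x), Real.sq_sqrt (hh0 x),
      hg0 x, hh0 x]
  have hadd : Integrable fun x => g x + h x := hg.add hh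
  rw [← integral_add hg hh, ← integral_const_mul, ← integral_sub hadd (hm.const_mul 2), hdSq]
  refine integral_congr_ae (Eventually.of_forall fun x => ?_)
  simp only [sub_sq, Real.sq_sqrt (hg0 x), Real.sq_sqrt (hh0 x)]
  ring

theorem integrable_sq_sqrt {g : ℝ → ℝ} (hg0 : ∀ x, 0 ≤ g x) (hg : Integrable g) :
    Integrable fun x => √(g x) ^ 2 := by
  simpa only [Real.sq_sqrt (hg0 _)] using hg

theorem integrable_sq_sub {g h : ℝ → ℝ} (hgm : Measurable g) (hhm : Measurable h)
    (hg : Integrable fun x => g x ^ 2) (hh : Integrable fun x => h x ^ 2) :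
    Integrable fun x => (g x - h x) ^ 2 := by
  refine ((hg.const_mul 2).add (hh.const_mul 2)).mono'
    ((hgm.sub hhm).pow_const 2).aestronglyMeasurable (Eventually.of_forall fun x => ?_)
  rw [Real.norm_of_nonneg (sq_nonneg _)]
  simp only [Pi.add_apply]
  nlinarith [sq_nonneg (g x + h x)]

end RootDensities

variable {m : ℕ} {Θ : Set (E m)} {f : E m → ℝ → ℝ} {p q : ℝ}

theorem sum_abs_le_mul_norm (v : E m) : ∑ j, |v j| ≤ m * ‖v‖ := by
  calc _ ≤ ∑ _j : Fin m, ‖v‖ := Finset.sum_le_sum fun j _ => by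
        simpa using PiLp.norm_apply_le v j
    _ = _ := by simp

theorem norm_le_sum_abs (v : E m) : ‖v‖ ≤ ∑ j, |v j| := by
  conv_lhs => rw [← (EuclideanSpace.basisFun (Fin m) ℝ).sum_repr v]
  refine (norm_sum_le _ _).trans (Finset.sum_le_sum fun i _ => ?_)
  simp [norm_smul]

/-- A strongly monotone Lipschitz increment is contracted by a small gradient step. -/
theorem norm_sub_smul_le {v w : E m} {lam L : ℝ} (hL : 0 < L) (hl : 0 ≤ lam)
    (h1 : lam * ‖v‖ ^ 2 ≤ inner ℝ v w) (h2 : ‖w‖ ≤ L * ‖v‖) :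
    ‖v - (lam / L ^ 2) • w‖ ≤ √(1 - lam ^ 2 / L ^ 2) * ‖v‖ := by
  -- On expanding the square, the cross term gains 2 lam²/L² and the quadratic term loses at most
  -- lam²/L². The step lam/L² is the one that optimizes this bound.
  have e : ‖v - (lam / L ^ 2) • w‖ ^ 2 ≤ (1 - lam ^ 2 / L ^ 2) * ‖v‖ ^ 2 := by
    rw [norm_sub_sq_real, inner_smul_right, norm_smul, Real.norm_of_nonneg (by positivity)]
    have h3 : ‖w‖ ^ 2 ≤ L ^ 2 * ‖v‖ ^ 2 := by
      rw [← mul_pow]; exact pow_le_pow_left₀ (norm_nonneg _) h2 2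
    have h4 : lam / L ^ 2 * (lam * ‖v‖ ^ 2) ≤ lam / L ^ 2 * inner ℝ v w :=
      mul_le_mul_of_nonneg_left h1 (by positivity)
    have h5 : (lam / L ^ 2) ^ 2 * ‖w‖ ^ 2 ≤ (lam / L ^ 2) ^ 2 * (L ^ 2 * ‖v‖ ^ 2) :=
      mul_le_mul_of_nonneg_left h3 (by positivity)
    have h6 : (lam / L ^ 2) ^ 2 * (L ^ 2 * ‖v‖ ^ 2) = lam ^ 2 / L ^ 2 * ‖v‖ ^ 2 := by
      field_simp
    have h7 : lam / L ^ 2 * (lam * ‖v‖ ^ 2) = lam ^ 2 / L ^ 2 * ‖v‖ ^ 2 := by ring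
    rw [mul_pow]
    linarith
  rw [← Real.sqrt_sq (norm_nonneg (v - _)), ← Real.sqrt_sq (norm_nonneg v)]
  rw [← Real.sqrt_mul' _ (by positivity)]
  refine Real.sqrt_le_sqrt ?_
  simpa using e

namespace RegularFamily

variable (hf : RegularFamily Θ f p q)
include hf

theorem integrable_sq_rootDensity {θ : E m} (hθ : θ ∈ Θ) : Integrable fun x => √(f θ x) ^ 2 :=
  integrable_sq_sqrt (fun x => (hf.pos θ hθ x).le) (hf.integrable_density hθ)

/-- Gradient steps for the Hellinger loss contract near an interior parameter. -/
theorem exists_gradient_contraction : ∃ ε₁ η ρ : ℝ, 0 < ε₁ ∧ 0 < η ∧ 0 < ρ ∧ ρ < 1 ∧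
    ∀ θg ∈ interior Θ, ∃ R > 0, Metric.closedBall θg R ⊆ Θ ∧
      ∀ γ : ℝ → ℝ, Measurable γ → Integrable (fun x => γ x ^ 2) →
        ∫ x, (γ x - √(f θg x)) ^ 2 ≤ ε₁ →
        ∀ θ ∈ Metric.closedBall θg R, ∀ θ' ∈ Metric.closedBall θg R,
          ‖(θ' - θ) - η • (WithLp.toLp 2 (weightedScore Θ f γ θ')
            - WithLp.toLp 2 (weightedScore Θ f γ θ) : E m)‖ ≤ ρ * ‖θ' - θ‖ := by
  obtain ⟨lam, M, hl, hM0, hI⟩ := hf.exists_fisher_bounds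
  -- Since (∑ |v_j|)² ≤ m² ‖v‖², this τ costs at most half of the lower bound lam, leaving strong
  -- monotonicity with constant lam/2. The +1 keeps the denominator positive when m = 0.
  set τ : ℝ := lam / (2 * (m ^ 2 + 1)) with hτ
  have hτ0 : 0 < τ := by positivity
  have hτm : τ * m ^ 2 ≤ lam / 2 := by
    rw [hτ, div_mul_eq_mul_div, div_le_div_iff₀ (by positivity) (by positivity)]
    nlinarith
  obtain ⟨ε₁, hε₁, happ⟩ := hf.exists_weightedScore_sub_approx hτ0
  -- The first summand is the Lipschitz constant of the gradient on the ball. Adding lam keeps lam/2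
  -- strictly below L, so that the contraction factor is the root of a positive number.
  set L : ℝ := m ^ 2 * (M + τ) + lam with hL
  have hL0 : 0 < L := by positivity
  have hlL : (lam / 2) ^ 2 / L ^ 2 < 1 := by
    rw [div_lt_one (by positivity)]
    have : lam ≤ L := by rw [hL]; nlinarith [mul_nonneg (sq_nonneg (m : ℝ)) (add_nonneg hM0 hτ0.le)]
    nlinarith
  refine ⟨ε₁, lam / 2 / L ^ 2, √(1 - (lam / 2) ^ 2 / L ^ 2), hε₁, by positivity,
    Real.sqrt_pos.2 (by linarith), ?_, fun θg hθg => ?_⟩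
  · rw [Real.sqrt_lt' one_pos]
    have : 0 < (lam / 2) ^ 2 / L ^ 2 := by positivity
    linarith
  obtain ⟨R, hR, hsub, hR'⟩ := happ θg hθg
  obtain ⟨hIM, hIl⟩ := hI θg (interior_subset hθg)
  refine ⟨R, hR, hsub, fun γ hγm hγ hcl θ hθ θ' hθ' => ?_⟩
  have h := hR' γ hγm hγ hcl θ hθ θ' hθ'
  set v := θ' - θ
  set w : E m := WithLp.toLp 2 (weightedScore Θ f γ θ') - WithLp.toLp 2 (weightedScore Θ f γ θ)
  have hw : ∀ i, w i = weightedScore Θ f γ θ' i - weightedScore Θ f γ θ i := fun i => rfl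
  simp only [← hw] at h
  have hS := sum_abs_le_mul_norm v
  have hS0 : 0 ≤ ∑ j, |v j| := Finset.sum_nonneg fun _ _ => abs_nonneg _
  refine norm_sub_smul_le hL0 (by positivity) ?_ ?_
  · have e : inner ℝ v w = (∑ i, ∑ j, v i * v j * fisher Θ f θg j i)
        + ∑ i, v i * (w i - ∑ j, v j * fisher Θ f θg j i) := by
      rw [← Finset.sum_add_distrib, PiLp.inner_apply]
      refine Finset.sum_congr rfl fun i _ => ?_
      rw [mul_sub, Finset.mul_sum]
      simp only [mul_assoc, Real.inner_apply]
      ring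
    have h2 : |∑ i, v i * (w i - ∑ j, v j * fisher Θ f θg j i)| ≤ τ * (∑ j, |v j|) ^ 2 := by
      calc _ ≤ ∑ i, |v i| * (τ * ∑ j, |v j|) := by
            refine (Finset.abs_sum_le_sum_abs _ _).trans (Finset.sum_le_sum fun i _ => ?_)
            rw [abs_mul]
            exact mul_le_mul_of_nonneg_left (h i) (abs_nonneg _)
        _ = _ := by rw [← Finset.sum_mul]; ring
    have h3 : τ * (∑ j, |v j|) ^ 2 ≤ lam / 2 * ‖v‖ ^ 2 := by
      calc _ ≤ τ * (m * ‖v‖) ^ 2 :=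
            mul_le_mul_of_nonneg_left (pow_le_pow_left₀ hS0 hS 2) hτ0.le
        _ = τ * m ^ 2 * ‖v‖ ^ 2 := by ring
        _ ≤ _ := mul_le_mul_of_nonneg_right hτm (by positivity)
    have h4 := hIl v
    rw [e]
    linarith [(abs_le.1 h2).1]
  · have hwi : ∀ i, |w i| ≤ (M + τ) * ∑ j, |v j| := fun i => by
      have h5 : |∑ j, v j * fisher Θ f θg j i| ≤ M * ∑ j, |v j| := by
        rw [Finset.mul_sum]
        refine (Finset.abs_sum_le_sum_abs _ _).trans (Finset.sum_le_sum fun j _ => ?_)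
        rw [abs_mul, mul_comm]
        exact mul_le_mul_of_nonneg_right (hIM j i) (abs_nonneg _)
      have h6 := abs_add_le (w i - ∑ j, v j * fisher Θ f θg j i) (∑ j, v j * fisher Θ f θg j i)
      rw [sub_add_cancel] at h6
      linarith [h i]
    calc ‖w‖ ≤ ∑ i, |w i| := norm_le_sum_abs w
      _ ≤ ∑ _i : Fin m, (M + τ) * (m * ‖v‖) := Finset.sum_le_sum fun i _ =>
          (hwi i).trans (mul_le_mul_of_nonneg_left hS (by positivity))
      _ = m ^ 2 * (M + τ) * ‖v‖ := by simp; ring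
      _ ≤ L * ‖v‖ := mul_le_mul_of_nonneg_right (by rw [hL]; linarith) (norm_nonneg _)

theorem continuousOn_integral_mul_rootDensity {γ : ℝ → ℝ} (hγm : Measurable γ)
    (hγ : Integrable fun x => γ x ^ 2) :
    (∀ θ ∈ Θ, Integrable fun x => γ x * √(f θ x)) ∧
      ContinuousOn (fun θ => ∫ x, γ x * √(f θ x)) Θ := by
  refine hf.continuousOn_integral_of_le_envelope hγ
    (fun _ hθ => hγm.mul (hf.measurable_density hθ).sqrt) (fun θ hθ x => ?_)
    (fun x => continuousOn_const.mul (hf.continuousOn_density x).sqrt)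
  have hp := (hf.pos θ hθ x).le
  have h : f θ x ≤ envelope Θ f θ x := by
    refine le_mul_of_one_le_left hp ?_
    have h1 : 0 ≤ ∑ i, score Θ f θ i x ^ 2 := Finset.sum_nonneg fun _ _ => sq_nonneg _
    have h2 : 0 ≤ ∑ i, ∑ j, score2 Θ f θ i j x ^ 2 :=
      Finset.sum_nonneg fun _ _ => Finset.sum_nonneg fun _ _ => sq_nonneg _
    have h3 : 0 ≤ ∑ i, ∑ j, (score Θ f θ i x * score Θ f θ j x) ^ 2 :=
      Finset.sum_nonneg fun _ _ => Finset.sum_nonneg fun _ _ => sq_nonneg _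
    linarith
  rw [abs_mul, abs_of_nonneg (Real.sqrt_nonneg _)]
  nlinarith [sq_nonneg (|γ x| - √(f θ x)), sq_abs (γ x), Real.sq_sqrt hp, sq_nonneg (γ x)]

theorem hdSq_density_eq {θ : E m} (hθ : θ ∈ Θ) {h : ℝ → ℝ} (hh0 : ∀ x, 0 ≤ h x)
    (hhm : Measurable h) (hh : Integrable h) :
    hdSq (f θ) h = 1 + (∫ x, h x) - 2 * ∫ x, √(h x) * √(f θ x) := by
  rw [hdSq_eq (fun x => (hf.pos θ hθ x).le) hh0 (hf.measurable_density hθ) hhm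
    (hf.integrable_density hθ) hh, (hf.isDensity θ hθ).integral_eq_one]

variable {κ : ℝ → ℝ} {c b : ℕ → ℝ}

/-- Every f_θ has total mass one, so θ enters the loss only through the affinity, with a negative
sign. -/
theorem affinity_le_of_isMHDE (hK : KernelDesign κ c b) {n : ℕ} {D : Fin n → ℝ} {θ : E m}
    (h : IsMHDE Θ f κ c b D θ) {θ' : E m} (hθ' : θ' ∈ Θ) :
    ∫ x, √(kde κ c b D x) * √(f θ' x) ≤ ∫ x, √(kde κ c b D x) * √(f θ x) := by
  have := h.2 θ' hθ'
  rw [loss, loss, hf.hdSq_density_eq h.1 (kde_nonneg hK D) (measurable_kde hK D)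
    (integrable_kde hK D), hf.hdSq_density_eq hθ' (kde_nonneg hK D) (measurable_kde hK D)
    (integrable_kde hK D)] at this
  linarith

theorem partialDeriv_rootDensity {θ : E m} (hθ : θ ∈ Θ) (i : Fin m) (x : ℝ) :
    partialDeriv Θ i (fun θ => √(f θ x)) θ = 1 / 2 * rootScore Θ f θ i x := by
  have hd : DifferentiableWithinAt ℝ (fun θ => f θ x) Θ θ :=
    (hf.contDiffOn x).differentiableOn (by norm_num) θ hθ
  have hp := hf.pos θ hθ x
  have h := hf.partialDeriv_density hθ i x
  rw [partialDeriv] at h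
  rw [partialDeriv, fderivWithin_sqrt hd hp.ne' (hf.uniqueDiffOn θ hθ), smul_apply, h, rootScore,
    smul_eq_mul]
  have hsq := Real.mul_self_sqrt hp.le
  have hne : √(f θ x) ≠ 0 := (Real.sqrt_pos.2 hp).ne'
  nth_rw 2 [← hsq]
  field_simp

/-- The Hellinger score vanishes at an interior minimum Hellinger distance estimate. -/
theorem gradLoss_eq_zero_of_isMHDE (hK : KernelDesign κ c b) {n : ℕ} {D : Fin n → ℝ} {θ : E m}
    (h : IsMHDE Θ f κ c b D θ) (hθ : θ ∈ interior Θ) : gradLoss Θ f κ c b D θ = 0 := by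
  ext i
  rw [gradLoss_apply, weightedScore]
  set γ : ℝ → ℝ := fun x => √(kde κ c b D x) with hγ
  have hγm : Measurable γ := (measurable_kde hK D).sqrt
  have hγ2 : Integrable fun x => γ x ^ 2 :=
    integrable_sq_sqrt (kde_nonneg hK D) (integrable_kde hK D)
  have hP : ∀ i, ∀ θ ∈ Θ, ∀ x, partialDeriv Θ i (fun θ => γ x * √(f θ x)) θ
      = 1 / 2 * (γ x * rootScore Θ f θ i x) := fun i θ hθ x => by
    have hd : DifferentiableWithinAt ℝ (fun θ => √(f θ x)) Θ θ :=
      ((hf.contDiffOn x).differentiableOn (by norm_num) θ hθ).sqrt (hf.pos θ hθ x).ne'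
    have h1 := hf.partialDeriv_rootDensity hθ i x
    unfold partialDeriv at h1 ⊢
    rw [fderivWithin_const_mul (hf.uniqueDiffOn θ hθ) hd, smul_apply, h1, smul_eq_mul]
    ring
  have := hf.integral_partialDeriv_eq_zero_of_isMax hγ2 (F := fun θ x => γ x * √(f θ x))
    (fun _ hθ => hγm.mul (hf.measurable_density hθ).sqrt)
    (hf.continuousOn_integral_mul_rootDensity hγm hγ2).1
    (fun x => contDiffOn_const.mul (((hf.contDiffOn x).of_le (by norm_num)).sqrt
      fun θ hθ => (hf.pos θ hθ x).ne'))
    (fun i θ hθ x => by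
      rw [hP i θ hθ x, abs_mul]
      have := hf.abs_mul_rootScore_le hθ γ i x
      rw [abs_of_pos (by norm_num : (0 : ℝ) < 1 / 2)]
      linarith [abs_nonneg (γ x * rootScore Θ f θ i x)])
    hθ (fun θ' hθ' => hf.affinity_le_of_isMHDE hK h (interior_subset hθ')) i
  simp only [hP i θ (interior_subset hθ), integral_const_mul] at this
  simp only [PiLp.zero_apply]
  linarith

/-- Minimum Hellinger distance estimates are close to the target when the root density estimate is
close to the true root density. -/
theorem exists_norm_sub_le_of_isMHDE (hK : KernelDesign κ c b) {g : ℝ → ℝ} (hg : IsDensity g)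
    {θg : E m} (ht : IsTarget Θ f g θg) {δ : ℝ} (hδ : 0 < δ) :
    ∃ ε₂ > 0, ∀ (n : ℕ) (D : Fin n → ℝ) (θ : E m),
      ∫ x, (√(kde κ c b D x) - √(g x)) ^ 2 ≤ ε₂ → IsMHDE Θ f κ c b D θ → ‖θ - θg‖ ≤ δ := by
  have hΘg := interior_subset ht.mem_interior
  have hgm : Measurable fun x => √(g x) := hg.measurable.sqrt
  have hgi := integrable_of_isDensity hg
  have hg2 : Integrable fun x => √(g x) ^ 2 := integrable_sq_sqrt hg.nonneg hgi
  obtain ⟨hΦi, hΦ⟩ := hf.continuousOn_integral_mul_rootDensity hgm hg2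
  set Φ : E m → ℝ := fun θ => ∫ x, √(g x) * √(f θ x) with hΦd
  have hlt : ∀ θ ∈ Θ, θ ≠ θg → Φ θ < Φ θg := fun θ hθ hne => by
    have := ht.unique_min θ hθ hne
    rw [hf.hdSq_density_eq hθ hg.nonneg hg.measurable hgi,
      hf.hdSq_density_eq hΘg hg.nonneg hg.measurable hgi] at this
    simp only [hΦd]
    linarith
  -- Outside the δ-ball the parameter set is compact and the affinity with g attains a maximum
  -- there, strictly below its value at θ_g by uniqueness of the minimizer.
  have hgap : ∃ ω > 0, ∀ θ ∈ Θ \ Metric.ball θg δ, Φ θ ≤ Φ θg - ω := by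
    have hc : IsCompact (Θ \ Metric.ball θg δ) := hf.isCompact.diff Metric.isOpen_ball
    rcases (Θ \ Metric.ball θg δ).eq_empty_or_nonempty with h | h
    · exact ⟨1, one_pos, by simp [h]⟩
    · obtain ⟨z, hz, hmax⟩ := hc.exists_isMaxOn h (hΦ.mono sdiff_subset)
      have hzne : z ≠ θg := fun e => hz.2 (by rw [e]; exact Metric.mem_ball_self hδ)
      exact ⟨Φ θg - Φ z, sub_pos.2 (hlt z hz.1 hzne), fun θ hθ => by
        have := hmax hθ
        simp only [mem_ofPred_eq] at this
        linarith⟩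
  obtain ⟨ω, hω, hgap⟩ := hgap
  -- By Cauchy–Schwarz and ∫ f_θ = 1, an L² error of at most ω/4 in the root density moves all
  -- affinities by at most ω/4, so two such errors cannot bridge the gap ω.
  refine ⟨(ω / 4) ^ 2, by positivity, fun n D θ hcl hθ => ?_⟩
  by_contra hne
  have hdist : θ ∈ Θ \ Metric.ball θg δ := ⟨hθ.1, fun h => hne (by
    rw [Metric.mem_ball, dist_eq_norm] at h; exact h.le)⟩
  have hkm : Measurable fun x => √(kde κ c b D x) := (measurable_kde hK D).sqrt
  have hk2 : Integrable fun x => √(kde κ c b D x) ^ 2 :=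
    integrable_sq_sqrt (kde_nonneg hK D) (integrable_kde hK D)
  have hΨi := (hf.continuousOn_integral_mul_rootDensity hkm hk2).1
  have hclose : ∀ θ ∈ Θ, |(∫ x, √(kde κ c b D x) * √(f θ x)) - Φ θ| ≤ ω / 4 := fun θ hθ => by
    rw [hΦd]
    dsimp only
    rw [← integral_sub (hΨi θ hθ) (hΦi θ hθ)]
    simp only [← sub_mul]
    refine (abs_integral_mul_le_sqrt (hkm.sub hgm).aestronglyMeasurable
      (hf.measurable_density hθ).sqrt.aestronglyMeasurable
      (integrable_sq_sub hkm hgm hk2 hg2) (hf.integrable_sq_rootDensity hθ)).trans ?_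
    simp only [Real.sq_sqrt (hf.pos θ hθ _).le, (hf.isDensity θ hθ).integral_eq_one, Real.sqrt_one,
      mul_one, Pi.sub_apply]
    exact Real.sqrt_le_iff.2 ⟨by positivity, hcl⟩
  have h1 := abs_le.1 (hclose θ hθ.1)
  have h2 := abs_le.1 (hclose θg hΘg)
  have h3 := hf.affinity_le_of_isMHDE hK hθ hΘg
  have h4 := hgap θ hdist
  linarith [h1.1, h1.2, h2.1, h2.2]

end RegularFamily

end PMHDE

/-! ### Sensitivity of the Hellinger score. -/

namespace PMHDE

theorem abs_sqrt_sub_sqrt_le {a b : ℝ} (ha : 0 ≤ a) (hb : 0 ≤ b) : |√a - √b| ≤ √|a - b| := by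
  refine Real.le_sqrt_of_sq_le ?_
  have h1 : |√a - √b| ≤ √a + √b := abs_le.2
    ⟨by linarith [Real.sqrt_nonneg a, Real.sqrt_nonneg b],
      by linarith [Real.sqrt_nonneg a, Real.sqrt_nonneg b]⟩
  calc |√a - √b| ^ 2 = |√a - √b| * |√a - √b| := sq _
    _ ≤ |√a - √b| * (√a + √b) := mul_le_mul_of_nonneg_left h1 (abs_nonneg _)
    _ = |(√a - √b) * (√a + √b)| := by
        rw [abs_mul, abs_of_nonneg (add_nonneg (Real.sqrt_nonneg a) (Real.sqrt_nonneg b))]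
    _ = |a - b| := by
        congr 1
        nlinarith [Real.mul_self_sqrt ha, Real.mul_self_sqrt hb]

theorem exists_eq_of_hammingDist_eq_one {n : ℕ} {D D' : Fin n → ℝ} (h : hammingDist D D' = 1) :
    ∃ j, ∀ i, i ≠ j → D i = D' i := by
  rw [hammingDist, Finset.card_eq_one] at h
  obtain ⟨j, hj⟩ := h
  refine ⟨j, fun i hi => ?_⟩
  by_contra hne
  have : i ∈ ({i | D i ≠ D' i} : Finset (Fin n)) := by simpa using hne
  rw [hj, Finset.mem_singleton] at this
  exact hi this

section Kernel

variable {κ : ℝ → ℝ} {c b : ℕ → ℝ}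

/-- Changing one observation changes the kernel density estimate by at most two kernels. -/
theorem abs_kde_sub_le (hK : KernelDesign κ c b) {n : ℕ} {D D' : Fin n → ℝ}
    (h : hammingDist D D' = 1) : ∃ y y' : ℝ, ∀ x, |kde κ c b D x - kde κ c b D' x|
      ≤ 1 / (n * c n) * (κ ((x - y) / c n) + κ ((x - y') / c n)) := by
  obtain ⟨j, hj⟩ := exists_eq_of_hammingDist_eq_one h
  refine ⟨D j, D' j, fun x => ?_⟩
  have hc := hK.c_pos n
  have h0 : ∀ y, 0 ≤ κ ((x - y) / c n) := fun y => hK.isDensity.nonneg _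
  rw [kde, kde, ← mul_sub, abs_mul, abs_of_nonneg (by positivity : 0 ≤ 1 / (n * c n)),
    ← Finset.sum_sub_distrib, Finset.sum_eq_single j (fun i _ hi => by rw [hj i hi, sub_self])
      (by simp)]
  refine mul_le_mul_of_nonneg_left ?_ (by positivity)
  have hI : ∀ y, 0 ≤ (Ioo (-b n) (b n)).indicator (fun y => κ ((x - y) / c n)) y ∧
      (Ioo (-b n) (b n)).indicator (fun y => κ ((x - y) / c n)) y ≤ κ ((x - y) / c n) := fun y =>
    ⟨indicator_nonneg (fun _ _ => h0 _) _, indicator_le_self' (fun _ _ => h0 _) _⟩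
  rw [abs_le]
  constructor <;> linarith [(hI (D j)).1, (hI (D j)).2, (hI (D' j)).1, (hI (D' j)).2]

/-- Where κ ≤ 1 the power is at most the indicator of the bounded support interval, and where κ ≥ 1
it is at most κ. -/
theorem integrable_kernel_rpow (hK : KernelDesign κ c b) {s : ℝ} (hs0 : 0 < s) (hs1 : s ≤ 1) :
    Integrable fun x => κ x ^ s := by
  obtain ⟨β, hβ, hsupp⟩ := hK.support
  have hi := integrable_of_isDensity hK.isDensity
  have h1 : Integrable ((Ioo (-β) β).indicator fun _ => (1 : ℝ)) :=
    (integrable_indicator_iff measurableSet_Ioo).2 (by simp)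
  refine (h1.add hi).mono' (hK.isDensity.measurable.pow_const s).aestronglyMeasurable
    (Eventually.of_forall fun x => ?_)
  have h0 := hK.isDensity.nonneg x
  rw [Real.norm_of_nonneg (Real.rpow_nonneg h0 _)]
  simp only [Pi.add_apply]
  by_cases hx : κ x = 0
  · rw [hx, Real.zero_rpow hs0.ne', add_zero]
    exact indicator_nonneg (fun _ _ => zero_le_one) _
  · rw [indicator_of_mem (hsupp hx)]
    rcases le_total (κ x) 1 with h | h
    · linarith [Real.rpow_le_one h0 h hs0.le]
    · have := Real.rpow_le_rpow_of_exponent_le h hs1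
      rw [Real.rpow_one] at this
      linarith

end Kernel

variable {m : ℕ} {Θ : Set (E m)} {f : E m → ℝ → ℝ} {p q : ℝ}

namespace RegularFamily

variable (hf : RegularFamily Θ f p q)
include hf

theorem holderConjugate : p.HolderConjugate q := by
  have hp := hf.one_lt_p
  have h := hf.conj
  rw [Real.holderConjugate_iff]
  exact ⟨hp, by simpa using h⟩

/-- Uniform `L^q` bound on `√f_θ u_{θ,i}`. -/
theorem exists_integral_rootScore_rpow_le : ∃ B, 0 ≤ B ∧ ∀ θ ∈ Θ, ∀ i,
    Integrable (fun x => |rootScore Θ f θ i x| ^ q) ∧ ∫ x, |rootScore Θ f θ i x| ^ q ≤ B := by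
  obtain ⟨B, hB⟩ := hf.isCompact.bddAbove_image hf.lq_score.2
  have hq := hf.holderConjugate.symm.pos
  refine ⟨max B 0, le_max_right _ _, fun θ hθ i => ?_⟩
  have hle : ∀ x, |rootScore Θ f θ i x| ^ q
      ≤ (∑ i, |score Θ f θ i x * f θ x ^ (1 / 2 - 1 / q)|) ^ q * f θ x := fun x => by
    have hp := hf.pos θ hθ x
    -- The exponents match because q (1/2 - 1/q) + 1 = q/2; one factor f_θ is the density of the
    -- expectation.
    have e : |rootScore Θ f θ i x| ^ q
        = |score Θ f θ i x * f θ x ^ (1 / 2 - 1 / q)| ^ q * f θ x := by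
      rw [rootScore, mul_comm, abs_mul, abs_mul, abs_of_nonneg (Real.sqrt_nonneg _),
        abs_of_pos (Real.rpow_pos_of_pos hp _), Real.mul_rpow (abs_nonneg _) (Real.sqrt_nonneg _),
        Real.mul_rpow (abs_nonneg _) (Real.rpow_nonneg hp.le _), Real.sqrt_eq_rpow,
        ← Real.rpow_mul hp.le, ← Real.rpow_mul hp.le, mul_assoc]
      congr 1
      nth_rw 3 [← Real.rpow_one (f θ x)]
      rw [← Real.rpow_add hp]
      congr 1
      field_simp
      ring
    rw [e]
    refine mul_le_mul_of_nonneg_right (Real.rpow_le_rpow (abs_nonneg _) ?_ hq.le) hp.le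
    exact Finset.single_le_sum (f := fun i => |score Θ f θ i x * f θ x ^ (1 / 2 - 1 / q)|)
      (fun _ _ => abs_nonneg _) (Finset.mem_univ i)
  have hi : Integrable fun x => |rootScore Θ f θ i x| ^ q :=
    (hf.lq_score.1 θ hθ).mono'
      ((hf.measurable_rootScore hθ i).abs.pow_const q).aestronglyMeasurable
      (Eventually.of_forall fun x => by
        rw [Real.norm_of_nonneg (Real.rpow_nonneg (abs_nonneg _) _)]; exact hle x)
  exact ⟨hi, ((integral_mono hi (hf.lq_score.1 θ hθ) hle).trans
    (hB (mem_image_of_mem _ hθ))).trans (le_max_left _ _)⟩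

/-- The sensitivity of the Hellinger score in terms of the sample size and the bandwidth. -/
theorem exists_abs_gradLoss_sub_le {κ : ℝ → ℝ} {c b : ℕ → ℝ} (hK : KernelDesign κ c b) :
    ∃ C, 0 ≤ C ∧ ∀ n : ℕ, 1 ≤ n → ∀ D D' : Fin n → ℝ, hammingDist D D' = 1 → ∀ θ ∈ Θ, ∀ i,
      |gradLoss Θ f κ c b D θ i - gradLoss Θ f κ c b D' θ i|
        ≤ C * ((n : ℝ) ^ (-(1 / 2) : ℝ) * c n ^ (1 / p - 1 / 2)) := by
  obtain ⟨B, hB0, hB⟩ := hf.exists_integral_rootScore_rpow_le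
  have hpq := hf.holderConjugate
  have hp0 := hpq.pos
  have hp2 := hf.p_lt_two
  have hs0 : 0 < p / 2 := by positivity
  have hs1 : p / 2 ≤ 1 := by linarith
  set J := ∫ x, κ x ^ (p / 2) with hJ
  have hJ0 : 0 ≤ J := integral_nonneg fun x => Real.rpow_nonneg (hK.isDensity.nonneg _) _
  have hJi := integrable_kernel_rpow hK hs0 hs1
  -- The leading 2 is that of the Hellinger score. The other factors come from Hölder's inequality:
  -- 2J from the L^p norm of the root of two kernels, and B from the uniform L^q bound on √f_θ u_θ.
  refine ⟨2 * ((2 * J) ^ (1 / p) * B ^ (1 / q)), by positivity,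
    fun n hn D D' hDD' θ hθ i => ?_⟩
  have hc := hK.c_pos n
  have hn0 : (0 : ℝ) < n := by exact_mod_cast hn
  obtain ⟨y, y', hy⟩ := abs_kde_sub_le hK hDD'
  have hκ0 := hK.isDensity.nonneg
  set h : ℝ → ℝ := fun x => 1 / (n * c n) * (κ ((x - y) / c n) + κ ((x - y') / c n)) with hh
  have hh0 : ∀ x, 0 ≤ h x := fun x =>
    mul_nonneg (by positivity) (add_nonneg (hκ0 _) (hκ0 _))
  have hκm : ∀ y, Measurable fun x => κ ((x - y) / c n) := fun y =>
    hK.isDensity.measurable.comp (by fun_prop)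
  have hhm : Measurable h := ((hκm y).add (hκm y')).const_mul _
  have hJy : ∀ y, Integrable fun x => κ ((x - y) / c n) ^ (p / 2) := fun y =>
    integrable_kernel_comp hJi hc y
  have hJye : ∀ y, ∫ x, κ ((x - y) / c n) ^ (p / 2) = c n * J := fun y =>
    integral_kernel_comp (fun x => κ x ^ (p / 2)) hc y
  -- The power p/2 is subadditive because p ≤ 2, which separates the two kernels. After rescaling,
  -- each integral contributes a factor c_n, so the p-th root gives n^{-1/2} c_n^{1/p - 1/2}.
  have hrle : ∀ x, √(h x) ^ p ≤ (n * c n) ^ (-(p / 2)) *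
      (κ ((x - y) / c n) ^ (p / 2) + κ ((x - y') / c n) ^ (p / 2)) := fun x => by
    rw [Real.sqrt_eq_rpow, ← Real.rpow_mul (hh0 x), hh]
    dsimp only
    rw [Real.mul_rpow (by positivity) (add_nonneg (hκ0 _) (hκ0 _)), one_div,
      show 1 / 2 * p = p / 2 by ring, Real.inv_rpow (by positivity), ← Real.rpow_neg (by positivity)]
    refine mul_le_mul_of_nonneg_left ?_ (by positivity)
    exact Real.rpow_add_le_add_rpow (hκ0 _) (hκ0 _) hs0.le hs1
  have hri : Integrable fun x => √(h x) ^ p :=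
    (((hJy y).add (hJy y')).const_mul ((n * c n) ^ (-(p / 2)))).mono'
      (hhm.sqrt.pow_const p).aestronglyMeasurable (Eventually.of_forall fun x => by
        rw [Real.norm_of_nonneg (Real.rpow_nonneg (Real.sqrt_nonneg _) _)]; exact hrle x)
  have hrint : ∫ x, √(h x) ^ p ≤ (n * c n) ^ (-(p / 2)) * (c n * (2 * J)) := by
    refine (integral_mono hri (((hJy y).add (hJy y')).const_mul _) hrle).trans (le_of_eq ?_)
    rw [integral_const_mul, integral_add' (hJy y) (hJy y'), hJye, hJye]
    ring
  obtain ⟨hwi, hwB⟩ := hB θ hθ i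
  have hwm := hf.measurable_rootScore hθ i
  have hmem1 : MemLp (fun x => √(h x)) (ENNReal.ofReal p) := by
    rw [← integrable_norm_rpow_iff hhm.sqrt.aestronglyMeasurable (by simpa using hp0)
      ENNReal.ofReal_ne_top, ENNReal.toReal_ofReal hp0.le]
    simpa only [Real.norm_of_nonneg (Real.sqrt_nonneg _)] using hri
  have hmem2 : MemLp (rootScore Θ f θ i) (ENNReal.ofReal q) := by
    rw [← integrable_norm_rpow_iff hwm.aestronglyMeasurable (by simpa using hpq.symm.pos)
      ENNReal.ofReal_ne_top, ENNReal.toReal_ofReal hpq.symm.pos.le]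
    simpa only [Real.norm_eq_abs] using hwi
  have hholder := integral_mul_norm_le_Lp_mul_Lq hpq hmem1 hmem2
  simp only [Real.norm_eq_abs, abs_of_nonneg (Real.sqrt_nonneg _)] at hholder
  have hγ : ∀ D : Fin n → ℝ, Integrable fun x => √(kde κ c b D x) * rootScore Θ f θ i x :=
    fun D => (hf.continuousOn_integral_mul_rootScore (measurable_kde hK D).sqrt
      (integrable_sq_sqrt (kde_nonneg hK D) (integrable_kde hK D)) i).1 θ hθ
  have hmul : Integrable fun x => √(h x) * |rootScore Θ f θ i x| := by
    have := hpq.ennrealOfReal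
    exact hmem1.integrable_mul hmem2.abs
  have hmain : |gradLoss Θ f κ c b D θ i - gradLoss Θ f κ c b D' θ i|
      ≤ 2 * ∫ x, √(h x) * |rootScore Θ f θ i x| := by
    rw [gradLoss_apply, gradLoss_apply, weightedScore, weightedScore, ← mul_sub,
      ← integral_sub (hγ D) (hγ D'), abs_mul, abs_neg, abs_two]
    refine mul_le_mul_of_nonneg_left ?_ zero_le_two
    refine abs_integral_le_integral_abs.trans (integral_mono ((hγ D).sub (hγ D')).abs hmul ?_)
    intro x
    dsimp only
    rw [← sub_mul, abs_mul]
    refine mul_le_mul_of_nonneg_right ?_ (abs_nonneg _)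
    exact (abs_sqrt_sub_sqrt_le (kde_nonneg hK D x) (kde_nonneg hK D' x)).trans
      (Real.sqrt_le_sqrt (hy x))
  refine hmain.trans ?_
  rw [mul_assoc]
  refine mul_le_mul_of_nonneg_left (hholder.trans ?_) zero_le_two
  have h1 : (∫ x, √(h x) ^ p) ^ (1 / p)
      ≤ (2 * J) ^ (1 / p) * ((n : ℝ) ^ (-(1 / 2) : ℝ) * c n ^ (1 / p - 1 / 2)) := by
    refine (Real.rpow_le_rpow (integral_nonneg fun x => Real.rpow_nonneg (Real.sqrt_nonneg _) _)
      hrint (by positivity)).trans (le_of_eq ?_)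
    rw [Real.mul_rpow (by positivity) (by positivity), Real.mul_rpow hc.le (by positivity),
      ← Real.rpow_mul (by positivity), Real.mul_rpow hn0.le hc.le,
      show -(p / 2) * (1 / p) = -(1 / 2) by field_simp]
    rw [sub_eq_add_neg (1 / p), Real.rpow_add hc]
    ring
  calc _ ≤ ((2 * J) ^ (1 / p) * ((n : ℝ) ^ (-(1 / 2) : ℝ) * c n ^ (1 / p - 1 / 2))) *
        B ^ (1 / q) := by
        refine mul_le_mul h1 ?_ (Real.rpow_nonneg (integral_nonneg fun x =>
          Real.rpow_nonneg (abs_nonneg _) _) _) (by positivity)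
        exact Real.rpow_le_rpow (integral_nonneg fun x => Real.rpow_nonneg (abs_nonneg _) _) hwB
          (by have := hpq.symm.pos; positivity)
    _ = _ := by ring

/-- The sensitivity is of order `n^{-1/p'}` for an explicit exponent `p' ∈ (1, 2)`. -/
theorem exists_sensitivity_le : ∃ p' : ℝ, 1 < p' ∧ p' < 2 ∧ ∀ (κ : ℝ → ℝ) (c b : ℕ → ℝ),
    KernelDesign κ c b → ∃ A : ℝ, 0 < A ∧ ∀ n : ℕ, 1 ≤ n →
      sensitivity Θ f κ c b n ≤ ENNReal.ofReal (A * (n : ℝ) ^ (-(1 / p'))) := by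
  have hp1 := hf.one_lt_p
  have hp2 := hf.p_lt_two
  set α : ℝ := 1 / p - 1 / 2 with hα
  have hα0 : 0 < α := by
    rw [hα, sub_pos]
    exact one_div_lt_one_div_of_lt (by linarith) hp2
  have hα1 : α < 1 / 2 := by
    have : 1 / p < 1 := by rw [div_lt_one (by linarith)]; exact hp1
    rw [hα]; linarith
  -- Boundedness of n^{1/2} c_n² gives c_n^α of order n^{-α/4}, so the total rate is n^{-(1/2 +
  -- α/4)}. From 0 < α < 1/2 its reciprocal exponent lies in (1, 2).
  refine ⟨1 / (1 / 2 + α / 4), ?_, ?_, fun κ c b hK => ?_⟩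
  · rw [lt_div_iff₀ (by positivity)]; linarith
  · rw [div_lt_iff₀ (by positivity)]; linarith
  obtain ⟨C, hC0, hC⟩ := hf.exists_abs_gradLoss_sub_le hK
  obtain ⟨T, hT⟩ := hK.c_sq.bddAbove_range
  have hT' : ∀ n : ℕ, √n * c n ^ 2 ≤ max T 0 := fun n => (hT ⟨n, rfl⟩).trans (le_max_left _ _)
  set T' := max T 0
  have hT0 : 0 ≤ T' := le_max_right _ _
  refine ⟨m * (C * T' ^ (α / 2)) + 1, by positivity, fun n hn => ?_⟩
  have hn0 : (0 : ℝ) < n := by exact_mod_cast hn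
  have hc := hK.c_pos n
  have hcα : c n ^ α ≤ T' ^ (α / 2) * (n : ℝ) ^ (-(α / 4)) := by
    have h1 : (c n ^ 2) ^ (α / 2) = c n ^ α := by
      rw [← Real.rpow_natCast, ← Real.rpow_mul hc.le]
      congr 1
      push_cast
      ring
    have h2 : c n ^ 2 ≤ T' * (n : ℝ) ^ (-(1 / 2) : ℝ) := by
      rw [Real.rpow_neg hn0.le, ← Real.sqrt_eq_rpow, ← div_eq_mul_inv,
        le_div_iff₀ (Real.sqrt_pos.2 hn0), mul_comm]
      exact hT' n
    rw [← h1]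
    refine (Real.rpow_le_rpow (by positivity) h2 (by positivity)).trans (le_of_eq ?_)
    rw [Real.mul_rpow hT0 (by positivity), ← Real.rpow_mul hn0.le]
    congr 2
    ring
  refine iSup_le fun D => iSup_le fun D' => iSup_le fun hDD' => iSup_le fun θ => iSup_le fun hθ => ?_
  rw [edist_dist, dist_eq_norm]
  refine ENNReal.ofReal_le_ofReal ((norm_le_sum_abs _).trans ?_)
  have hexp : (n : ℝ) ^ (-(1 / 2) : ℝ) * (n : ℝ) ^ (-(α / 4))
      = (n : ℝ) ^ (-(1 / (1 / (1 / 2 + α / 4)))) := by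
    rw [← Real.rpow_add hn0]
    congr 1
    rw [one_div_one_div]
    ring
  rw [← hexp]
  have hi : ∀ i, |(gradLoss Θ f κ c b D θ - gradLoss Θ f κ c b D' θ) i|
      ≤ C * T' ^ (α / 2) * ((n : ℝ) ^ (-(1 / 2) : ℝ) * (n : ℝ) ^ (-(α / 4))) := fun i => by
    refine (hC n hn D D' hDD' θ hθ i).trans ?_
    rw [mul_assoc]
    refine mul_le_mul_of_nonneg_left ?_ hC0
    calc _ ≤ (n : ℝ) ^ (-(1 / 2) : ℝ) * (T' ^ (α / 2) * (n : ℝ) ^ (-(α / 4))) :=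
          mul_le_mul_of_nonneg_left hcα (by positivity)
      _ = _ := by ring
  refine (Finset.sum_le_sum fun i _ => hi i).trans ?_
  rw [Finset.sum_const, Finset.card_univ, Fintype.card_fin, nsmul_eq_mul, add_mul, ← mul_assoc]
  have : 0 ≤ 1 * ((n : ℝ) ^ (-(1 / 2) : ℝ) * (n : ℝ) ^ (-(α / 4))) := by positivity
  linarith

end RegularFamily

end PMHDE

/-! ### Gaussian steps, multiplication of affinities, and privacy. -/

namespace PMHDE

variable {m : ℕ}

section GaussianDensity

/-- Density of the centred Gaussian law on `ℝ^m` with covariance `s² I`. -/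
noncomputable def gaussianDensity (m : ℕ) (s : ℝ) (x : E m) : ℝ :=
  ((2 * Real.pi * s ^ 2) ^ (m / 2 : ℝ))⁻¹ * Real.exp (-(1 / (2 * s ^ 2)) * ‖x‖ ^ 2)

theorem gaussianDensity_nonneg (s : ℝ) (x : E m) : 0 ≤ gaussianDensity m s x := by
  unfold gaussianDensity; positivity

theorem continuous_gaussianDensity (s : ℝ) : Continuous (gaussianDensity m s) := by
  unfold gaussianDensity; fun_prop

theorem measurable_gaussianDensity (s : ℝ) : Measurable (gaussianDensity m s) :=
  (continuous_gaussianDensity s).measurable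

theorem integral_exp_neg_mul_sq_norm {b : ℝ} (hb : 0 < b) :
    ∫ x : E m, Real.exp (-b * ‖x‖ ^ 2) = (Real.pi / b) ^ (m / 2 : ℝ) := by
  simpa using GaussianFourier.integral_rexp_neg_mul_sq_norm (V := E m) hb

theorem integrable_exp_neg_mul_sq_norm {b : ℝ} (hb : 0 < b) :
    Integrable fun x : E m => Real.exp (-b * ‖x‖ ^ 2) := by
  refine Integrable.of_integral_ne_zero ?_
  rw [integral_exp_neg_mul_sq_norm hb]
  positivity

theorem integrable_gaussianDensity {s : ℝ} (hs : s ≠ 0) : Integrable (gaussianDensity m s) :=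
  (integrable_exp_neg_mul_sq_norm (b := 1 / (2 * s ^ 2)) (by positivity)).const_mul _

theorem integral_gaussianDensity {s : ℝ} (hs : s ≠ 0) : ∫ x, gaussianDensity m s x = 1 := by
  unfold gaussianDensity
  rw [integral_const_mul, integral_exp_neg_mul_sq_norm (by positivity),
    show Real.pi / (1 / (2 * s ^ 2)) = 2 * Real.pi * s ^ 2 by field_simp]
  exact inv_mul_cancel₀ (by positivity)

theorem lintegral_gaussianDensity_sub {s : ℝ} (hs : s ≠ 0) (μ : E m) :
    ∫⁻ x, ENNReal.ofReal (gaussianDensity m s (x - μ)) = 1 := by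
  rw [lintegral_sub_right_eq_self (fun x => ENNReal.ofReal (gaussianDensity m s x)) μ,
    ← ofReal_integral_eq_lintegral_ofReal (integrable_gaussianDensity hs)
    (Eventually.of_forall (gaussianDensity_nonneg s)), integral_gaussianDensity hs,
    ENNReal.ofReal_one]

/-- Both sides are probability measures, so it suffices to compare characteristic functions; the one
of the density is a Gaussian Fourier integral. -/
theorem map_smul_stdGaussian {s : ℝ} (hs : s ≠ 0) :
    (stdGaussian (E m)).map (fun z => s • z)
      = volume.withDensity fun x => ENNReal.ofReal (gaussianDensity m s x) := by
  have h1 : IsProbabilityMeasure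
      (volume.withDensity fun x : E m => ENNReal.ofReal (gaussianDensity m s x)) :=
    ⟨by simpa using lintegral_gaussianDensity_sub (m := m) hs 0⟩
  have h2 : IsProbabilityMeasure ((stdGaussian (E m)).map (fun z => s • z)) :=
    Measure.isProbabilityMeasure_map (by fun_prop)
  refine Measure.ext_of_charFun (funext fun t => ?_)
  rw [charFun_map_smul, charFun_stdGaussian, charFun_apply,
    integral_withDensity_eq_integral_toReal_smul
      (measurable_gaussianDensity s).ennreal_ofReal (by simp)]
  simp only [ENNReal.toReal_ofReal (gaussianDensity_nonneg s _)]
  have hb : 0 < ((1 / (2 * s ^ 2) : ℝ) : ℂ).re := by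
    rw [Complex.ofReal_re]; positivity
  have key := GaussianFourier.integral_cexp_neg_mul_sq_norm_add (V := E m) hb Complex.I t
  have e : ∀ x : E m, gaussianDensity m s x • Complex.exp (((inner ℝ x t : ℝ) : ℂ) * Complex.I)
      = (((2 * Real.pi * s ^ 2) ^ (m / 2 : ℝ))⁻¹ : ℝ) •
        Complex.exp (-((1 / (2 * s ^ 2) : ℝ) : ℂ) * (‖x‖ : ℂ) ^ 2
          + Complex.I * ((inner ℝ t x : ℝ) : ℂ)) := fun x => by
    rw [gaussianDensity, mul_smul, Complex.exp_add, real_inner_comm, mul_comm Complex.I]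
    congr 1
    rw [Complex.real_smul, Complex.ofReal_exp]
    push_cast
    rfl
  simp only [e]
  rw [integral_smul, key, Complex.real_smul]
  have hpow : ((Real.pi : ℂ) / ((1 / (2 * s ^ 2) : ℝ) : ℂ)) ^ ((Module.finrank ℝ (E m) : ℂ) / 2)
      = (((2 * Real.pi * s ^ 2) ^ (m / 2 : ℝ) : ℝ) : ℂ) := by
    rw [← Complex.ofReal_div, show Real.pi / (1 / (2 * s ^ 2)) = 2 * Real.pi * s ^ 2 by field_simp,
      Complex.ofReal_cpow (by positivity)]
    simp
  rw [hpow, ← mul_assoc, ← Complex.ofReal_mul, inv_mul_cancel₀ (by positivity), Complex.ofReal_one,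
    one_mul, Complex.I_sq, norm_smul]
  congr 1
  push_cast
  have : (s : ℂ) ≠ 0 := by exact_mod_cast hs
  rw [mul_pow, ← Complex.ofReal_pow, Real.norm_eq_abs, sq_abs]
  push_cast
  field_simp
  ring

theorem lintegral_stdGaussian_comp {s : ℝ} (hs : s ≠ 0) (μ : E m) {F : E m → ℝ≥0∞}
    (hF : Measurable F) : ∫⁻ z, F (μ + s • z) ∂(stdGaussian (E m))
      = ∫⁻ y, ENNReal.ofReal (gaussianDensity m s (y - μ)) * F y := by
  have h1 : ∫⁻ z, F (μ + s • z) ∂(stdGaussian (E m))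
      = ∫⁻ y, F (μ + y) ∂((stdGaussian (E m)).map (fun z => s • z)) :=
    (lintegral_map (hF.comp (measurable_const_add μ)) (by fun_prop)).symm
  have hFμ : Measurable fun y => F (μ + y) := hF.comp (measurable_const_add μ)
  rw [h1, map_smul_stdGaussian hs, lintegral_withDensity_eq_lintegral_mul _
    (measurable_gaussianDensity s).ennreal_ofReal hFμ, ← lintegral_sub_right_eq_self _ μ]
  simp

/-- Overlap of two Gaussian densities. -/
theorem sqrt_mul_gaussianDensity (s : ℝ) (a b y : E m) :
    √(gaussianDensity m s (y - a)) * √(gaussianDensity m s (y - b))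
      = Real.exp (-(‖a - b‖ ^ 2 / (8 * s ^ 2))) *
        gaussianDensity m s (y - (1 / 2 : ℝ) • (a + b)) := by
  rcases eq_or_ne s 0 with rfl | hs
  · rcases Nat.eq_zero_or_pos m with rfl | hm
    · simp [gaussianDensity]
    · have : (m / 2 : ℝ) ≠ 0 := by positivity
      simp [gaussianDensity, Real.zero_rpow this]
  rw [← Real.sqrt_mul (gaussianDensity_nonneg _ _)]
  refine (Real.sqrt_eq_iff_mul_self_eq (mul_nonneg (gaussianDensity_nonneg _ _)
    (gaussianDensity_nonneg _ _)) (mul_nonneg (Real.exp_pos _).le (gaussianDensity_nonneg _ _))).2 ?_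
  -- The parallelogram law recentres the sum of the two exponents at the midpoint of the means; the
  -- remainder, free of y, is the overlap factor.
  have hpar : ‖y - a‖ ^ 2 + ‖y - b‖ ^ 2
      = 2 * ‖y - (1 / 2 : ℝ) • (a + b)‖ ^ 2 + 1 / 2 * ‖a - b‖ ^ 2 := by
    have h := parallelogram_law_with_norm ℝ (y - a) (y - b)
    have e1 : y - a + (y - b) = (2 : ℝ) • (y - (1 / 2 : ℝ) • (a + b)) := by
      module
    have e2 : y - a - (y - b) = -(a - b) := by abel
    rw [e1, e2, norm_smul, norm_neg, Real.norm_two] at h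
    nlinarith
  unfold gaussianDensity
  set C := ((2 * Real.pi * s ^ 2) ^ (m / 2 : ℝ))⁻¹
  have hexp : Real.exp (-(1 / (2 * s ^ 2)) * ‖y - a‖ ^ 2)
        * Real.exp (-(1 / (2 * s ^ 2)) * ‖y - b‖ ^ 2)
      = (Real.exp (-(‖a - b‖ ^ 2 / (8 * s ^ 2)))
        * Real.exp (-(1 / (2 * s ^ 2)) * ‖y - (1 / 2 : ℝ) • (a + b)‖ ^ 2)) *
        (Real.exp (-(‖a - b‖ ^ 2 / (8 * s ^ 2)))
        * Real.exp (-(1 / (2 * s ^ 2)) * ‖y - (1 / 2 : ℝ) • (a + b)‖ ^ 2)) := by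
    simp only [← Real.exp_add]
    congr 1
    have : -(1 / (2 * s ^ 2)) * ‖y - a‖ ^ 2 + -(1 / (2 * s ^ 2)) * ‖y - b‖ ^ 2
      = -(1 / (2 * s ^ 2)) * (‖y - a‖ ^ 2 + ‖y - b‖ ^ 2) := by ring
    rw [this, hpar]
    field_simp
    ring
  linear_combination C ^ 2 * hexp

end GaussianDensity

section Affinity

variable {α : Type*} [MeasurableSpace α]

/-- The Hellinger affinity of `P` and `Q` is at least `a`. -/
def AffinityGE (P Q : Measure α) (a : ℝ) : Prop :=
  ∃ (ν : Measure α) (p q : α → ℝ≥0∞), SigmaFinite ν ∧ Measurable p ∧ Measurable q ∧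
    P = ν.withDensity p ∧ Q = ν.withDensity q ∧
    ENNReal.ofReal a ≤ ∫⁻ x, p x ^ (1 / 2 : ℝ) * q x ^ (1 / 2 : ℝ) ∂ν

theorem hellingerDiv_self (P : Measure α) : hellingerDiv P P = 0 := by
  simp [hellingerDiv]

/-- Expanding (√p - √q)² against a common dominating measure, the two densities contribute total
mass 2 and the cross term is twice the affinity. -/
theorem AffinityGE.hellingerDiv_le {P Q : Measure α} [IsProbabilityMeasure P]
    [IsProbabilityMeasure Q] {a : ℝ} (h : AffinityGE P Q a) : hellingerDiv P Q ≤ 2 - 2 * a := by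
  obtain ⟨ν, p, q, hν, hp, hq, rfl, rfl, ha⟩ := h
  have hp1 : ∫⁻ x, p x ∂ν = 1 := by
    rw [← setLIntegral_univ, ← withDensity_apply _ MeasurableSet.univ]; exact measure_univ
  have hq1 : ∫⁻ x, q x ∂ν = 1 := by
    rw [← setLIntegral_univ, ← withDensity_apply _ MeasurableSet.univ]; exact measure_univ
  rw [hellingerDiv_eq _ _ ν (withDensity_absolutelyContinuous _ _)
    (withDensity_absolutelyContinuous _ _)]
  have hpi : Integrable (fun x => (p x).toReal) ν :=
    integrable_toReal_of_lintegral_ne_top hp.aemeasurable (by simp [hp1])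
  have hqi : Integrable (fun x => (q x).toReal) ν :=
    integrable_toReal_of_lintegral_ne_top hq.aemeasurable (by simp [hq1])
  have hpI : ∫ x, (p x).toReal ∂ν = 1 := by
    rw [integral_toReal hp.aemeasurable (ae_lt_top hp (by simp [hp1])), hp1, ENNReal.toReal_one]
  have hqI : ∫ x, (q x).toReal ∂ν = 1 := by
    rw [integral_toReal hq.aemeasurable (ae_lt_top hq (by simp [hq1])), hq1, ENNReal.toReal_one]
  have hm : Integrable (fun x => √(p x).toReal * √(q x).toReal) ν := by
    refine (hpi.add hqi).mono' (hp.ennreal_toReal.sqrt.mul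
      hq.ennreal_toReal.sqrt).aestronglyMeasurable (Eventually.of_forall fun x => ?_)
    rw [Real.norm_of_nonneg (by positivity)]
    simp only [Pi.add_apply]
    nlinarith [sq_nonneg (√(p x).toReal - √(q x).toReal),
      Real.sq_sqrt (ENNReal.toReal_nonneg (a := p x)),
      Real.sq_sqrt (ENNReal.toReal_nonneg (a := q x)),
      ENNReal.toReal_nonneg (a := p x), ENNReal.toReal_nonneg (a := q x)]
  have hma : a ≤ ∫ x, √(p x).toReal * √(q x).toReal ∂ν := by
    have e : ENNReal.ofReal (∫ x, √(p x).toReal * √(q x).toReal ∂ν)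
        = ∫⁻ x, p x ^ (1 / 2 : ℝ) * q x ^ (1 / 2 : ℝ) ∂ν := by
      rw [ofReal_integral_eq_lintegral_ofReal hm (Eventually.of_forall fun x => by positivity)]
      refine lintegral_congr_ae ?_
      filter_upwards [ae_lt_top hp (by simp [hp1]), ae_lt_top hq (by simp [hq1])] with x h1 h2
      rw [ENNReal.ofReal_mul (by positivity), Real.sqrt_eq_rpow, Real.sqrt_eq_rpow,
        ← ENNReal.ofReal_rpow_of_nonneg ENNReal.toReal_nonneg (by norm_num),
        ← ENNReal.ofReal_rpow_of_nonneg ENNReal.toReal_nonneg (by norm_num),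
        ENNReal.ofReal_toReal h1.ne, ENNReal.ofReal_toReal h2.ne]
    rw [← e] at ha
    exact (ENNReal.ofReal_le_ofReal_iff
      (integral_nonneg fun x => by positivity)).1 ha
  have hadd : Integrable (fun x => (p x).toReal + (q x).toReal) ν := hpi.add hqi
  have e : ∫ x, (√((ν.withDensity p).rnDeriv ν x).toReal
      - √((ν.withDensity q).rnDeriv ν x).toReal) ^ 2 ∂ν
      = 2 - 2 * ∫ x, √(p x).toReal * √(q x).toReal ∂ν := by
    have : (2 : ℝ) - 2 * ∫ x, √(p x).toReal * √(q x).toReal ∂ν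
        = ∫ x, (p x).toReal + (q x).toReal - 2 * (√(p x).toReal * √(q x).toReal) ∂ν := by
      rw [integral_sub hadd (hm.const_mul 2), integral_add hpi hqi, hpI, hqI, integral_const_mul]
      norm_num
    rw [this]
    refine integral_congr_ae ?_
    filter_upwards [Measure.rnDeriv_withDensity ν hp, Measure.rnDeriv_withDensity ν hq]
      with x h1 h2
    rw [h1, h2, sub_sq, Real.sq_sqrt ENNReal.toReal_nonneg, Real.sq_sqrt ENNReal.toReal_nonneg]
    ring
  rw [e]
  linarith

/-- Starts the induction: both runs begin at the same deterministic point. Its law has no Lebesgue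
density when m > 0, which is why `AffinityGE` allows an arbitrary reference measure. -/
theorem affinityGE_dirac (x : α) : AffinityGE (Measure.dirac x) (Measure.dirac x) 1 :=
  ⟨Measure.dirac x, 1, 1, inferInstance, measurable_one, measurable_one, by simp, by simp, by simp⟩

/-- One step `θ ↦ T θ + s Z` of a Gaussian Markov chain, applied to a law. -/
noncomputable def gaussianStep (s : ℝ) (T : E m → E m) (P : Measure (E m)) : Measure (E m) :=
  (P.prod (stdGaussian (E m))).map fun w => T w.1 + s • w.2

/-- The output is a Gaussian mixture, so it has a Lebesgue density whatever the reference measure of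
the input was. -/
theorem gaussianStep_withDensity {s : ℝ} (hs : s ≠ 0) {T : E m → E m} (hT : Measurable T)
    (ν : Measure (E m)) [SigmaFinite ν] {p : E m → ℝ≥0∞} (hp : Measurable p) :
    gaussianStep s T (ν.withDensity p) = volume.withDensity fun y =>
      ∫⁻ θ, p θ * ENNReal.ofReal (gaussianDensity m s (y - T θ)) ∂ν := by
  have hk : Measurable fun w : E m × E m =>
      p w.2 * ENNReal.ofReal (gaussianDensity m s (w.1 - T w.2)) :=
    (hp.comp measurable_snd).mul ((measurable_gaussianDensity s).comp
      (measurable_fst.sub (hT.comp measurable_snd))).ennreal_ofReal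
  have hstep : Measurable fun w : E m × E m => T w.1 + s • w.2 :=
    (hT.comp measurable_fst).add (measurable_snd.const_smul s)
  ext A hA
  have hAm : Measurable (A.indicator (1 : E m → ℝ≥0∞)) := measurable_one.indicator hA
  have hAs : Measurable fun w : E m × E m => A.indicator (1 : E m → ℝ≥0∞) (T w.1 + s • w.2) :=
    hAm.comp hstep
  rw [gaussianStep, ← lintegral_indicator_one hA, lintegral_map hAm hstep,
    lintegral_prod _ hAs.aemeasurable, withDensity_apply _ hA,
    ← lintegral_indicator hA]
  simp only [lintegral_stdGaussian_comp hs _ hAm]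
  have hin : Measurable fun θ => ∫⁻ y, ENNReal.ofReal (gaussianDensity m s (y - T θ))
      * A.indicator 1 y := by
    refine Measurable.lintegral_prod_right' (f := fun w : E m × E m =>
      ENNReal.ofReal (gaussianDensity m s (w.2 - T w.1)) * A.indicator 1 w.2) ?_
    exact ((measurable_gaussianDensity s).comp
      (measurable_snd.sub (hT.comp measurable_fst))).ennreal_ofReal.mul (hAm.comp measurable_snd)
  rw [lintegral_withDensity_eq_lintegral_mul _ hp hin]
  simp only [Pi.mul_apply]
  have hg : ∀ θ, Measurable fun y => ENNReal.ofReal (gaussianDensity m s (y - T θ))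
      * A.indicator 1 y := fun θ =>
    ((measurable_gaussianDensity s).comp (measurable_id.sub_const _)).ennreal_ofReal.mul hAm
  have hpull : ∀ θ, p θ * ∫⁻ y, ENNReal.ofReal (gaussianDensity m s (y - T θ)) * A.indicator 1 y
      = ∫⁻ y, p θ * (ENNReal.ofReal (gaussianDensity m s (y - T θ)) * A.indicator 1 y) := fun θ =>
    (lintegral_const_mul (p θ) (hg θ)).symm
  simp only [hpull]
  rw [lintegral_lintegral_swap]
  · refine lintegral_congr fun y => ?_
    by_cases hy : y ∈ A <;> simp [hy]
  · refine Measurable.aemeasurable ?_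
    exact (hp.comp measurable_fst).mul (((measurable_gaussianDensity s).comp
      (measurable_snd.sub (hT.comp measurable_fst))).ennreal_ofReal.mul (hAm.comp measurable_snd))

theorem ofReal_rpow_half_mul {a b : ℝ} (ha : 0 ≤ a) (hb : 0 ≤ b) :
    ENNReal.ofReal a ^ (1 / 2 : ℝ) * ENNReal.ofReal b ^ (1 / 2 : ℝ)
      = ENNReal.ofReal (√a * √b) := by
  rw [ENNReal.ofReal_mul (Real.sqrt_nonneg _), Real.sqrt_eq_rpow, Real.sqrt_eq_rpow,
    ENNReal.ofReal_rpow_of_nonneg ha (by norm_num), ENNReal.ofReal_rpow_of_nonneg hb (by norm_num)]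

/-- Affinities multiply along Gaussian steps. -/
theorem AffinityGE.gaussianStep {P Q : Measure (E m)} {a : ℝ} (h : AffinityGE P Q a)
    {s d : ℝ} (hs : s ≠ 0) {T T' : E m → E m} (hT : Measurable T) (hT' : Measurable T')
    (hd : ∀ θ, ‖T θ - T' θ‖ ≤ d) :
    AffinityGE (gaussianStep s T P) (gaussianStep s T' Q)
      (Real.exp (-(d ^ 2 / (8 * s ^ 2))) * a) := by
  obtain ⟨ν, p, q, hν, hp, hq, rfl, rfl, ha⟩ := h
  have hk : ∀ {T : E m → E m}, Measurable T → Measurable fun w : E m × E m =>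
      ENNReal.ofReal (gaussianDensity m s (w.1 - T w.2)) := fun {T} hT =>
    ((measurable_gaussianDensity s).comp
      (measurable_fst.sub (hT.comp measurable_snd))).ennreal_ofReal
  have hk' : ∀ {p : E m → ℝ≥0∞} {T : E m → E m}, Measurable p → Measurable T →
      Measurable fun w : E m × E m =>
      p w.2 * ENNReal.ofReal (gaussianDensity m s (w.1 - T w.2)) := fun {p T} hp hT =>
    (hp.comp measurable_snd).mul (hk hT)
  refine ⟨volume, _, _, inferInstance, (hk' hp hT).lintegral_prod_right',
    (hk' hq hT').lintegral_prod_right', gaussianStep_withDensity hs hT ν hp,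
    gaussianStep_withDensity hs hT' ν hq, ?_⟩
  set r : ℝ := 1 / 2 with hr
  -- Cauchy–Schwarz over the previous state at each fixed output y: the affinity of two mixtures is
  -- at least the affinity of the joint laws of state and output.
  have hcs : ∀ y, ∫⁻ θ, (p θ ^ r * q θ ^ r) *
        (ENNReal.ofReal (gaussianDensity m s (y - T θ)) ^ r
          * ENNReal.ofReal (gaussianDensity m s (y - T' θ)) ^ r) ∂ν
      ≤ (∫⁻ θ, p θ * ENNReal.ofReal (gaussianDensity m s (y - T θ)) ∂ν) ^ r
        * (∫⁻ θ, q θ * ENNReal.ofReal (gaussianDensity m s (y - T' θ)) ∂ν) ^ r := fun y => by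
    have hm1 : Measurable fun θ => (p θ * ENNReal.ofReal (gaussianDensity m s (y - T θ))) ^ r :=
      ((hk' hp hT).comp (measurable_const.prodMk measurable_id)).pow_const r
    have hm2 : Measurable fun θ => (q θ * ENNReal.ofReal (gaussianDensity m s (y - T' θ))) ^ r :=
      ((hk' hq hT').comp (measurable_const.prodMk measurable_id)).pow_const r
    have := ENNReal.lintegral_mul_le_Lp_mul_Lq ν Real.HolderConjugate.two_two hm1.aemeasurable
      hm2.aemeasurable
    have hr0 : 0 ≤ r := by norm_num [hr]
    have hr2 : r * 2 = 1 := by norm_num [hr]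
    simp only [← ENNReal.rpow_mul, hr2, ENNReal.rpow_one, Pi.mul_apply] at this
    refine le_trans (le_of_eq (lintegral_congr fun θ => ?_)) this
    rw [ENNReal.mul_rpow_of_nonneg _ _ hr0, ENNReal.mul_rpow_of_nonneg _ _ hr0]
    ring
  refine le_trans ?_ (lintegral_mono hcs)
  -- For a fixed state the product of root densities is a constant times a Gaussian density centred
  -- midway, so integrating over y leaves the overlap factor alone.
  have hov : ∀ θ y, ENNReal.ofReal (gaussianDensity m s (y - T θ)) ^ r
      * ENNReal.ofReal (gaussianDensity m s (y - T' θ)) ^ r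
      = ENNReal.ofReal (Real.exp (-(‖T θ - T' θ‖ ^ 2 / (8 * s ^ 2)))) *
        ENNReal.ofReal (gaussianDensity m s (y - (1 / 2 : ℝ) • (T θ + T' θ))) := fun θ y => by
    rw [ofReal_rpow_half_mul (gaussianDensity_nonneg _ _) (gaussianDensity_nonneg _ _),
      sqrt_mul_gaussianDensity, ENNReal.ofReal_mul (Real.exp_pos _).le]
  have hpq : Measurable fun θ => p θ ^ r * q θ ^ r := (hp.pow_const r).mul (hq.pow_const r)
  rw [lintegral_lintegral_swap]
  · calc ENNReal.ofReal (Real.exp (-(d ^ 2 / (8 * s ^ 2))) * a)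
        ≤ ENNReal.ofReal (Real.exp (-(d ^ 2 / (8 * s ^ 2)))) * ∫⁻ θ, p θ ^ r * q θ ^ r ∂ν := by
          rw [ENNReal.ofReal_mul (Real.exp_pos _).le]
          exact mul_le_mul_right ha _
      _ = ∫⁻ θ, ENNReal.ofReal (Real.exp (-(d ^ 2 / (8 * s ^ 2)))) * (p θ ^ r * q θ ^ r) ∂ν :=
          (lintegral_const_mul _ hpq).symm
      _ ≤ _ := lintegral_mono fun θ => by
          have hmm : Measurable fun y => ENNReal.ofReal
              (gaussianDensity m s (y - (1 / 2 : ℝ) • (T θ + T' θ))) :=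
            ((measurable_gaussianDensity s).comp (measurable_id.sub_const _)).ennreal_ofReal
          simp only [hov]
          rw [lintegral_const_mul _ (hmm.const_mul _), lintegral_const_mul _ hmm,
            lintegral_gaussianDensity_sub hs, mul_one, mul_comm]
          refine mul_le_mul_right (ENNReal.ofReal_le_ofReal (Real.exp_le_exp.2 ?_)) _
          have := hd θ
          gcongr
  · refine Measurable.aemeasurable ?_
    exact (hpq.comp measurable_snd).mul (((hk hT).pow_const r).mul ((hk hT').pow_const r))

end Affinity

section NoisyGradientDescent

instance isProbabilityMeasure_noiseLaw : IsProbabilityMeasure (noiseLaw m) := by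
  unfold noiseLaw; infer_instance

theorem measurable_noisyGD {G : E m → E m} (hG : Measurable G) (η σ : ℝ) (θ₀ : E m) (k : ℕ) :
    Measurable fun z => noisyGD G η σ θ₀ z k := by
  induction k with
  | zero => exact measurable_const
  | succ k ih =>
    exact ih.sub (((hG.comp ih).add ((measurable_pi_apply k).const_smul σ)).const_smul η)

/-- Only the first k noise vectors influence the k-th iterate; this is the source of its
independence from the next one. -/
theorem noisyGD_congr {G : E m → E m} {η σ : ℝ} {θ₀ : E m} {z z' : ℕ → E m} {k : ℕ}
    (h : ∀ i < k, z i = z' i) : noisyGD G η σ θ₀ z k = noisyGD G η σ θ₀ z' k := by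
  induction k with
  | zero => rfl
  | succ k ih =>
    simp only [noisyGD, ih fun i hi => h i (by omega), h k (by omega)]

/-- The iterate is independent of the next noise variable. -/
theorem map_prodMk_noisyGD {G : E m → E m} (hG : Measurable G) (η σ : ℝ) (θ₀ : E m) (k : ℕ) :
    (noiseLaw m).map (fun z => (noisyGD G η σ θ₀ z k, z k))
      = ((noiseLaw m).map fun z => noisyGD G η σ θ₀ z k).prod (stdGaussian (E m)) := by
  have hm := measurable_noisyGD hG η σ θ₀ k
  have hind : iIndepFun (fun (i : ℕ) (z : ℕ → E m) => z i) (noiseLaw m) :=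
    iIndepFun_infinitePi (P := fun _ : ℕ => stdGaussian (E m)) (X := fun _ x => x)
      fun _ => measurable_id
  have h2 := hind.indepFun_finset (Finset.range k) {k} (by simp) fun i => measurable_pi_apply i
  -- Zero-padding a finite noise vector writes the iterate as a measurable function of the first k
  -- coordinates, to which independence of disjoint blocks applies.
  set ext : ((i : Finset.range k) → E m) → (ℕ → E m) := fun w i =>
    if h : i ∈ Finset.range k then w ⟨i, h⟩ else 0 with hext
  have hextm : Measurable ext := measurable_pi_lambda _ fun i => by
    by_cases h : i ∈ Finset.range k
    · simp only [hext, h, dif_pos]; exact measurable_pi_apply _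
    · simp only [hext, h, dif_neg, not_false_eq_true]; exact measurable_const
  have hψ : Measurable fun w : (({k} : Finset ℕ) → E m) => w ⟨k, Finset.mem_singleton_self k⟩ :=
    measurable_pi_apply _
  have hφ : Measurable fun w => noisyGD G η σ θ₀ (ext w) k := hm.comp hextm
  have h3 := h2.comp hφ hψ
  have e : (fun w => noisyGD G η σ θ₀ (ext w) k) ∘
      (fun (z : ℕ → E m) (i : Finset.range k) => z i) = fun z => noisyGD G η σ θ₀ z k := by
    funext z
    refine noisyGD_congr fun i hi => ?_
    simp [hext, hi]
  rw [e] at h3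
  have h4 := (indepFun_iff_map_prod_eq_prod_map_map hm.aemeasurable
    (measurable_pi_apply k).aemeasurable).1 h3
  refine h4.trans ?_
  congr 1
  exact Measure.infinitePi_map_eval (fun _ : ℕ => stdGaussian (E m)) k

/-- The scale is negative because the noise is subtracted; only its square enters the affinity. -/
theorem map_noisyGD_succ {G : E m → E m} (hG : Measurable G) (η σ : ℝ) (θ₀ : E m) (k : ℕ) :
    (noiseLaw m).map (fun z => noisyGD G η σ θ₀ z (k + 1))
      = gaussianStep (-(η * σ)) (fun θ => θ - η • G θ)
        ((noiseLaw m).map fun z => noisyGD G η σ θ₀ z k) := by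
  have hm := measurable_noisyGD hG η σ θ₀ k
  rw [gaussianStep, ← map_prodMk_noisyGD hG, Measure.map_map]
  · congr 1
    funext z
    simp only [noisyGD, Function.comp]
    module
  · exact ((measurable_fst.sub ((hG.comp measurable_fst).const_smul η))).add
      (measurable_snd.const_smul (-(η * σ)))
  · exact hm.prodMk (measurable_pi_apply k)

/-- The recursion says that 1 - h/2 is multiplied by 1 - x/2 at each composition. -/
theorem hComp_eq (x : ℝ) (k : ℕ) : hComp x k = 2 - 2 * (1 - x / 2) ^ k := by
  induction k with
  | zero => simp [hComp]
  | succ k ih => rw [hComp, ih, pow_succ]; ring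

theorem noiseScale_pos {x : ℝ} (h0 : 0 < x) (h2 : x < 2) : 0 < noiseScale x := by
  have : Real.log (1 - 1 / 2 * x) < 0 := Real.log_neg (by linarith) (by linarith)
  exact Real.sqrt_pos.2 (one_div_pos.2 (by linarith))

/-- The calibration of the noise: with shift and scale in the ratio 1 to `noiseScale x`, one step
multiplies the affinity by 1 - x/2. -/
theorem exp_neg_noiseScale {x : ℝ} (h0 : 0 < x) (h2 : x < 2) :
    Real.exp (-(1 / (8 * noiseScale x ^ 2))) = 1 - x / 2 := by
  have hl : Real.log (1 - 1 / 2 * x) < 0 := Real.log_neg (by linarith) (by linarith)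
  rw [noiseScale, Real.sq_sqrt (one_div_nonneg.2 (by linarith))]
  rw [show -(1 / (8 * (1 / (-8 * Real.log (1 - 1 / 2 * x))))) = Real.log (1 - 1 / 2 * x) by
    field_simp, Real.exp_log (by linarith)]
  ring

variable {Θ : Set (E m)} {f : E m → ℝ → ℝ} {p q : ℝ}

theorem RegularFamily.measurable_gradLoss_comp (hf : RegularFamily Θ f p q) {κ : ℝ → ℝ}
    {c b : ℕ → ℝ} (hK : KernelDesign κ c b) {π : E m → E m} (hπ : IsRetraction Θ π) {n : ℕ}
    (D : Fin n → ℝ) : Measurable fun θ => gradLoss Θ f κ c b D (π θ) := by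
  have hc : ContinuousOn (gradLoss Θ f κ c b D) Θ := by
    have : gradLoss Θ f κ c b D = fun θ => (WithLp.toLp 2
        (fun i => weightedScore Θ f (fun x => √(kde κ c b D x)) θ i) : E m) := by
      funext θ; ext i; exact gradLoss_apply κ c b D θ i
    rw [this]
    refine (PiLp.continuous_toLp 2 _).comp_continuousOn (continuousOn_pi.2 fun i => ?_)
    exact hf.continuousOn_weightedScore (measurable_kde hK D).sqrt
      (integrable_sq_sqrt (kde_nonneg hK D) (integrable_kde hK D)) i
  exact (continuousOn_iff_continuous_domRestrict.1 hc).measurable.comp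
    (hπ.measurable.subtype_mk (h := hπ.mem))

/-- Privacy of noisy gradient descent on the Hellinger loss. -/
theorem RegularFamily.isHDP_pgd (hf : RegularFamily Θ f p q) {κ : ℝ → ℝ} {c b : ℕ → ℝ}
    (hK : KernelDesign κ c b) {π : E m → E m} (hπ : IsRetraction Θ π) {ε : ℝ} (hε : 0 < ε)
    {n K : ℕ} {η Δ x : ℝ} (θ₀ : E m) (hη : 0 < η) (hΔ : 0 ≤ Δ)
    (hS : sensitivity Θ f κ c b n ≤ ENNReal.ofReal Δ) (hx0 : 0 < x) (hx2 : x < 2)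
    (hcomp : hComp x K ≤ ε) :
    IsHDP (n := n) ε (noiseLaw m) (fun D z => pgd Θ f κ c b π η Δ x θ₀ K D z) := by
  have hG : ∀ D : Fin n → ℝ, Measurable fun θ => gradLoss Θ f κ c b D (π θ) :=
    hf.measurable_gradLoss_comp hK hπ
  refine ⟨fun D => measurable_noisyGD (hG D) _ _ _ _, fun D D' hDD' => ?_⟩
  have hdist : ∀ θ, ‖gradLoss Θ f κ c b D (π θ) - gradLoss Θ f κ c b D' (π θ)‖ ≤ Δ := fun θ => by
    have h1 : edist (gradLoss Θ f κ c b D (π θ)) (gradLoss Θ f κ c b D' (π θ))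
        ≤ sensitivity Θ f κ c b n :=
      le_iSup_of_le D (le_iSup_of_le D' (le_iSup_of_le hDD' (le_iSup_of_le (π θ)
        (le_iSup_of_le (hπ.mem θ) le_rfl))))
    have h2 := h1.trans hS
    rw [edist_dist, ENNReal.ofReal_le_ofReal_iff hΔ, dist_eq_norm] at h2
    exact h2
  -- With Δ = 0 the noise vanishes and the Gaussian argument is unavailable, but then the two
  -- gradient maps coincide and the output laws are equal.
  rcases hΔ.eq_or_lt with h0 | hΔ'
  · have e : (fun θ => gradLoss Θ f κ c b D (π θ)) = fun θ => gradLoss Θ f κ c b D' (π θ) := by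
      funext θ
      have := hdist θ
      rw [← h0] at this
      exact sub_eq_zero.1 (norm_le_zero_iff.1 this)
    simp only [pgd, e]
    rw [hellingerDiv_self]
    exact hε.le
  set σ := Δ * noiseScale x with hσ
  have hns := noiseScale_pos hx0 hx2
  have hs : -(η * σ) ≠ 0 := by
    rw [neg_ne_zero]; positivity
  have haff : ∀ k, AffinityGE
      ((noiseLaw m).map fun z => noisyGD (fun θ => gradLoss Θ f κ c b D (π θ)) η σ θ₀ z k)
      ((noiseLaw m).map fun z => noisyGD (fun θ => gradLoss Θ f κ c b D' (π θ)) η σ θ₀ z k)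
      ((1 - x / 2) ^ k) := fun k => by
    induction k with
    | zero => simpa [noisyGD] using affinityGE_dirac θ₀
    | succ k ih =>
      rw [map_noisyGD_succ (hG D), map_noisyGD_succ (hG D')]
      have := ih.gaussianStep hs (d := η * Δ) (measurable_id.sub ((hG D).const_smul η))
        (measurable_id.sub ((hG D').const_smul η)) fun θ => ?_
      -- The shift ηΔ and the noise scale ηΔ · `noiseScale x` share the factor ηΔ, so the loss per
      -- step depends on x alone.
      · have e : (η * Δ) ^ 2 / (8 * (-(η * σ)) ^ 2) = 1 / (8 * noiseScale x ^ 2) := by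
          rw [hσ]; field_simp
        rw [e, exp_neg_noiseScale hx0 hx2, ← pow_succ'] at this
        exact this
      · simp only [Pi.sub_apply, Pi.smul_apply, id]
        rw [sub_sub_sub_cancel_left, ← smul_sub, norm_smul, Real.norm_of_nonneg hη.le,
          norm_sub_rev]
        exact mul_le_mul_of_nonneg_left (hdist θ) hη.le
  have hP : ∀ D : Fin n → ℝ, IsProbabilityMeasure ((noiseLaw m).map fun z =>
      noisyGD (fun θ => gradLoss Θ f κ c b D (π θ)) η σ θ₀ z K) := fun D =>
    Measure.isProbabilityMeasure_map (measurable_noisyGD (hG D) _ _ _ _).aemeasurable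
  have hPD := hP D
  have hPD' := hP D'
  have := (haff K).hellingerDiv_le
  rw [← hComp_eq] at this
  exact this.trans hcomp

end NoisyGradientDescent

end PMHDE

/-! ### L¹ bias and stochastic error of kernel estimates. -/

namespace PMHDE

/-- Continuity of translations in `L¹`. -/
theorem tendsto_lintegral_edist_translate {g : ℝ → ℝ} (hgm : Measurable g) (hg : Integrable g) :
    Tendsto (fun s => ∫⁻ x, edist (g (x - s)) (g x)) (𝓝 0) (𝓝 0) := by
  rw [ENNReal.tendsto_nhds_zero]
  intro ε hε
  have hε3 : ε / 3 ≠ 0 := (ENNReal.div_pos hε.ne' (by simp)).ne'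
  -- Approximation by a compactly supported continuous function, whose translates by |s| < 1 share a
  -- bounded dominating function. Translation invariance transfers the approximation error to the
  -- shifted function.
  obtain ⟨h, hsupp, hgh, hcont, -⟩ := hg.exists_hasCompactSupport_lintegral_sub_le hε3
  have hgh' : ∫⁻ x, edist (g x) (h x) ≤ ε / 3 := by simpa only [edist_eq_enorm_sub] using hgh
  obtain ⟨C, hC⟩ := hsupp.exists_bound_of_continuous hcont
  obtain ⟨R, hR⟩ := hsupp.isCompact.isBounded.subset_closedBall 0
  have hzero : ∀ x, R < |x| → h x = 0 := fun x hx => by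
    by_contra hne
    have := hR (subset_tsupport h (Function.mem_support.2 hne))
    rw [Metric.mem_closedBall, dist_zero_right, Real.norm_eq_abs] at this
    linarith
  have hlim : Tendsto (fun s => ∫⁻ x, edist (h (x - s)) (h x)) (𝓝 0) (𝓝 0) := by
    have := tendsto_lintegral_filter_of_dominated_convergence (μ := volume) (l := 𝓝 (0 : ℝ))
      (F := fun s x => edist (h (x - s)) (h x)) (f := fun _ => 0)
      (Icc (-(R + 1)) (R + 1) |>.indicator fun _ => ENNReal.ofReal (2 * C))
      (Eventually.of_forall fun s => (hcont.measurable.comp (measurable_id.sub_const s)).edist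
        hcont.measurable) ?_ ?_ ?_
    · simpa using this
    · filter_upwards [Metric.ball_mem_nhds (0 : ℝ) one_pos] with s hs
      refine Eventually.of_forall fun x => ?_
      rw [Metric.mem_ball, dist_zero_right, Real.norm_eq_abs] at hs
      by_cases hx : x ∈ Icc (-(R + 1)) (R + 1)
      · rw [indicator_of_mem hx, edist_dist]
        refine ENNReal.ofReal_le_ofReal ((dist_le_norm_add_norm _ _).trans ?_)
        linarith [hC (x - s), hC x]
      · have hx' : R + 1 < |x| := by
          by_contra hle
          exact hx (abs_le.1 (not_lt.1 hle))
        have h1 : R < |x - s| := by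
          have := abs_sub_abs_le_abs_sub x s
          linarith
        rw [hzero x (by linarith), hzero _ h1]
        simp
    · rw [lintegral_indicator measurableSet_Icc, setLIntegral_const, Real.volume_Icc]
      exact ENNReal.mul_ne_top ENNReal.ofReal_ne_top ENNReal.ofReal_ne_top
    · refine Eventually.of_forall fun x => ?_
      have : Continuous fun s => edist (h (x - s)) (h x) := by fun_prop
      simpa using this.tendsto 0
  filter_upwards [ENNReal.tendsto_nhds_zero.1 hlim (ε / 3) (ENNReal.div_pos hε.ne' (by simp))]
    with s hs
  have hm1 : Measurable fun x => g (x - s) := hgm.comp (measurable_id.sub_const s)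
  have hm2 : Measurable fun x => h (x - s) := hcont.measurable.comp (measurable_id.sub_const s)
  have hshift : ∫⁻ x, edist (g (x - s)) (h (x - s)) = ∫⁻ x, edist (g x) (h x) :=
    lintegral_sub_right_eq_self (fun x => edist (g x) (h x)) s
  calc ∫⁻ x, edist (g (x - s)) (g x)
      ≤ ∫⁻ x, (edist (g (x - s)) (h (x - s)) + edist (h (x - s)) (h x)) + edist (g x) (h x) :=
        lintegral_mono fun x => by
          rw [edist_comm (g x) (h x)]
          exact edist_triangle4 _ _ _ _
    _ = (∫⁻ x, edist (g (x - s)) (h (x - s))) + (∫⁻ x, edist (h (x - s)) (h x))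
          + ∫⁻ x, edist (g x) (h x) := by
        rw [lintegral_add_right _ (hgm.edist hcont.measurable),
          lintegral_add_right _ (hm2.edist hcont.measurable)]
    _ ≤ ε / 3 + ε / 3 + ε / 3 := add_le_add (add_le_add (hshift.le.trans hgh') hs) hgh'
    _ = ε := ENNReal.add_thirds ε

/-- Mean absolute deviation of an empirical mean of bounded nonnegative variables. -/
theorem lintegral_edist_empirical_mean_le {α : Type*} [MeasurableSpace α] (μ : Measure α)
    [IsProbabilityMeasure μ] {φ : α → ℝ} (hφ : Measurable φ) {B : ℝ} (h0 : ∀ y, 0 ≤ φ y)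
    (hB : ∀ y, φ y ≤ B) {n : ℕ} (hn : 1 ≤ n) {a : ℝ} (ha : 0 < a) :
    ∫⁻ D : Fin n → α, edist (1 / n * ∑ i, φ (D i)) (∫ y, φ y ∂μ) ∂(Measure.pi fun _ => μ)
      ≤ ENNReal.ofReal (B / (n * a) * (∫ y, φ y ∂μ) + a) := by
  have hn0 : (0 : ℝ) < n := by exact_mod_cast hn
  have hB0 : 0 ≤ B := by
    have : Nonempty α := nonempty_of_isProbabilityMeasure μ
    exact (h0 (Classical.arbitrary α)).trans (hB _)
  set P : Measure (Fin n → α) := Measure.pi fun _ => μ with hP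
  set I := ∫ y, φ y ∂μ with hI
  set S : (Fin n → α) → ℝ := fun D => 1 / n * ∑ i, φ (D i) with hS
  have hbd : ∀ y, ‖φ y‖ ≤ B := fun y => by rw [Real.norm_of_nonneg (h0 y)]; exact hB y
  have hφi : Integrable φ μ := Integrable.of_bound hφ.aestronglyMeasurable B
    (Eventually.of_forall hbd)
  have hφ2 : MemLp (fun y => (1 / n : ℝ) * φ y) 2 μ := MemLp.of_bound
    (hφ.const_mul _).aestronglyMeasurable (1 / n * B) (Eventually.of_forall fun y => by
      rw [norm_mul, Real.norm_of_nonneg (by positivity)]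
      exact mul_le_mul_of_nonneg_left (hbd y) (by positivity))
  have hSsum : S = ∑ i, fun D : Fin n → α => (1 / n : ℝ) * φ (D i) := by
    funext D
    simp only [hS, Finset.sum_apply, Finset.mul_sum]
  have hSm : Measurable S := (Finset.measurable_sum _ fun i _ =>
    hφ.comp (measurable_pi_apply i)).const_mul _
  have hS0 : ∀ D, 0 ≤ S D := fun D =>
    mul_nonneg (by positivity) (Finset.sum_nonneg fun i _ => h0 _)
  have hSB : ∀ D, S D ≤ B := fun D => by
    calc S D ≤ 1 / n * ∑ _i : Fin n, B :=
          mul_le_mul_of_nonneg_left (Finset.sum_le_sum fun i _ => hB _) (by positivity)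
      _ = B := by simp; field_simp
  have hSi : ∀ i : Fin n, Integrable (fun D : Fin n → α => (1 / n : ℝ) * φ (D i)) P := fun i =>
    Integrable.of_bound ((hφ.comp (measurable_pi_apply i)).const_mul _).aestronglyMeasurable
      (1 / n * B) (Eventually.of_forall fun D => by
        rw [norm_mul, Real.norm_of_nonneg (by positivity)]
        exact mul_le_mul_of_nonneg_left (hbd _) (by positivity))
  have hES : ∫ D, S D ∂P = I := by
    rw [hSsum]
    simp only [Finset.sum_apply]
    rw [integral_finsetSum _ fun i _ => hSi i]
    simp only [integral_const_mul]
    have : ∀ i : Fin n, ∫ D, φ (D i) ∂P = I := fun i =>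
      integral_comp_eval (μ := fun _ : Fin n => μ) hφ.aestronglyMeasurable
    simp only [this, Finset.sum_const, Finset.card_univ, Fintype.card_fin, nsmul_eq_mul]
    field_simp
  -- One factor φ is bounded by B and the other is kept, so the variance retains the mean I. For the
  -- kernel estimate this mean is integrable in the evaluation point.
  have hVar : Var[S; P] ≤ B / n * I := by
    rw [hSsum, variance_sum_pi (X := fun (_ : Fin n) y => (1 / n : ℝ) * φ y) fun _ => hφ2]
    have h1 : Var[fun y => (1 / n : ℝ) * φ y; μ] ≤ (1 / n) ^ 2 * (B * I) := by
      rw [variance_const_mul]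
      refine mul_le_mul_of_nonneg_left ?_ (by positivity)
      refine (variance_le_expectation_sq hφ.aestronglyMeasurable).trans ?_
      rw [hI, ← integral_const_mul]
      refine integral_mono_of_nonneg (Eventually.of_forall fun y => sq_nonneg _)
        (hφi.const_mul B) (Eventually.of_forall fun y => ?_)
      simp only [Pi.pow_apply]
      nlinarith [h0 y, hB y]
    calc _ ≤ ∑ _i : Fin n, (1 / n : ℝ) ^ 2 * (B * I) := Finset.sum_le_sum fun _ _ => h1
      _ = B / n * I := by
        simp only [Finset.sum_const, Finset.card_univ, Fintype.card_fin, nsmul_eq_mul]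
        field_simp
  have hI0 : 0 ≤ I := integral_nonneg h0
  have hIB : I ≤ B := by
    rw [← hES]
    refine (integral_mono (Integrable.of_bound hSm.aestronglyMeasurable B
      (Eventually.of_forall fun D => ?_)) (integrable_const B) hSB).trans (by simp)
    rw [Real.norm_of_nonneg (hS0 D)]; exact hSB D
  have habs : ∀ D, |S D - I| ≤ B := fun D => abs_le.2
    ⟨by linarith [hS0 D], by linarith [hSB D]⟩
  have hsq : Integrable (fun D => (S D - I) ^ 2) P :=
    Integrable.of_bound ((hSm.sub_const I).pow_const 2).aestronglyMeasurable (B ^ 2)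
      (Eventually.of_forall fun D => by
        rw [Real.norm_of_nonneg (sq_nonneg _), ← sq_abs]
        exact pow_le_pow_left₀ (abs_nonneg _) (habs D) 2)
  have hai : Integrable (fun D => |S D - I|) P :=
    Integrable.of_bound (hSm.sub_const I).abs.aestronglyMeasurable B
      (Eventually.of_forall fun D => by simpa using habs D)
  have hbound : ∫ D, |S D - I| ∂P ≤ B / (n * a) * I + a := by
    -- Trading |u| for u²/a + a avoids the square root of the variance, leaving a bound linear in
    -- the mean.
    have h1 : ∀ D, |S D - I| ≤ 1 / a * (S D - I) ^ 2 + a := fun D => by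
      rw [← sub_nonneg]
      have : 1 / a * (S D - I) ^ 2 + a - |S D - I|
          = 1 / a * ((|S D - I| - a / 2) ^ 2 + 3 / 4 * a ^ 2) := by
        rw [← sq_abs]; field_simp; ring
      rw [this]; positivity
    refine (integral_mono hai ((hsq.const_mul _).add (integrable_const a)) h1).trans ?_
    simp only [Pi.add_apply]
    rw [integral_add (hsq.const_mul _) (integrable_const a), integral_const_mul]
    have hv : ∫ D, (S D - I) ^ 2 ∂P = Var[S; P] := by
      rw [variance_eq_integral hSm.aemeasurable, hES]
    rw [hv]
    have h2 : 1 / a * Var[S; P] ≤ 1 / a * (B / n * I) :=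
      mul_le_mul_of_nonneg_left hVar (by positivity)
    have h3 : 1 / a * (B / n * I) = B / (n * a) * I := by field_simp
    have h4 : ∫ _D, a ∂P = a := by simp
    rw [h4]
    linarith
  calc _ = ∫⁻ D, ENNReal.ofReal |S D - I| ∂P := by simp only [edist_dist, Real.dist_eq, hS]
    _ = ENNReal.ofReal (∫ D, |S D - I| ∂P) :=
      (ofReal_integral_eq_lintegral_ofReal hai (Eventually.of_forall fun _ => abs_nonneg _)).symm
    _ ≤ _ := ENNReal.ofReal_le_ofReal hbound

/-- The law with Lebesgue density `g`. -/
noncomputable def densityLaw (g : ℝ → ℝ) : Measure ℝ :=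
  volume.withDensity fun x => ENNReal.ofReal (g x)

theorem lintegral_ofReal_density {g : ℝ → ℝ} (hg : IsDensity g) :
    ∫⁻ x, ENNReal.ofReal (g x) = 1 := by
  rw [← ofReal_integral_eq_lintegral_ofReal (integrable_of_isDensity hg)
    (Eventually.of_forall hg.nonneg), hg.integral_eq_one, ENNReal.ofReal_one]

theorem isProbabilityMeasure_densityLaw {g : ℝ → ℝ} (hg : IsDensity g) :
    IsProbabilityMeasure (densityLaw g) :=
  ⟨by rw [densityLaw, withDensity_apply _ MeasurableSet.univ, setLIntegral_univ,
    lintegral_ofReal_density hg]⟩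

/-- The expected truncated kernel density estimate. -/
noncomputable def meanKde (κ : ℝ → ℝ) (a t : ℝ) (g : ℝ → ℝ) (x : ℝ) : ℝ :=
  ∫ y, 1 / a * (Ioo (-t) t).indicator (fun y => κ ((x - y) / a)) y ∂(densityLaw g)

section Bias

variable {κ : ℝ → ℝ} {M a t : ℝ} {g : ℝ → ℝ}

theorem measurable_truncated_kernel (hκ : Measurable κ) (a t x : ℝ) :
    Measurable fun y => 1 / a * (Ioo (-t) t).indicator (fun y => κ ((x - y) / a)) y :=
  (Measurable.indicator (hκ.comp (by fun_prop)) measurableSet_Ioo).const_mul _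

/-- Moves the truncation from the kernel to g, exhibiting the mean as a convolution with the
truncated density. -/
theorem meanKde_eq (hg : IsDensity g) (κ : ℝ → ℝ) (a t x : ℝ) :
    meanKde κ a t g x
      = ∫ y, 1 / a * κ ((x - y) / a) * (Ioo (-t) t).indicator g y := by
  rw [meanKde, densityLaw, integral_withDensity_eq_integral_toReal_smul
    hg.measurable.ennreal_ofReal (by simp)]
  refine integral_congr_ae (Eventually.of_forall fun y => ?_)
  simp only [ENNReal.toReal_ofReal (hg.nonneg y), smul_eq_mul]
  by_cases hy : y ∈ Ioo (-t) t <;> simp [hy]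
  ring

theorem measurable_meanKde (hκ : Measurable κ) (hg : IsDensity g) (a t : ℝ) :
    Measurable (meanKde κ a t g) := by
  have := isProbabilityMeasure_densityLaw hg
  refine (StronglyMeasurable.integral_prod_right' (f := fun w : ℝ × ℝ =>
    1 / a * (Ioo (-t) t).indicator (fun y => κ ((w.1 - y) / a)) w.2) ?_).measurable
  refine Measurable.stronglyMeasurable (Measurable.const_mul ?_ _)
  have h1 : Measurable fun w : ℝ × ℝ => κ ((w.1 - w.2) / a) := hκ.comp (by fun_prop)
  exact h1.indicator (measurable_snd measurableSet_Ioo)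

/-- `L¹` error of the expected kernel density estimate. -/
theorem lintegral_edist_meanKde_le (hκm : Measurable κ) (h0 : ∀ x, 0 ≤ κ x) (hM : ∀ x, κ x ≤ M)
    (hκ : Integrable κ) (hκ1 : ∫ x, κ x ≤ 1) {β : ℝ} (hβ : ∀ x, κ x ≠ 0 → |x| < β)
    (hg : IsDensity g) (ha : 0 < a) {δ : ℝ≥0∞}
    (hδ : ∀ s, |s| < a * β → ∫⁻ x, edist (g (x - s)) (g x) ≤ δ) :
    ∫⁻ x, edist (meanKde κ a t g x) (g x) ≤ ENNReal.ofReal (1 - ∫ x, κ x)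
      + (∫⁻ x, edist ((Ioo (-t) t).indicator g x) (g x)) + δ := by
  set J := ∫ x, κ x with hJ
  set G : ℝ → ℝ := (Ioo (-t) t).indicator g with hG
  have hgi := integrable_of_isDensity hg
  have hGm : Measurable G := hg.measurable.indicator measurableSet_Ioo
  have hGi : Integrable G := hgi.indicator measurableSet_Ioo
  set k : ℝ → ℝ := fun s => 1 / a * κ (s / a) with hk
  have hkm : Measurable k := (hκm.comp (measurable_id.div_const a)).const_mul _
  have hk0 : ∀ s, 0 ≤ k s := fun s => mul_nonneg (by positivity) (h0 _)
  have hki : Integrable k := (hκ.comp_div ha.ne').const_mul _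
  have hkJ : ∫ s, k s = J := by
    rw [hk, integral_const_mul, Measure.integral_comp_div, abs_of_pos ha, smul_eq_mul]
    field_simp
    exact hJ.symm
  have hkx : ∀ x, Integrable fun y => k (x - y) := fun x => hki.comp_sub_left x
  have hkG : ∀ x, Integrable fun y => k (x - y) * G y := fun x => by
    refine Integrable.bdd_mul (c := 1 / a * M) hGi
      (hkm.comp (measurable_const.sub measurable_id)).aestronglyMeasurable
      (Eventually.of_forall fun y => ?_)
    rw [Real.norm_of_nonneg (hk0 _)]
    exact mul_le_mul_of_nonneg_left (hM _) (by positivity)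
  have hpt : ∀ x, edist (meanKde κ a t g x) (g x)
      ≤ (∫⁻ s, ENNReal.ofReal (k s) * edist (G (x - s)) (g x))
        + ENNReal.ofReal (1 - J) * ENNReal.ofReal (g x) := fun x => by
    -- The kernel has mass J, possibly below one, so the convolution is compared with J g(x); the
    -- missing mass 1 - J is paid separately.
    have e1 : meanKde κ a t g x - J * g x = ∫ y, k (x - y) * (G y - g x) := by
      rw [meanKde_eq hg]
      simp only [mul_sub]
      rw [integral_sub (hkG x) ((hkx x).mul_const _), integral_mul_const,
        integral_sub_left_eq_self (fun s => k s) volume x, hkJ]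
    have h1 : edist (meanKde κ a t g x) (J * g x)
        ≤ ∫⁻ s, ENNReal.ofReal (k s) * edist (G (x - s)) (g x) := by
      rw [edist_eq_enorm_sub, e1]
      refine (enorm_integral_le_lintegral_enorm _).trans (le_of_eq ?_)
      rw [← lintegral_sub_left_eq_self _ x]
      refine lintegral_congr fun y => ?_
      rw [enorm_mul, sub_sub_cancel, edist_eq_enorm_sub, Real.enorm_of_nonneg (hk0 _)]
    have h2 : edist (J * g x) (g x) = ENNReal.ofReal (1 - J) * ENNReal.ofReal (g x) := by
      rw [← ENNReal.ofReal_mul (by linarith), edist_comm, edist_dist, Real.dist_eq,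
        abs_of_nonneg]
      · ring_nf
      · nlinarith [hg.nonneg x]
    exact (edist_triangle _ (J * g x) _).trans (add_le_add h1 h2.le)
  have hmeas2 : Measurable fun w : ℝ × ℝ => ENNReal.ofReal (k w.2) * edist (G (w.1 - w.2)) (g w.1) :=
    (hkm.comp measurable_snd).ennreal_ofReal.mul
      ((hGm.comp (measurable_fst.sub measurable_snd)).edist (hg.measurable.comp measurable_fst))
  have hinner : ∀ s, ENNReal.ofReal (k s) * ∫⁻ x, edist (G (x - s)) (g x)
      ≤ ENNReal.ofReal (k s) * ((∫⁻ x, edist (G x) (g x)) + δ) := fun s => by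
    -- Only shifts with |s| < aβ carry weight, and these are the ones for which the translation
    -- modulus δ is assumed.
    by_cases hs : κ (s / a) = 0
    · simp [hk, hs]
    have hsβ : |s| < a * β := by
      have := hβ _ hs
      rwa [abs_div, abs_of_pos ha, div_lt_iff₀ ha, mul_comm] at this
    refine mul_le_mul_right ?_ _
    have hsh : ∫⁻ x, edist (G (x - s)) (g (x - s)) = ∫⁻ x, edist (G x) (g x) :=
      lintegral_sub_right_eq_self (fun x => edist (G x) (g x)) s
    have hms : Measurable fun x => g (x - s) := hg.measurable.comp (measurable_id.sub_const s)
    calc _ ≤ ∫⁻ x, edist (G (x - s)) (g (x - s)) + edist (g (x - s)) (g x) :=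
          lintegral_mono fun x => edist_triangle _ _ _
      _ = (∫⁻ x, edist (G (x - s)) (g (x - s))) + ∫⁻ x, edist (g (x - s)) (g x) :=
          lintegral_add_right _ (hms.edist hg.measurable)
      _ ≤ _ := add_le_add hsh.le (hδ s hsβ)
  have hkl : ∫⁻ s, ENNReal.ofReal (k s) ≤ 1 := by
    rw [← ofReal_integral_eq_lintegral_ofReal hki (Eventually.of_forall hk0), hkJ]
    exact ENNReal.ofReal_le_one.2 hκ1
  calc ∫⁻ x, edist (meanKde κ a t g x) (g x)
      ≤ ∫⁻ x, (∫⁻ s, ENNReal.ofReal (k s) * edist (G (x - s)) (g x))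
        + ENNReal.ofReal (1 - J) * ENNReal.ofReal (g x) := lintegral_mono hpt
    _ = (∫⁻ x, ∫⁻ s, ENNReal.ofReal (k s) * edist (G (x - s)) (g x))
        + ENNReal.ofReal (1 - J) := by
        rw [lintegral_add_right _ (hg.measurable.ennreal_ofReal.const_mul _),
          lintegral_const_mul _ hg.measurable.ennreal_ofReal, lintegral_ofReal_density hg, mul_one]
    _ ≤ ((∫⁻ x, edist (G x) (g x)) + δ) + ENNReal.ofReal (1 - J) := by
        gcongr
        rw [lintegral_lintegral_swap hmeas2.aemeasurable]
        calc _ = ∫⁻ s, ENNReal.ofReal (k s) * ∫⁻ x, edist (G (x - s)) (g x) :=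
              lintegral_congr fun s => lintegral_const_mul _
                ((hGm.comp (measurable_id.sub_const s)).edist hg.measurable)
          _ ≤ ∫⁻ s, ENNReal.ofReal (k s) * ((∫⁻ x, edist (G x) (g x)) + δ) :=
              lintegral_mono hinner
          _ = (∫⁻ s, ENNReal.ofReal (k s)) * ((∫⁻ x, edist (G x) (g x)) + δ) :=
              lintegral_mul_const _ hkm.ennreal_ofReal
          _ ≤ 1 * _ := mul_le_mul_left hkl _
          _ = _ := one_mul _
    _ = _ := by rw [add_comm, add_assoc]

end Bias

end PMHDE

/-! ### Consistency of the truncated kernel density estimator. -/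

namespace PMHDE

variable {κ : ℝ → ℝ} {c b : ℕ → ℝ} {g : ℝ → ℝ}

theorem kde_eq_empirical_mean (κ : ℝ → ℝ) (c b : ℕ → ℝ) {n : ℕ} (D : Fin n → ℝ) (x : ℝ) :
    kde κ c b D x = 1 / n * ∑ i, 1 / c n *
      (Ioo (-b n) (b n)).indicator (fun y => κ ((x - y) / c n)) (D i) := by
  rw [kde, ← Finset.mul_sum, ← mul_assoc]
  congr 1
  rw [one_div_mul_one_div]

/-- Mean `L¹` error of the kernel density estimate through a bounded kernel `κ' ≤ κ`. -/
theorem lintegral_edist_kde_le (hK : KernelDesign κ c b) (hg : IsDensity g) {κ' : ℝ → ℝ} {M : ℝ}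
    (hm : Measurable κ') (h0 : ∀ x, 0 ≤ κ' x) (hle : ∀ x, κ' x ≤ κ x) (hM : ∀ x, κ' x ≤ M)
    {n : ℕ} (hn : 1 ≤ n) (R : ℝ) {α : ℝ} (hα : 0 < α) :
    ∫⁻ D : Fin n → ℝ, (∫⁻ x, edist (kde κ c b D x) (g x)) ∂(Measure.pi fun _ => densityLaw g)
      ≤ ENNReal.ofReal (1 - ∫ x, κ' x)
        + ((ENNReal.ofReal (M / (n * c n * α)) *
              (1 + ∫⁻ x, edist (meanKde κ' (c n) (b n) g x) (g x))
            + ENNReal.ofReal α * ENNReal.ofReal (2 * R))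
          + 2 * ((∫⁻ x in (Icc (-R) R)ᶜ, ENNReal.ofReal (g x))
            + ∫⁻ x, edist (meanKde κ' (c n) (b n) g x) (g x)))
        + ∫⁻ x, edist (meanKde κ' (c n) (b n) g x) (g x) := by
  have hμ := isProbabilityMeasure_densityLaw hg
  set P : Measure (Fin n → ℝ) := Measure.pi fun _ => densityLaw g with hP
  have hc := hK.c_pos n
  have hn0 : (0 : ℝ) < n := by exact_mod_cast hn
  have hM0 : 0 ≤ M := (h0 0).trans (hM 0)
  set m₁ : ℝ → ℝ := meanKde κ' (c n) (b n) g with hm₁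
  have hm₁m : Measurable m₁ := measurable_meanKde hm hg _ _
  set bias := ∫⁻ x, edist (m₁ x) (g x) with hbias
  have hκi := integrable_of_isDensity hK.isDensity
  have hκ'i : Integrable κ' := hκi.mono' hm.aestronglyMeasurable (Eventually.of_forall fun x => by
    rw [Real.norm_of_nonneg (h0 x)]; exact hle x)
  have hφ0 : ∀ x y, 0 ≤ 1 / c n * (Ioo (-b n) (b n)).indicator (fun y => κ' ((x - y) / c n)) y :=
    fun x y => mul_nonneg (by positivity) (indicator_nonneg (fun _ _ => h0 _) _)
  have hφM : ∀ x y, 1 / c n * (Ioo (-b n) (b n)).indicator (fun y => κ' ((x - y) / c n)) y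
      ≤ M / c n := fun x y => by
    rw [div_eq_mul_one_div M, mul_comm M]
    refine mul_le_mul_of_nonneg_left ?_ (by positivity)
    by_cases hy : y ∈ Ioo (-b n) (b n)
    · simpa [hy] using hM _
    · simpa [hy] using hM0
  have hm₁0 : ∀ x, 0 ≤ m₁ x := fun x => integral_nonneg (hφ0 x)
  have hkm := measurable_kde_uncurry hm c b n
  have hjoint : Measurable fun z : (Fin n → ℝ) × ℝ => edist (kde κ' c b z.1 z.2) (m₁ z.2) :=
    hkm.edist (hm₁m.comp measurable_snd)
  -- replacing the kernel
  have hA : ∀ D : Fin n → ℝ, ∫⁻ x, edist (kde κ c b D x) (kde κ' c b D x)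
      ≤ ENNReal.ofReal (1 - ∫ x, κ' x) := fun D => by
    have hdi : Integrable fun x => κ x - κ' x := hκi.sub hκ'i
    have hd0 : ∀ x, 0 ≤ κ x - κ' x := fun x => sub_nonneg.2 (hle x)
    have hsub : ∀ x, kde κ c b D x - kde κ' c b D x = kde (fun x => κ x - κ' x) c b D x :=
      fun x => by
        simp only [kde, indicator_kernel_eq, ← mul_sub, ← Finset.sum_sub_distrib]
        simp only [indicator_kernel_eq (fun x => κ x - κ' x)]
    have h1 := integral_kde_le hdi hd0 hK.c_pos b D
    rw [integral_sub hκi hκ'i, hK.isDensity.integral_eq_one] at h1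
    calc _ = ∫⁻ x, ENNReal.ofReal (kde (fun x => κ x - κ' x) c b D x) :=
          lintegral_congr fun x => by
            rw [edist_dist, Real.dist_eq, hsub,
              abs_of_nonneg (kde_nonneg_of_nonneg hd0 hK.c_pos b D x)]
      _ = ENNReal.ofReal (∫ x, kde (fun x => κ x - κ' x) c b D x) :=
          (ofReal_integral_eq_lintegral_ofReal (integrable_kde_of_integrable hdi hK.c_pos b D)
            (Eventually.of_forall (kde_nonneg_of_nonneg hd0 hK.c_pos b D))).symm
      _ ≤ _ := ENNReal.ofReal_le_ofReal h1
  -- stochastic error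
  have hstoch : ∀ x, ∫⁻ D, edist (kde κ' c b D x) (m₁ x) ∂P
      ≤ ENNReal.ofReal (M / (n * c n * α)) * ENNReal.ofReal (m₁ x) + ENNReal.ofReal α := fun x => by
    have h1 := lintegral_edist_empirical_mean_le (densityLaw g)
      (measurable_truncated_kernel hm (c n) (b n) x) (hφ0 x) (hφM x) hn hα
    simp only [← kde_eq_empirical_mean] at h1
    refine h1.trans (le_of_eq ?_)
    change ENNReal.ofReal (M / c n / (n * α) * m₁ x + α) = _
    rw [ENNReal.ofReal_add (mul_nonneg (by positivity) (hm₁0 x)) hα.le,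
      ENNReal.ofReal_mul (by positivity)]
    congr 3
    field_simp
  have hmean : ∀ x, ∫⁻ D, ENNReal.ofReal (kde κ' c b D x) ∂P = ENNReal.ofReal (m₁ x) := fun x => by
    simp only [kde_eq_empirical_mean, Finset.mul_sum]
    have hin : ∀ i : Fin n, ∀ D : Fin n → ℝ, 0 ≤ 1 / (n : ℝ) * (1 / c n *
        (Ioo (-b n) (b n)).indicator (fun y => κ' ((x - y) / c n)) (D i)) := fun i D =>
      mul_nonneg (by positivity) (hφ0 x _)
    have hint : Integrable (fun y => 1 / c n *
        (Ioo (-b n) (b n)).indicator (fun y => κ' ((x - y) / c n)) y) (densityLaw g) :=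
      Integrable.of_bound (measurable_truncated_kernel hm (c n) (b n) x).aestronglyMeasurable
        (M / c n) (Eventually.of_forall fun y => by
          rw [Real.norm_of_nonneg (hφ0 x y)]; exact hφM x y)
    have heval : ∀ i : Fin n, Integrable (fun D : Fin n → ℝ => 1 / (n : ℝ) * (1 / c n *
        (Ioo (-b n) (b n)).indicator (fun y => κ' ((x - y) / c n)) (D i))) P := fun i =>
      (integrable_comp_eval (μ := fun _ : Fin n => densityLaw g) hint).const_mul _
    rw [← ofReal_integral_eq_lintegral_ofReal (integrable_finsetSum _ fun i _ => heval i)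
      (Eventually.of_forall fun D => Finset.sum_nonneg fun i _ => hin i D),
      integral_finsetSum _ fun i _ => heval i]
    congr 1
    have : ∀ i : Fin n, ∫ D : Fin n → ℝ, 1 / (n : ℝ) * (1 / c n *
        (Ioo (-b n) (b n)).indicator (fun y => κ' ((x - y) / c n)) (D i)) ∂P
        = 1 / n * m₁ x := fun i => by
      rw [integral_const_mul, integral_comp_eval (μ := fun _ : Fin n => densityLaw g)
        hint.aestronglyMeasurable]
      rfl
    simp only [this, Finset.sum_const, Finset.card_univ, Fintype.card_fin, nsmul_eq_mul]
    field_simp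
  have hm₁le : ∀ x, ENNReal.ofReal (m₁ x) ≤ ENNReal.ofReal (g x) + edist (m₁ x) (g x) := fun x => by
    rw [edist_dist, ← ENNReal.ofReal_add (hg.nonneg x) dist_nonneg]
    refine ENNReal.ofReal_le_ofReal ?_
    rw [Real.dist_eq]
    linarith [le_abs_self (m₁ x - g x)]
  have hgl : Measurable fun x => ENNReal.ofReal (g x) := hg.measurable.ennreal_ofReal
  have hel : Measurable fun x => edist (m₁ x) (g x) := hm₁m.edist hg.measurable
  have hadd : Measurable fun x => ENNReal.ofReal (g x) + edist (m₁ x) (g x) := hgl.add hel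
  -- On a bounded interval the variance bound is integrated directly; its constant part α costs the
  -- length 2R.
  have hin : ∫⁻ x in Icc (-R) R, ∫⁻ D, edist (kde κ' c b D x) (m₁ x) ∂P
      ≤ ENNReal.ofReal (M / (n * c n * α)) * (1 + bias)
        + ENNReal.ofReal α * ENNReal.ofReal (2 * R) := by
    calc _ ≤ ∫⁻ x in Icc (-R) R, ENNReal.ofReal (M / (n * c n * α)) * ENNReal.ofReal (m₁ x)
            + ENNReal.ofReal α := lintegral_mono hstoch
      _ = ENNReal.ofReal (M / (n * c n * α)) * (∫⁻ x in Icc (-R) R, ENNReal.ofReal (m₁ x))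
            + ENNReal.ofReal α * ENNReal.ofReal (2 * R) := by
          rw [lintegral_add_right _ measurable_const, lintegral_const_mul _ hm₁m.ennreal_ofReal,
            setLIntegral_const, Real.volume_Icc]
          congr 3
          ring
      _ ≤ _ := by
          gcongr
          calc _ ≤ ∫⁻ x, ENNReal.ofReal (m₁ x) := setLIntegral_le_lintegral _ _
            _ ≤ ∫⁻ x, ENNReal.ofReal (g x) + edist (m₁ x) (g x) := lintegral_mono hm₁le
            _ = _ := by rw [lintegral_add_left hgl, lintegral_ofReal_density hg]
  -- On the tails no cancellation is used: the error is at most the sum of the estimate and its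
  -- mean, both with integral governed by the tail of g and the bias.
  have hout : ∫⁻ x in (Icc (-R) R)ᶜ, ∫⁻ D, edist (kde κ' c b D x) (m₁ x) ∂P
      ≤ 2 * ((∫⁻ x in (Icc (-R) R)ᶜ, ENNReal.ofReal (g x)) + bias) := by
    have hpt : ∀ x, ∫⁻ D, edist (kde κ' c b D x) (m₁ x) ∂P
        ≤ 2 * (ENNReal.ofReal (g x) + edist (m₁ x) (g x)) := fun x => by
      calc _ ≤ ∫⁻ D, ENNReal.ofReal (kde κ' c b D x) + ENNReal.ofReal (m₁ x) ∂P := by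
            refine lintegral_mono fun D => ?_
            have hk0 := kde_nonneg_of_nonneg h0 hK.c_pos b D x
            rw [edist_dist, ← ENNReal.ofReal_add hk0 (hm₁0 x)]
            refine ENNReal.ofReal_le_ofReal ?_
            rw [Real.dist_eq]
            exact abs_le.2 ⟨by linarith [hm₁0 x], by linarith [hm₁0 x]⟩
        _ = 2 * ENNReal.ofReal (m₁ x) := by
            rw [lintegral_add_right _ measurable_const, hmean, lintegral_const, measure_univ,
              mul_one, two_mul]
        _ ≤ _ := by gcongr; exact hm₁le x
    calc _ ≤ ∫⁻ x in (Icc (-R) R)ᶜ, 2 * (ENNReal.ofReal (g x) + edist (m₁ x) (g x)) :=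
          lintegral_mono hpt
      _ = 2 * ((∫⁻ x in (Icc (-R) R)ᶜ, ENNReal.ofReal (g x))
            + ∫⁻ x in (Icc (-R) R)ᶜ, edist (m₁ x) (g x)) := by
          rw [lintegral_const_mul _ hadd, lintegral_add_left hgl]
      _ ≤ _ := by gcongr; exact setLIntegral_le_lintegral _ _
  calc _ ≤ ∫⁻ D, ((ENNReal.ofReal (1 - ∫ x, κ' x) + ∫⁻ x, edist (kde κ' c b D x) (m₁ x))
          + bias) ∂P := by
        refine lintegral_mono fun D => ?_
        have hmk : Measurable (kde κ' c b D) :=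
          hkm.comp (measurable_const.prodMk measurable_id)
        calc _ ≤ ∫⁻ x, (edist (kde κ c b D x) (kde κ' c b D x) + edist (kde κ' c b D x) (m₁ x))
              + edist (m₁ x) (g x) := lintegral_mono fun x => edist_triangle4 _ _ _ _
          _ = (∫⁻ x, edist (kde κ c b D x) (kde κ' c b D x))
              + (∫⁻ x, edist (kde κ' c b D x) (m₁ x)) + bias := by
              rw [lintegral_add_right _ hel, lintegral_add_right _ (hmk.edist hm₁m)]
          _ ≤ _ := by gcongr; exact hA D
    _ = ENNReal.ofReal (1 - ∫ x, κ' x)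
          + (∫⁻ x, ∫⁻ D, edist (kde κ' c b D x) (m₁ x) ∂P) + bias := by
        rw [lintegral_add_right _ measurable_const, lintegral_add_left measurable_const,
          lintegral_const, lintegral_const, measure_univ, mul_one, mul_one,
          lintegral_lintegral_swap hjoint.aemeasurable]
    _ ≤ _ := by
        gcongr
        rw [← lintegral_add_compl _ measurableSet_Icc]
        exact add_le_add hin hout

theorem tendsto_nat_mul_bandwidth (hK : KernelDesign κ c b) :
    Tendsto (fun n : ℕ => (n : ℝ) * c n) atTop atTop := by
  refine tendsto_atTop_mono' _ ?_ hK.c_one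
  filter_upwards [eventually_ge_atTop 1] with n hn
  have hn1 : (1 : ℝ) ≤ n := by exact_mod_cast hn
  refine mul_le_mul_of_nonneg_right ?_ (hK.c_pos n).le
  exact Real.sqrt_le_iff.2 ⟨by positivity, by nlinarith⟩

theorem tendsto_lintegral_edist_truncation (hg : IsDensity g) (hb : Tendsto b atTop atTop) :
    Tendsto (fun n => ∫⁻ x, edist ((Ioo (-b n) (b n)).indicator g x) (g x)) atTop (𝓝 0) := by
  have := tendsto_lintegral_of_dominated_convergence (μ := volume)
    (F := fun n x => edist ((Ioo (-b n) (b n)).indicator g x) (g x)) (f := fun _ => 0)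
    (fun x => ENNReal.ofReal (g x))
    (fun n => (hg.measurable.indicator measurableSet_Ioo).edist hg.measurable)
    (fun n => Eventually.of_forall fun x => ?_)
    (by rw [lintegral_ofReal_density hg]; exact ENNReal.one_ne_top)
    (Eventually.of_forall fun x => ?_)
  · simpa using this
  · by_cases hx : x ∈ Ioo (-b n) (b n)
    · simp [hx]
    · simp [hx, edist_dist, Real.dist_eq, abs_of_nonneg (hg.nonneg x)]
  · refine tendsto_const_nhds.congr' ?_
    filter_upwards [hb.eventually_gt_atTop |x|] with n hn
    have hx : x ∈ Ioo (-b n) (b n) := abs_lt.1 hn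
    simp [hx]

theorem exists_tail_le (hg : IsDensity g) {ε : ℝ≥0∞} (hε : 0 < ε) :
    ∃ R : ℝ, 0 < R ∧ ∫⁻ x in (Icc (-R) R)ᶜ, ENNReal.ofReal (g x) ≤ ε := by
  have := tendsto_lintegral_of_dominated_convergence (μ := volume)
    (F := fun (n : ℕ) => ((Icc (-(n : ℝ)) n)ᶜ).indicator fun x => ENNReal.ofReal (g x))
    (f := fun _ => 0) (fun x => ENNReal.ofReal (g x))
    (fun n => hg.measurable.ennreal_ofReal.indicator measurableSet_Icc.compl)
    (fun n => Eventually.of_forall fun x => indicator_le_self _ _ x)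
    (by rw [lintegral_ofReal_density hg]; exact ENNReal.one_ne_top)
    (Eventually.of_forall fun x => ?_)
  · simp only [lintegral_indicator measurableSet_Icc.compl, lintegral_zero] at this
    obtain ⟨n, hn, h1⟩ := ((ENNReal.tendsto_nhds_zero.1 this ε hε).and
      (eventually_ge_atTop 1)).exists
    exact ⟨n, by exact_mod_cast h1, hn⟩
  · refine tendsto_const_nhds.congr' ?_
    filter_upwards [tendsto_natCast_atTop_atTop.eventually_ge_atTop |x|] with n hn
    have hx : x ∈ Icc (-(n : ℝ)) n := abs_le.1 hn
    simp [hx]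

/-- A probability density is approximated from below in `L¹` by its truncations. -/
theorem exists_truncation (hκ : IsDensity κ) {ε : ℝ} (hε : 0 < ε) :
    ∃ M : ℝ, 0 ≤ M ∧ 1 - ∫ x, min (κ x) M ≤ ε := by
  have hκi := integrable_of_isDensity hκ
  have := tendsto_integral_of_dominated_convergence (μ := volume)
    (F := fun (n : ℕ) x => min (κ x) n) (f := κ) κ
    (fun n => (hκ.measurable.min measurable_const).aestronglyMeasurable) hκi
    (fun n => Eventually.of_forall fun x => by
      rw [Real.norm_of_nonneg (le_min (hκ.nonneg x) (by positivity))]; exact min_le_left _ _)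
    (Eventually.of_forall fun x => tendsto_const_nhds.congr' (by
      filter_upwards [tendsto_natCast_atTop_atTop.eventually_ge_atTop (κ x)] with n hn
      exact (min_eq_left hn).symm))
  rw [hκ.integral_eq_one] at this
  obtain ⟨n, hn⟩ := (Metric.tendsto_nhds.1 this ε hε).exists
  refine ⟨n, by positivity, ?_⟩
  rw [Real.dist_eq] at hn
  linarith [(abs_lt.1 hn).1]

/-- `L¹` consistency of the truncated kernel density estimator. -/
theorem tendsto_lintegral_edist_kde (hK : KernelDesign κ c b) (hg : IsDensity g) :
    Tendsto (fun n : ℕ => ∫⁻ D : Fin n → ℝ, (∫⁻ x, edist (kde κ c b D x) (g x))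
      ∂(Measure.pi fun _ => densityLaw g)) atTop (𝓝 0) := by
  rw [ENNReal.tendsto_nhds_zero]
  intro ε₀ hε₀
  -- The contributions below add up to 14ε + 3ε², which for ε ≤ 1 is at most 17ε; the factor 22
  -- leaves slack.
  obtain ⟨ε, hε, hε1, hεε⟩ : ∃ ε : ℝ, 0 < ε ∧ ε ≤ 1 ∧ ENNReal.ofReal (22 * ε) ≤ ε₀ := by
    rcases eq_or_ne ε₀ ⊤ with rfl | htop
    · exact ⟨1, one_pos, le_rfl, le_top⟩
    · have h := ENNReal.toReal_pos hε₀.ne' htop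
      refine ⟨min 1 (ε₀.toReal / 22), by positivity, min_le_left _ _, ?_⟩
      refine (ENNReal.ofReal_le_ofReal ?_).trans ENNReal.ofReal_toReal_le
      have := min_le_right 1 (ε₀.toReal / 22)
      linarith
  have hεpos : 0 < ENNReal.ofReal ε := ENNReal.ofReal_pos.2 hε
  -- The kernel may be unbounded, while the variance estimate needs a bound. Capping it at a level M
  -- costs L¹ mass at most ε uniformly in the data.
  obtain ⟨M, hM0, hM⟩ := exists_truncation hK.isDensity hε
  obtain ⟨R, hR0, hR⟩ := exists_tail_le hg hεpos
  obtain ⟨β, hβ0, hβ⟩ := hK.support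
  set κ' : ℝ → ℝ := fun x => min (κ x) M with hκ'
  have hκ'm : Measurable κ' := hK.isDensity.measurable.min measurable_const
  have hκ'0 : ∀ x, 0 ≤ κ' x := fun x => le_min (hK.isDensity.nonneg x) hM0
  have hκi := integrable_of_isDensity hK.isDensity
  have hκ'i : Integrable κ' := hκi.mono' hκ'm.aestronglyMeasurable
    (Eventually.of_forall fun x => by
      rw [Real.norm_of_nonneg (hκ'0 x)]; exact min_le_left _ _)
  have hκ'1 : ∫ x, κ' x ≤ 1 := by
    rw [← hK.isDensity.integral_eq_one]
    exact integral_mono hκ'i hκi fun x => min_le_left _ _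
  have hκ'β : ∀ x, κ' x ≠ 0 → |x| < β := fun x hx => by
    refine abs_lt.2 (hβ (Function.mem_support.2 fun h => hx ?_))
    simp [hκ', h, hM0]
  set α : ℝ := ε / (2 * R) with hα
  have hα0 : 0 < α := by positivity
  obtain ⟨d, hd, hdball⟩ := Metric.eventually_nhds_iff.1 (ENNReal.tendsto_nhds_zero.1
    (tendsto_lintegral_edist_translate hg.measurable (integrable_of_isDensity hg))
    (ENNReal.ofReal ε) hεpos)
  have hcβ : ∀ᶠ n in atTop, c n * β < d := by
    have := hK.c_tendsto.mul_const β
    rw [zero_mul] at this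
    exact this.eventually_lt_const hd
  have hMn : ∀ᶠ n : ℕ in atTop, M / (n * c n * α) ≤ ε := by
    filter_upwards [(tendsto_nat_mul_bandwidth hK).eventually_ge_atTop (M / (ε * α)),
      (tendsto_nat_mul_bandwidth hK).eventually_gt_atTop 0] with n h1 h2
    rw [div_le_iff₀ (by positivity)]
    rw [div_le_iff₀ (by positivity)] at h1
    linarith
  filter_upwards [hcβ, hMn, eventually_ge_atTop 1, ENNReal.tendsto_nhds_zero.1
    (tendsto_lintegral_edist_truncation hg hK.b_tendsto) (ENNReal.ofReal ε) hεpos]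
    with n h1 h2 hn h3
  have hbias : ∫⁻ x, edist (meanKde κ' (c n) (b n) g x) (g x) ≤ ENNReal.ofReal (3 * ε) := by
    refine (lintegral_edist_meanKde_le (t := b n) hκ'm hκ'0 (fun x => min_le_right _ M) hκ'i hκ'1
      hκ'β hg (hK.c_pos n) (δ := ENNReal.ofReal ε) fun s hs => ?_).trans ?_
    · refine hdball ?_
      rw [dist_zero_right, Real.norm_eq_abs]
      exact hs.trans h1
    · calc _ ≤ ENNReal.ofReal ε + ENNReal.ofReal ε + ENNReal.ofReal ε :=
            add_le_add (add_le_add (ENNReal.ofReal_le_ofReal hM) h3) le_rfl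
        _ = _ := by
          rw [← ENNReal.ofReal_add hε.le hε.le, ← ENNReal.ofReal_add (by positivity) hε.le]
          congr 1; ring
  refine (lintegral_edist_kde_le hK hg hκ'm hκ'0 (fun x => min_le_left _ _)
    (fun x => min_le_right _ M) hn R hα0).trans (le_trans ?_ hεε)
  calc _ ≤ ENNReal.ofReal ε + ((ENNReal.ofReal ε * (1 + ENNReal.ofReal (3 * ε))
          + ENNReal.ofReal α * ENNReal.ofReal (2 * R))
          + 2 * (ENNReal.ofReal ε + ENNReal.ofReal (3 * ε))) + ENNReal.ofReal (3 * ε) := by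
        gcongr
    _ = ENNReal.ofReal (ε + ((ε * (1 + 3 * ε) + α * (2 * R)) + 2 * (ε + 3 * ε)) + 3 * ε) := by
        have h2' : (2 : ℝ≥0∞) = ENNReal.ofReal 2 := by simp
        have h1' : (1 : ℝ≥0∞) = ENNReal.ofReal 1 := by simp
        rw [h2', h1']
        repeat rw [← ENNReal.ofReal_mul (by positivity)]
        repeat rw [← ENNReal.ofReal_add (by positivity) (by positivity)]
        rw [← ENNReal.ofReal_mul (by positivity), ← ENNReal.ofReal_mul (by positivity)]
        repeat rw [← ENNReal.ofReal_add (by positivity) (by positivity)]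
    _ ≤ _ := by
        refine ENNReal.ofReal_le_ofReal ?_
        have : α * (2 * R) = ε := by rw [hα]; field_simp
        rw [this]
        nlinarith

/-- Consistency of the root density estimate in probability. -/
theorem tendsto_measure_root_kde (hK : KernelDesign κ c b) (hg : IsDensity g) {δ : ℝ} (hδ : 0 < δ) :
    Tendsto (fun n : ℕ => (Measure.pi fun _ : Fin n => densityLaw g)
      {D | δ < ∫ x, (√(kde κ c b D x) - √(g x)) ^ 2}) atTop (𝓝 0) := by
  -- Markov's inequality for the L¹ error, which dominates the squared L² distance of the roots
  -- because (√a - √b)² ≤ |a - b|.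
  have hlim := ENNReal.Tendsto.div_const (tendsto_lintegral_edist_kde hK hg)
    (b := ENNReal.ofReal δ) (Or.inr (ENNReal.ofReal_pos.2 hδ).ne')
  rw [ENNReal.zero_div] at hlim
  refine tendsto_of_tendsto_of_tendsto_of_le_of_le tendsto_const_nhds hlim (fun _ => zero_le)
    fun n => ?_
  have := isProbabilityMeasure_densityLaw hg
  have hm : Measurable fun D : Fin n → ℝ => ∫⁻ x, edist (kde κ c b D x) (g x) :=
    Measurable.lintegral_prod_right' (f := fun z : (Fin n → ℝ) × ℝ =>
      edist (kde κ c b z.1 z.2) (g z.2))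
      ((measurable_kde_uncurry hK.isDensity.measurable c b n).edist
        (hg.measurable.comp measurable_snd))
  refine (measure_mono fun D hD => ?_).trans (meas_ge_le_lintegral_div hm.aemeasurable
    (ENNReal.ofReal_pos.2 hδ).ne' ENNReal.ofReal_ne_top)
  have hD' : δ < ∫ x, (√(kde κ c b D x) - √(g x)) ^ 2 := hD
  have hi : Integrable fun x => (√(kde κ c b D x) - √(g x)) ^ 2 :=
    integrable_sq_sub (measurable_kde hK D).sqrt hg.measurable.sqrt
      (integrable_sq_sqrt (kde_nonneg hK D) (integrable_kde hK D))
      (integrable_sq_sqrt hg.nonneg (integrable_of_isDensity hg))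
  show ENNReal.ofReal δ ≤ _
  calc _ ≤ ENNReal.ofReal (∫ x, (√(kde κ c b D x) - √(g x)) ^ 2) :=
        ENNReal.ofReal_le_ofReal hD'.le
    _ = ∫⁻ x, ENNReal.ofReal ((√(kde κ c b D x) - √(g x)) ^ 2) :=
        ofReal_integral_eq_lintegral_ofReal hi (Eventually.of_forall fun x => sq_nonneg _)
    _ ≤ _ := lintegral_mono fun x => by
        rw [edist_dist, Real.dist_eq]
        refine ENNReal.ofReal_le_ofReal ?_
        have h := abs_sqrt_sub_sqrt_le (kde_nonneg hK D x) (hg.nonneg x)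
        rw [← sq_abs]
        calc _ ≤ √|kde κ c b D x - g x| ^ 2 := pow_le_pow_left₀ (abs_nonneg _) h 2
          _ = _ := Real.sq_sqrt (abs_nonneg _)

end PMHDE

/-! ### Noise concentration, perturbed contraction, and rates. -/

namespace PMHDE

variable {m : ℕ}

/-- Gaussian concentration of the norm, from the exponential moment of `‖z‖² / 4`. -/
theorem stdGaussian_lt_norm_le (m : ℕ) (t : ℝ) (ht : 0 ≤ t) :
    stdGaussian (E m) {z | t < ‖z‖}
      ≤ ENNReal.ofReal ((2 : ℝ) ^ (m / 2 : ℝ) * Real.exp (-(t ^ 2 / 4))) := by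
  have hF : Measurable fun z : E m => ENNReal.ofReal (Real.exp (‖z‖ ^ 2 / 4)) := by fun_prop
  -- The Gaussian exponent -1/2 plus 1/4 leaves -1/4, so the normalizing integral grows by the
  -- factor 2^{m/2}.
  have hmom : ∫⁻ z, ENNReal.ofReal (Real.exp (‖z‖ ^ 2 / 4)) ∂(stdGaussian (E m))
      = ENNReal.ofReal ((2 : ℝ) ^ (m / 2 : ℝ)) := by
    have h1 := lintegral_stdGaussian_comp (m := m) one_ne_zero 0 hF
    simp only [one_smul, zero_add, sub_zero] at h1
    rw [h1]
    have h2 : ∀ y : E m, ENNReal.ofReal (gaussianDensity m 1 y)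
        * ENNReal.ofReal (Real.exp (‖y‖ ^ 2 / 4))
        = ENNReal.ofReal (((2 * Real.pi) ^ (m / 2 : ℝ))⁻¹ * Real.exp (-(1 / 4) * ‖y‖ ^ 2)) :=
      fun y => by
        rw [← ENNReal.ofReal_mul (gaussianDensity_nonneg _ _), gaussianDensity, mul_assoc,
          ← Real.exp_add]
        congr 3
        · norm_num
        · ring
    simp only [h2]
    rw [← ofReal_integral_eq_lintegral_ofReal
      ((integrable_exp_neg_mul_sq_norm (by norm_num)).const_mul _)
      (Eventually.of_forall fun y => by positivity), integral_const_mul,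
      integral_exp_neg_mul_sq_norm (by norm_num),
      show Real.pi / (1 / 4) = 2 * Real.pi * 2 by ring,
      Real.mul_rpow (x := 2 * Real.pi) (by positivity) (by norm_num),
      inv_mul_cancel_left₀ (by positivity)]
  calc _ ≤ stdGaussian (E m) {z | ENNReal.ofReal (Real.exp (t ^ 2 / 4))
          ≤ ENNReal.ofReal (Real.exp (‖z‖ ^ 2 / 4))} := by
        refine measure_mono fun z (hz : t < ‖z‖) => ENNReal.ofReal_le_ofReal ?_
        gcongr
    _ ≤ (∫⁻ z, ENNReal.ofReal (Real.exp (‖z‖ ^ 2 / 4)) ∂(stdGaussian (E m)))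
          / ENNReal.ofReal (Real.exp (t ^ 2 / 4)) :=
        meas_ge_le_lintegral_div hF.aemeasurable
          (ENNReal.ofReal_pos.2 (Real.exp_pos _)).ne' ENNReal.ofReal_ne_top
    _ = _ := by
        rw [hmom, ← ENNReal.ofReal_div_of_pos (Real.exp_pos _), Real.exp_neg, div_eq_mul_inv]

theorem noiseLaw_exists_lt_norm_le (m K : ℕ) (t : ℝ) (ht : 0 ≤ t) :
    noiseLaw m {z | ∃ k < K, t < ‖z k‖}
      ≤ ENNReal.ofReal (K * ((2 : ℝ) ^ (m / 2 : ℝ) * Real.exp (-(t ^ 2 / 4)))) := by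
  have hS : MeasurableSet {z : E m | t < ‖z‖} := measurableSet_lt measurable_const measurable_norm
  have heq : {z : ℕ → E m | ∃ k < K, t < ‖z k‖}
      = ⋃ k ∈ Finset.range K, (fun z : ℕ → E m => z k) ⁻¹' {z | t < ‖z‖} := by
    ext z; simp
  rw [heq]
  calc _ ≤ ∑ k ∈ Finset.range K, noiseLaw m ((fun z : ℕ → E m => z k) ⁻¹' {z | t < ‖z‖}) :=
        measure_biUnion_finset_le _ _
    _ ≤ ∑ _k ∈ Finset.range K,
          ENNReal.ofReal ((2 : ℝ) ^ (m / 2 : ℝ) * Real.exp (-(t ^ 2 / 4))) :=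
        Finset.sum_le_sum fun k _ => by
          rw [noiseLaw, (measurePreserving_eval_infinitePi (fun _ : ℕ => stdGaussian (E m)) k
            ).measure_preimage hS.nullMeasurableSet]
          exact stdGaussian_lt_norm_le m t ht
    _ = _ := by
        rw [Finset.sum_const, Finset.card_range, nsmul_eq_mul,
          ENNReal.ofReal_mul (Nat.cast_nonneg K), ENNReal.ofReal_natCast]

/-- From log(1 - u) ≤ -u. At level ε/K per step the noise is thus of order √(K/ε), which is where √K
and 1/√ε in the rate come from. -/
theorem noiseScale_le {x y : ℝ} (hy : 0 < y) (hyx : y ≤ x) (hx2 : x < 2) :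
    noiseScale x ≤ 1 / 2 * √(1 / y) := by
  have h1 : Real.log (1 - 1 / 2 * x) ≤ -(1 / 2 * x) := by
    have := Real.log_le_sub_one_of_pos (x := 1 - 1 / 2 * x) (by linarith)
    linarith
  have h2 : 1 / 2 * √(1 / y) = √(1 / (4 * y)) := by
    rw [show 1 / (4 * y) = (1 / 2) ^ 2 * (1 / y) by field_simp; norm_num,
      Real.sqrt_mul (by positivity), Real.sqrt_sq (by norm_num)]
  rw [h2, noiseScale]
  refine Real.sqrt_le_sqrt (one_div_le_one_div_of_le (by positivity) ?_)
  linarith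

/-- Perturbed fixed-point iteration for a map contracting towards `θs`. -/
theorem norm_noisyGD_sub_le {G : E m → E m} {η σ t ρ R : ℝ} {θ₀ θs : E m} {z : ℕ → E m} {K : ℕ}
    (hη : 0 ≤ η) (hσ : 0 ≤ σ) (ht : 0 ≤ t) (hρ0 : 0 ≤ ρ) (hρ1 : ρ < 1)
    (hG : ∀ θ, ‖θ - θs‖ ≤ R → ‖θ - θs - η • G θ‖ ≤ ρ * ‖θ - θs‖) (h0 : ‖θ₀ - θs‖ ≤ R)
    (hz : ∀ k < K, ‖z k‖ ≤ t) (hsmall : η * σ * t ≤ (1 - ρ) * R) :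
    ‖noisyGD G η σ θ₀ z K - θs‖ ≤ ρ ^ K * R + η * σ * t / (1 - ρ) := by
  have hρ : 0 < 1 - ρ := by linarith
  have hstep : ∀ k < K, ‖noisyGD G η σ θ₀ z k - θs‖ ≤ R →
      ‖noisyGD G η σ θ₀ z (k + 1) - θs‖ ≤ ρ * ‖noisyGD G η σ θ₀ z k - θs‖ + η * σ * t := by
    intro k hk hR
    rw [noisyGD]
    set θ := noisyGD G η σ θ₀ z k
    calc _ = ‖(θ - θs - η • G θ) - (η * σ) • z k‖ := by
          congr 1; rw [smul_add, smul_smul]; abel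
      _ ≤ ‖θ - θs - η • G θ‖ + ‖(η * σ) • z k‖ := norm_sub_le _ _
      _ ≤ _ := by
          rw [norm_smul, Real.norm_of_nonneg (by positivity)]
          exact add_le_add (hG θ hR) (mul_le_mul_of_nonneg_left (hz k hk) (by positivity))
  have hind : ∀ k ≤ K, ‖noisyGD G η σ θ₀ z k - θs‖ ≤ R ∧
      ‖noisyGD G η σ θ₀ z k - θs‖ ≤ ρ ^ k * R + η * σ * t / (1 - ρ) := by
    intro k
    induction k with
    | zero =>
      intro _
      refine ⟨h0, ?_⟩
      have : 0 ≤ η * σ * t / (1 - ρ) := by positivity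
      simpa [noisyGD] using h0.trans (by linarith)
    | succ k ih =>
      intro hk
      obtain ⟨i1, i2⟩ := ih (by omega)
      have hs := hstep k (by omega) i1
      -- The ball of radius R is preserved because ρR plus noise at most (1 - ρ)R is at most R,
      -- which keeps the contraction available at the next step.
      refine ⟨hs.trans ?_, hs.trans ?_⟩
      · nlinarith
      · have hfix : ρ * (η * σ * t / (1 - ρ)) + η * σ * t = η * σ * t / (1 - ρ) := by
          field_simp
          ring
        calc _ ≤ ρ * (ρ ^ k * R + η * σ * t / (1 - ρ)) + η * σ * t := by gcongr
          _ = ρ ^ (k + 1) * R + (ρ * (η * σ * t / (1 - ρ)) + η * σ * t) := by ring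
          _ = _ := by rw [hfix]
  exact (hind K le_rfl).2

variable {Θ : Set (E m)} {f : E m → ℝ → ℝ} {p q : ℝ}

/-- On the event that the root density estimate is close to its target and that the noise is
bounded, private gradient descent is close to the minimum Hellinger distance estimator. -/
theorem RegularFamily.exists_norm_pgd_sub_le (hf : RegularFamily Θ f p q) :
    ∃ ε₀ η ρ : ℝ, 0 < ε₀ ∧ 0 < η ∧ 0 < ρ ∧ ρ < 1 ∧
      ∀ (κ : ℝ → ℝ) (c b : ℕ → ℝ), KernelDesign κ c b → ∀ π : E m → E m, IsRetraction Θ π →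
      ∀ (g : ℝ → ℝ) (θg : E m), IsDensity g → IsTarget Θ f g θg → hdSq (f θg) g < ε₀ →
      ∃ r > 0, ∃ δ > 0, ∀ (n : ℕ) (D : Fin n → ℝ) (θs : E m), IsMHDE Θ f κ c b D θs →
        ∫ x, (√(kde κ c b D x) - √(g x)) ^ 2 ≤ δ → ∀ θ₀ : E m, ‖θ₀ - θg‖ ≤ r →
        ∀ (Δ x t : ℝ) (K : ℕ) (z : ℕ → E m), 0 ≤ Δ → 0 ≤ t → (∀ k < K, ‖z k‖ ≤ t) →
          η * (Δ * noiseScale x) * t ≤ (1 - ρ) * (2 * r) →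
          ‖pgd Θ f κ c b π η Δ x θ₀ K D z - θs‖
            ≤ ρ ^ K * (2 * r) + η * (Δ * noiseScale x) * t / (1 - ρ) := by
  obtain ⟨ε₁, η, ρ, hε₁, hη, hρ0, hρ1, hcontr⟩ := hf.exists_gradient_contraction
  -- Passing from γ to √f_{θ_g} through √g with (a + b)² ≤ 2a² + 2b² makes two errors of ε₁/4 add up
  -- to ε₁.
  refine ⟨ε₁ / 4, η, ρ, by positivity, hη, hρ0, hρ1, fun κ c b hK π hπ g θg hg ht hclose => ?_⟩
  obtain ⟨R, hR, hRΘ, hRc⟩ := hcontr θg ht.mem_interior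
  obtain ⟨ε₂, hε₂, hmin⟩ := hf.exists_norm_sub_le_of_isMHDE hK hg ht (δ := R / 4) (by positivity)
  have hΘg := interior_subset ht.mem_interior
  -- The MHDE and the initial value are each within R/4 of θ_g, so the start is within 2(R/4) of the
  -- MHDE; points that close to the MHDE are within 3R/4 of θ_g, inside the contraction ball.
  refine ⟨R / 4, by positivity, min (ε₁ / 4) ε₂, by positivity,
    fun n D θs hθs hD θ₀ hθ₀ Δ x t K z hΔ ht0 hz hsmall => ?_⟩
  have hθsg : ‖θs - θg‖ ≤ R / 4 := hmin n D θs (hD.trans (min_le_right _ _)) hθs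
  have hθsint : θs ∈ interior Θ := by
    refine mem_interior.2 ⟨Metric.ball θg R, Metric.ball_subset_closedBall.trans hRΘ,
      Metric.isOpen_ball, ?_⟩
    rw [Metric.mem_ball, dist_eq_norm]
    linarith
  have hzero := hf.gradLoss_eq_zero_of_isMHDE hK hθs hθsint
  set γ : ℝ → ℝ := fun x => √(kde κ c b D x) with hγ
  have hγm : Measurable γ := (measurable_kde hK D).sqrt
  have hγ2 : Integrable fun x => γ x ^ 2 :=
    integrable_sq_sqrt (kde_nonneg hK D) (integrable_kde hK D)
  have hgm : Measurable fun x => √(g x) := hg.measurable.sqrt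
  have hg2 := integrable_sq_sqrt hg.nonneg (integrable_of_isDensity hg)
  have hfm : Measurable fun x => √(f θg x) := (hf.measurable_density hΘg).sqrt
  have hγf : ∫ x, (γ x - √(f θg x)) ^ 2 ≤ ε₁ := by
    have i1 := (integrable_sq_sub hγm hgm hγ2 hg2).const_mul 2
    have i2 := (integrable_sq_sub hfm hgm (hf.integrable_sq_rootDensity hΘg) hg2).const_mul 2
    calc _ ≤ ∫ x, 2 * (γ x - √(g x)) ^ 2 + 2 * (√(f θg x) - √(g x)) ^ 2 := by
          refine integral_mono (integrable_sq_sub hγm hfm hγ2 (hf.integrable_sq_rootDensity hΘg))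
            (i1.add i2) fun x => ?_
          dsimp only
          nlinarith [sq_nonneg ((γ x - √(g x)) + (√(f θg x) - √(g x)))]
      _ = 2 * (∫ x, (γ x - √(g x)) ^ 2) + 2 * hdSq (f θg) g := by
          rw [integral_add i1 i2, integral_const_mul, integral_const_mul, hdSq]
      _ ≤ _ := by
          have := hD.trans (min_le_left _ _)
          linarith
  have hgrad : ∀ θ, gradLoss Θ f κ c b D θ = WithLp.toLp 2 (weightedScore Θ f γ θ) := fun θ => by
    ext i; rw [gradLoss_apply]
  have hball : ∀ θ : E m, ‖θ - θs‖ ≤ 2 * (R / 4) → θ ∈ Metric.closedBall θg R := fun θ hθ => by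
    rw [Metric.mem_closedBall, dist_eq_norm]
    have := norm_sub_le_norm_sub_add_norm_sub θ θs θg
    linarith
  refine norm_noisyGD_sub_le hη.le (mul_nonneg hΔ (Real.sqrt_nonneg _)) ht0 hρ0.le hρ1
    (fun θ hθ => ?_) ?_ hz hsmall
  · have hθb := hball θ hθ
    have := hRc γ hγm hγ2 hγf θs (hball θs (by simp; positivity)) θ hθb
    rw [← hgrad, ← hgrad, hzero, sub_zero] at this
    rwa [hπ.eq_self θ (hRΘ hθb)]
  · have := norm_sub_le_norm_sub_add_norm_sub θ₀ θg θs
    rw [norm_sub_rev θg θs] at this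
    linarith

/-- Rates: the noise level is eventually small, and the geometric term is negligible. -/
theorem eventually_rates {p A ε r η ρ ξ : ℝ} {Δ x : ℕ → ℝ} {K : ℕ → ℕ} (hp1 : 1 < p) (hA : 0 < A)
    (hε : 0 < ε) (hr : 0 < r) (hη : 0 < η) (hρ0 : 0 < ρ) (hρ1 : ρ < 1) (hξ : 0 < ξ) (hξ1 : ξ < 1)
    (hΔ : ∀ n : ℕ, 1 ≤ n → 0 ≤ Δ n ∧ Δ n ≤ A * (n : ℝ) ^ (-(1 / p)))
    (hK : ∀ n : ℕ, 1 ≤ n → (-Real.log ρ)⁻¹ * Real.log n ≤ K n)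
    (hlim : Tendsto (fun n : ℕ => (n : ℝ) ^ (-(1 / p)) * √(K n * Real.log (K n))) atTop (𝓝 0))
    (hx : ∀ n : ℕ, 1 ≤ n → x n < 2 ∧ ε / K n ≤ x n) (B : ℝ) :
    ∀ᶠ n : ℕ in atTop, B ≤ K n ∧ 1 ≤ Real.log (K n) ∧
      (n : ℝ) ^ (-(1 / p)) * √(K n * Real.log (K n / ξ))
        ≤ √2 * ((n : ℝ) ^ (-(1 / p)) * √(K n * Real.log (K n))) ∧
      η * (Δ n * noiseScale (x n)) * √(8 * Real.log (K n / ξ)) ≤ (1 - ρ) * (2 * r) ∧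
      ρ ^ K n * (2 * r) + η * (Δ n * noiseScale (x n)) * √(8 * Real.log (K n / ξ)) / (1 - ρ)
        ≤ (1 + 2 * η / (1 - ρ)) * (A / √ε) * (n : ℝ) ^ (-(1 / p))
          * √(K n * Real.log (K n / ξ)) := by
  have hlog : 0 < -Real.log ρ := neg_pos.2 (Real.log_neg hρ0 hρ1)
  have hρ : 0 < 1 - ρ := by linarith
  have hsε : 0 < √ε := Real.sqrt_pos.2 hε
  have hKlim : Tendsto (fun n => (K n : ℝ)) atTop atTop :=
    tendsto_atTop_mono' _ ((eventually_ge_atTop 1).mono hK)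
      ((Real.tendsto_log_atTop.comp tendsto_natCast_atTop_atTop).const_mul_atTop (by positivity))
  have hloglim := Real.tendsto_log_atTop.comp hKlim
  -- The geometric term is of order 1/n by the choice of K_n, and p > 1 makes this negligible
  -- against n^{-1/p}.
  have hpow : Tendsto (fun n : ℕ => 2 * r * (n : ℝ) ^ (-(1 - 1 / p))) atTop (𝓝 0) := by
    have h1 : 0 < 1 - 1 / p := by
      rw [sub_pos, div_lt_one (by linarith)]; exact hp1
    simpa using ((tendsto_rpow_neg_atTop h1).comp tendsto_natCast_atTop_atTop).const_mul (2 * r)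
  have hlim2 := hlim.const_mul (2 * η * (A / √ε) * √2)
  rw [mul_zero] at hlim2
  filter_upwards [hKlim.eventually_ge_atTop B, hKlim.eventually_ge_atTop (1 / ξ),
    hKlim.eventually_ge_atTop 1, hloglim.eventually_ge_atTop 1, eventually_ge_atTop 1,
    hpow.eventually_le_const (show 0 < A / √ε by positivity),
    hlim2.eventually_le_const (show 0 < (1 - ρ) * (2 * r) by positivity)]
    with n hB hKξ hK1 hL hn hpn hsn
  simp only [Function.comp_apply] at hL
  have hn0 : (0 : ℝ) < n := by exact_mod_cast hn
  have hK0 : (0 : ℝ) < K n := by linarith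
  set T : ℝ := (n : ℝ) ^ (-(1 / p)) with hT
  have hT0 : 0 < T := Real.rpow_pos_of_pos hn0 _
  have hLξ : Real.log (K n / ξ) = Real.log (K n) + Real.log (1 / ξ) := by
    rw [← Real.log_mul hK0.ne' (by positivity), mul_one_div]
  have hLξ1 : 0 < Real.log (1 / ξ) := Real.log_pos (by rw [lt_div_iff₀ hξ]; linarith)
  have hLξ2 : Real.log (1 / ξ) ≤ Real.log (K n) := Real.log_le_log (by positivity) hKξ
  -- Once K_n ≥ 1/ξ, log(K_n/ξ) is at most 2 log K_n; hence the factor √2 in passing to the ξ-free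
  -- rate.
  have hsq : √(K n * Real.log (K n / ξ)) ≤ √2 * √(K n * Real.log (K n)) := by
    rw [← Real.sqrt_mul (by norm_num)]
    refine Real.sqrt_le_sqrt ?_
    rw [hLξ]; nlinarith
  have h3 : T * √(K n * Real.log (K n / ξ)) ≤ √2 * (T * √(K n * Real.log (K n))) := by
    calc _ ≤ T * (√2 * √(K n * Real.log (K n))) := by gcongr
      _ = _ := by ring
  set Q : ℝ := (A / √ε) * T * √(K n * Real.log (K n / ξ)) with hQ
  have hns : noiseScale (x n) ≤ 1 / 2 * (√(K n) / √ε) := by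
    have := noiseScale_le (y := ε / K n) (by positivity) (hx n hn).2 (hx n hn).1
    rwa [one_div_div, Real.sqrt_div hK0.le] at this
  have hnoise : η * (Δ n * noiseScale (x n)) * √(8 * Real.log (K n / ξ)) ≤ 2 * η * Q := by
    have h8 : √(8 * Real.log (K n / ξ)) ≤ 4 * √(Real.log (K n / ξ)) := by
      have h84 : √8 ≤ 4 := Real.sqrt_le_iff.2 ⟨by norm_num, by norm_num⟩
      rw [Real.sqrt_mul (by norm_num)]
      gcongr
    calc _ ≤ η * ((A * T) * (1 / 2 * (√(K n) / √ε))) * (4 * √(Real.log (K n / ξ))) := by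
          have := (hΔ n hn).1
          have h4 := (hΔ n hn).2
          have h5 : 0 ≤ noiseScale (x n) := Real.sqrt_nonneg _
          gcongr
      _ = _ := by
          rw [hQ, Real.sqrt_mul hK0.le]
          ring
  have hQ0 : 0 ≤ Q := by positivity
  refine ⟨hB, hL, h3, hnoise.trans ?_, ?_⟩
  · refine le_trans ?_ hsn
    calc _ = 2 * η * (A / √ε) * (T * √(K n * Real.log (K n / ξ))) := by rw [hQ]; ring
      _ ≤ 2 * η * (A / √ε) * (√2 * (T * √(K n * Real.log (K n)))) := by gcongr
      _ = _ := by ring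
  · have hgeo : ρ ^ K n * (2 * r) ≤ Q := by
      have h1 : ρ ^ K n ≤ (n : ℝ)⁻¹ := by
        rw [← Real.log_le_log_iff (by positivity) (by positivity), Real.log_pow, Real.log_inv]
        have := hK n hn
        rw [inv_mul_le_iff₀ hlog] at this
        linarith
      have h2 : 1 ≤ √(K n * Real.log (K n / ξ)) := by
        rw [Real.one_le_sqrt]
        nlinarith
      calc _ ≤ (n : ℝ)⁻¹ * (2 * r) := by gcongr
        _ = 2 * r * (n : ℝ) ^ (-(1 - 1 / p)) * T := by
            rw [mul_assoc, hT, ← Real.rpow_add hn0, show -(1 - 1 / p) + -(1 / p) = -1 by ring,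
              Real.rpow_neg_one, mul_comm]
        _ ≤ A / √ε * T * 1 := by rw [mul_one]; gcongr
        _ ≤ Q := by rw [hQ]; gcongr
    calc _ ≤ Q + 2 * η * Q / (1 - ρ) := by gcongr
      _ = _ := by rw [hQ]; ring

end PMHDE

/-! ### Assembly of the three statements. -/

namespace PMHDE

/-- A union bound over a sample event and a noise event. -/
theorem sampleNoiseLaw_le {m n : ℕ} {g : ℝ → ℝ} (hg : IsDensity g)
    {S : Set ((Fin n → ℝ) × (ℕ → E m))}
    {U : Set (Fin n → ℝ)} {V : Set (ℕ → E m)} {u v : ℝ≥0∞}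
    (hU : (Measure.pi fun _ : Fin n => densityLaw g) U ≤ u) (hV : noiseLaw m V ≤ v)
    (hS : ∀ ω ∈ S, ω.1 ∈ U ∨ ω.2 ∈ V) : sampleNoiseLaw m n g S ≤ u + v := by
  have := isProbabilityMeasure_densityLaw hg
  change ((Measure.pi fun _ : Fin n => densityLaw g).prod (noiseLaw m)) S ≤ u + v
  calc _ ≤ ((Measure.pi fun _ : Fin n => densityLaw g).prod (noiseLaw m))
          (U ×ˢ univ ∪ univ ×ˢ V) := measure_mono fun ω hω => by simpa using hS ω hω
    _ ≤ _ := measure_union_le _ _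
    _ ≤ _ := by
        rw [Measure.prod_prod, Measure.prod_prod, measure_univ, measure_univ, mul_one, one_mul]
        exact add_le_add hU hV

end PMHDE

theorem theorem3 {m : ℕ} (Θ : Set (E m)) (f : E m → ℝ → ℝ) (p₀ q₀ : ℝ)
    (hf : RegularFamily Θ f p₀ q₀) :
    -- privacy
    (∀ (κ : ℝ → ℝ) (c b : ℕ → ℝ), KernelDesign κ c b →
      ∀ π : E m → E m, IsRetraction Θ π →
      ∀ ε : ℝ, 0 < ε → ε < 2 →
      ∀ (n K : ℕ) (η Δ x : ℝ) (θ₀ : E m), 0 < η → 0 ≤ Δ →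
        sensitivity Θ f κ c b n ≤ ENNReal.ofReal Δ → 0 < x → x < 2 → hComp x K ≤ ε →
        IsHDP (n := n) ε (noiseLaw m) (fun D z => pgd Θ f κ c b π η Δ x θ₀ K D z)) ∧
    -- the sensitivity is of order `n ^ (-1/p)` for some `p`
    (∃ p : ℝ, 1 < p ∧ p < 2 ∧ ∀ (κ : ℝ → ℝ) (c b : ℕ → ℝ), KernelDesign κ c b →
      ∃ A : ℝ, 0 < A ∧ ∀ n : ℕ, 1 ≤ n →
        sensitivity Θ f κ c b n ≤ ENNReal.ofReal (A * (n : ℝ) ^ (-(1 / p)))) ∧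
    -- utility
    (∃ ε₀ η c₁ c₂ : ℝ, 0 < ε₀ ∧ 0 < η ∧ 0 < c₁ ∧ 0 < c₂ ∧
      ∀ (κ : ℝ → ℝ) (c b : ℕ → ℝ), KernelDesign κ c b →
      ∀ π : E m → E m, IsRetraction Θ π →
      ∀ (g : ℝ → ℝ) (θg : E m) (a : ℕ → ℝ), IsDensity g → IsTarget Θ f g θg →
        CentralConditions Θ f κ c θg a → hdSq (f θg) g < ε₀ →
      ∃ r : ℝ, 0 < r ∧
        ∀ p A ε : ℝ, 1 < p → p ≤ 2 → 0 < A → 0 < ε → ε < 2 →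
        ∀ (Δ : ℕ → ℝ) (x : ℕ → ℝ) (K : ℕ → ℕ) (θhat : (n : ℕ) → (Fin n → ℝ) → E m),
          (∀ n : ℕ, 1 ≤ n → sensitivity Θ f κ c b n ≤ ENNReal.ofReal (Δ n) ∧ 0 ≤ Δ n ∧
            Δ n ≤ A * (n : ℝ) ^ (-(1 / p))) →
          (∀ n : ℕ, 1 ≤ n → c₁ * Real.log n ≤ K n) →
          Tendsto (fun n : ℕ => (n : ℝ) ^ (-(1 / p)) * √(K n * Real.log (K n))) atTop (𝓝 0) →
          (∀ n : ℕ, 1 ≤ n → 0 < x n ∧ x n < 2 ∧ ε / K n ≤ x n ∧ hComp (x n) (K n) ≤ ε) →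
          (∀ n : ℕ, 1 ≤ n → ∀ D : Fin n → ℝ, IsMHDE Θ f κ c b D (θhat n D)) →
          (∀ ξ : ℝ, 0 < ξ → ξ < 1 → ∃ N : ℕ, ∀ n > N, ∀ θ₀ : E m, ‖θ₀ - θg‖ ≤ r →
            sampleNoiseLaw m n g {ω |
              c₂ * (A / √ε) * (n : ℝ) ^ (-(1 / p)) * √(K n * Real.log (K n / ξ)) <
                ‖pgd Θ f κ c b π η (Δ n) (x n) θ₀ (K n) ω.1 ω.2 - θhat n ω.1‖}
              ≤ ENNReal.ofReal ξ) ∧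
          (∀ ξ : ℝ, 0 < ξ → ξ < 1 → ∃ (M : ℝ) (N : ℕ), ∀ n > N, ∀ θ₀ : E m, ‖θ₀ - θg‖ ≤ r →
            sampleNoiseLaw m n g {ω |
              M * ((n : ℝ) ^ (-(1 / p)) * √(K n * Real.log (K n))) <
                ‖pgd Θ f κ c b π η (Δ n) (x n) θ₀ (K n) ω.1 ω.2 - θhat n ω.1‖}
              ≤ ENNReal.ofReal ξ)) := by
  refine ⟨fun κ c b hK π hπ ε hε hε2 n K η Δ x θ₀ hη hΔ hS hx0 hx2 hcomp =>
    hf.isHDP_pgd hK hπ hε θ₀ hη hΔ hS hx0 hx2 hcomp, hf.exists_sensitivity_le, ?_⟩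
  obtain ⟨ε₀, η, ρ, hε₀, hη, hρ0, hρ1, hmain⟩ := hf.exists_norm_pgd_sub_le
  have hlog : 0 < -Real.log ρ := neg_pos.2 (Real.log_neg hρ0 hρ1)
  have hρ : 0 < 1 - ρ := by linarith
  -- The first constant gives ρ^{K_n} ≤ 1/n. In the second, 1 pays for the geometric term and 2η/(1
  -- - ρ) for the accumulated noise.
  refine ⟨ε₀, η, (-Real.log ρ)⁻¹, 1 + 2 * η / (1 - ρ), hε₀, hη, by positivity, by positivity,
    fun κ c b hK π hπ g θg a hg ht _ hclose => ?_⟩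
  obtain ⟨r, hr, δ, hδ, hpgd⟩ := hmain κ c b hK π hπ g θg hg ht hclose
  refine ⟨r, hr, fun p A ε hp1 hp2 hA hε hε2 Δ x K θhat hΔ hKn hlim hx hθ => ?_⟩
  set c₂ : ℝ := 1 + 2 * η / (1 - ρ) with hc₂
  have key : ∀ ξ : ℝ, 0 < ξ → ξ < 1 → ∃ N : ℕ, ∀ n > N,
      c₂ * (A / √ε) * (n : ℝ) ^ (-(1 / p)) * √(K n * Real.log (K n / ξ))
        ≤ c₂ * (A / √ε) * √2 * ((n : ℝ) ^ (-(1 / p)) * √(K n * Real.log (K n))) ∧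
      ∀ θ₀ : E m, ‖θ₀ - θg‖ ≤ r → sampleNoiseLaw m n g {ω |
          c₂ * (A / √ε) * (n : ℝ) ^ (-(1 / p)) * √(K n * Real.log (K n / ξ)) <
            ‖pgd Θ f κ c b π η (Δ n) (x n) θ₀ (K n) ω.1 ω.2 - θhat n ω.1‖}
        ≤ ENNReal.ofReal ξ := by
    intro ξ hξ hξ1
    -- The threshold 2 · 2^{m/2} for K_n brings the noise failure probability 2^{m/2} ξ²/K_n below
    -- ξ/2.
    have hrates := eventually_rates (p := p) (A := A) (ε := ε) (Δ := Δ) (x := x) (K := K)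
      hp1 hA hε hr hη hρ0 hρ1 hξ hξ1 (fun n hn => (hΔ n hn).2) hKn hlim
      (fun n hn => ⟨(hx n hn).2.1, (hx n hn).2.2.1⟩) (max 1 (2 * (2 : ℝ) ^ (m / 2 : ℝ)))
    have hkde := ENNReal.tendsto_nhds_zero.1 (tendsto_measure_root_kde hK hg hδ)
      (ENNReal.ofReal (ξ / 2)) (ENNReal.ofReal_pos.2 (by positivity))
    obtain ⟨N, hN⟩ := eventually_atTop.1 ((hrates.and hkde).and (eventually_ge_atTop 1))
    refine ⟨N, fun n hn => ?_⟩
    obtain ⟨⟨⟨hB, hL, hQ, hsmall, hbound⟩, hU⟩, hn1⟩ := hN n (le_of_lt hn)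
    refine ⟨?_, fun θ₀ hθ₀ => ?_⟩
    · calc _ = c₂ * (A / √ε) * ((n : ℝ) ^ (-(1 / p)) * √(K n * Real.log (K n / ξ))) := by ring
        _ ≤ c₂ * (A / √ε) * (√2 * ((n : ℝ) ^ (-(1 / p)) * √(K n * Real.log (K n)))) := by
            have : 0 < c₂ := by positivity
            gcongr
        _ = _ := by ring
    have hK1 : (1 : ℝ) ≤ K n := (le_max_left _ _).trans hB
    have hK2 : 2 * (2 : ℝ) ^ (m / 2 : ℝ) ≤ K n := (le_max_right _ _).trans hB
    -- With this radius exp(-t²/4) = (ξ/K_n)², so one factor K_n is absorbed by the union bound and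
    -- another remains for the constants.
    set t : ℝ := √(8 * Real.log (K n / ξ)) with ht_def
    have hL0 : 0 ≤ Real.log (K n / ξ) := Real.log_nonneg (by rw [le_div_iff₀ hξ]; linarith)
    have hV : noiseLaw m {z | ∃ k < K n, t < ‖z k‖} ≤ ENNReal.ofReal (ξ / 2) := by
      refine (noiseLaw_exists_lt_norm_le m (K n) t (Real.sqrt_nonneg _)).trans
        (ENNReal.ofReal_le_ofReal ?_)
      have hexp : Real.exp (-(t ^ 2 / 4)) = (ξ / K n) ^ 2 := by
        rw [ht_def, Real.sq_sqrt (by positivity),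
          show -(8 * Real.log (K n / ξ) / 4) = (2 : ℕ) * -Real.log (K n / ξ) by push_cast; ring,
          Real.exp_nat_mul, ← Real.log_inv, Real.exp_log (by positivity), inv_div]
      rw [hexp, div_pow, show (K n : ℝ) * ((2 : ℝ) ^ (m / 2 : ℝ) * (ξ ^ 2 / (K n : ℝ) ^ 2))
        = (2 : ℝ) ^ (m / 2 : ℝ) * ξ ^ 2 / K n by field_simp, div_le_iff₀ (by positivity)]
      have h1 : ξ ^ 2 ≤ ξ := by nlinarith
      have h2 : (0 : ℝ) < (2 : ℝ) ^ (m / 2 : ℝ) := by positivity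
      nlinarith
    have hsum : ENNReal.ofReal (ξ / 2) + ENNReal.ofReal (ξ / 2) = ENNReal.ofReal ξ := by
      rw [← ENNReal.ofReal_add (by positivity) (by positivity), add_halves]
    rw [← hsum]
    -- A large deviation forces a poor density estimate or a large noise vector, each of probability
    -- at most ξ/2. Neither bad event depends on the initial value, whence the uniformity.
    refine sampleNoiseLaw_le hg hU hV fun ω hω => ?_
    by_contra! hgood
    obtain ⟨hD, hz⟩ := hgood
    simp only [mem_ofPred_eq, not_lt, not_exists, not_and] at hD hz
    have := hpgd n ω.1 (θhat n ω.1) (hθ n hn1 ω.1) hD θ₀ hθ₀ (Δ n) (x n) t (K n) ω.2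
      (hΔ n hn1).2.1 (Real.sqrt_nonneg _) hz hsmall
    exact absurd hω (not_lt.2 (this.trans hbound))
  refine ⟨fun ξ hξ hξ1 => ?_, fun ξ hξ hξ1 => ?_⟩
  · obtain ⟨N, hN⟩ := key ξ hξ hξ1
    exact ⟨N, fun n hn => (hN n hn).2⟩
  · obtain ⟨N, hN⟩ := key ξ hξ hξ1
    refine ⟨c₂ * (A / √ε) * √2, N, fun n hn θ₀ hθ₀ => le_trans (measure_mono fun ω hω => ?_)
      ((hN n hn).2 θ₀ hθ₀)⟩
    exact lt_of_le_of_lt (hN n hn).1 hω
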